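/- For positive integers $k,n$ let $d_k(n)$ be the number of ordered $k$-tuples of positive integers with product $n$, and put $$a(k)=\prod_p\Big(1-\frac1p\Big)^{k^2}\sum_{m=0}^\infty\frac{d_k(p^m)^2}{p^m}.$$ Let $\beta(1)=1$ and, for $k\ge2$, $$\beta(k)=\frac1{(2\pi i)^{2k-1}}\int_{(b_{2k})}\cdots\int_{(b_2)}\bigg[\prod_{i=2}^k\prod_{j=k+1}^{2k}\frac1{s_i+s_j}\bigg]e^{s_2+\cdots+s_{2k}}\prod_{j=2}^k ds_j\prod_{j=k+1}^{2k}\frac{ds_j}{s_j},$$ where $\int_{(b)}=\int_{b-i\infty}^{b+i\infty}$ and the $b_j>0$ are arbitrary. Theorem. Fix integers $k\ge1$ and $B\ge0$. Then, as $x,q\to\infty$, with $x$ real and $q$ running over positive integers with at most $B$ distinct prime factors such that $x^k\le q$ and, if $k=1$, moreover $x/q\to0$, $$\frac1{\varphi(q)}\sum_{\chi\ne\chi_0}\Big|\sum_{n\le x}\chi(n)\Big|^{2k}\sim a(k)\,\beta(k)\prod_{p\mid q}\bigg(\sum_{m=0}^\infty\frac{d_k(p^m)^2}{p^m}\bigg)^{-1}\frac{\Gamma(2k-1)}{\Gamma(k)^2}\,x^k(\log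 x)^{(k-1)^2},$$ where $\chi$ runs over all Dirichlet characters modulo $q$ other than the principal character $\chi_0$. -/

import Mathlib

namespace CharSumMoments

open MeasureTheory

noncomputable section

/-- The `k`-fold divisor function: the number of ordered `k`-tuples of positive integers with
product `n`. -/
def divisorFun (k n : ℕ) : ℕ := (Nat.finMulAntidiag k n).card

/-- The local series `∑_{m ≥ 0} d_k(p^m)² / p^m`. -/
def localSum (k p : ℕ) : ℝ := ∑' m : ℕ, (divisorFun k (p ^ m) : ℝ) ^ 2 / (p : ℝ) ^ m

/-- The arithmetic factor `a(k) = ∏_p (1 - 1/p)^{k²} ∑_{m ≥ 0} d_k(p^m)² / p^m`. -/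
def arithFactor (k : ℕ) : ℝ :=
  ∏' p : Nat.Primes, (1 - 1 / ((p : ℕ) : ℝ)) ^ (k ^ 2) * localSum k p

/-- The point `b + i t` of the vertical line `Re s = b`. -/
def linePoint (b t : ℝ) : ℂ := (b : ℂ) + (t : ℂ) * Complex.I

/-- The integrand of `β(k)`, as a function of `u = (s_2, …, s_k)` and `v = (s_{k+1}, …, s_{2k})`. -/
def betaIntegrand (k : ℕ) (u : Fin (k - 1) → ℂ) (v : Fin k → ℂ) : ℂ :=
  (∏ i, ∏ j, 1 / (u i + v j)) * Complex.exp ((∑ i, u i) + ∑ j, v j) * ∏ j, 1 / v j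

/-- The constant `β(k)`: `β(1) = 1`, and for `k ≥ 2` it is `(2πi)^{-(2k-1)}` times the
`(2k-1)`-fold contour integral of `betaIntegrand` over the lines `Re s = b i` (for the first `k-1`
variables) and `Re s = c j` (for the last `k`). Each line is parametrised by `s = b + i t`, so that
`ds = i dt`; for `k ≥ 2` and positive abscissae the multiple integral converges absolutely. -/
def beta (k : ℕ) (b : Fin (k - 1) → ℝ) (c : Fin k → ℝ) : ℂ :=
  if k = 1 then 1
  else
    1 / (2 * (Real.pi : ℂ) * Complex.I) ^ (2 * k - 1) *
      ∫ t : (Fin (k - 1) → ℝ) × (Fin k → ℝ),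
        betaIntegrand k (fun i => linePoint (b i) (t.1 i)) (fun j => linePoint (c j) (t.2 j)) *
          Complex.I ^ (2 * k - 1)

open scoped Classical in
/-- `(1/φ(q)) ∑_{χ ≠ χ₀} |∑_{n ≤ x} χ(n)|^{2k}`, over all non-principal characters mod `q`. -/
def charMoment (k q : ℕ) [NeZero q] (x : ℝ) : ℝ :=
  1 / (q.totient : ℝ) *
    ∑ χ : DirichletCharacter ℂ q with χ ≠ 1,
      ‖∑ n ∈ Finset.Icc 1 ⌊x⌋₊, χ (n : ZMod q)‖ ^ (2 * k)

end

end CharSumMoments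

/-! Put `k = d + 1` and `X = ⌊x⌋`. By orthogonality, the sum over all characters is `φ(q)` times the
number of pairs of `k`-tuples in `[1, X]` with entries prime to `q` and congruent products; as `X^k
≤ q`, congruent products are equal. The principal character accounts for at most `X^{2k}/φ(q)`.
Since `φ(q) ≥ 2^{-B} q`, this is negligible, by a power of `log x` if `k ≥ 2` and by `x/q → 0` if `k
= 1`. What remains is to count the solutions of `n_1⋯n_k = m_1⋯m_k`, uniformly over the sets `R` of
at most `B` forbidden primes (`eventually_card_solSet_close`).

Every solution is given by the row and column products of a `k × k` matrix of positive integers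
(`exists_refinement`), so matrices with all row and column products at most `X` are counted. For a
fixed upper left `d × d` block `A`, the last row, last column and corner can be chosen in about
`C(2d,d) X^k / ∏ A` ways, provided that their ranges are long; the binomial coefficient, which is
`Γ(2k-1)/Γ(k)²`, is an explicit integral (`innerConst_eq_centralBinom`). With `A_e = X^{t_e}`, the
sum of `1/∏ A` turns into `(log X)^{d²}` times an integral over `t`, and the ranges are long
precisely when `t` is interior to the polytope of upper left blocks of bistochastic matrices. So the
count is asymptotic to `C(2d,d) · birkhoffVol d · X^k (log X)^{d²}`. Weights `n, m` with equal
products, put on the rows and columns, divide this by `∏ n` (`tendsto_matDensity`).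

A solution may come from several matrices. Hence every number is split into a factor composed of
primes of a finite set `S` and a cofactor free of them, and only the cofactors are written as
matrices. A matrix with pairwise coprime entries is determined by its margins (`entry_eq_gcd`);
otherwise a prime outside `R ∪ S` divides two entries, which happens in a proportion `O(∑ p^{-2})`
of cases. The smooth pairs with common product `N` number `d_k(N)²` and carry weight `1/N`, so they
produce the local sums over `S`; freeing the `k²` entries from the primes of `R ∪ S` produces the
factors `(1 - 1/p)^{k²}`. As `S` grows, `a(k) ∏_{p ∣ q} (local sum)^{-1}` appears.

Finally `β(k) = birkhoffVol d` (`beta_eq_birkhoffVol`): the rational part of the integrand of `β(k)`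
is the Laplace transform of the volume of `marginPolytope d ρ γ` in its margins `(ρ, γ)`, and the
exponential inverts it at margins all equal to `1`. Inversion needs absolute convergence of the
contour integral, proved by comparison with spanning stars of a bipartite graph, and continuity of
the volume at that point. -/

namespace CharSumMoments

open MeasureTheory Filter Topology

/-! ### Fourier inversion on a product of coordinate spaces. -/

section FourierInversion

open FourierTransform

/-- Splitting the coordinates of a Euclidean space indexed by a sum type. -/
noncomputable def splitCoord (ι κ : Type*) [Fintype ι] [Fintype κ] :
    EuclideanSpace ℝ (ι ⊕ κ) ≃ᵐ (ι → ℝ) × (κ → ℝ) :=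
  (MeasurableEquiv.toLp 2 (ι ⊕ κ → ℝ)).symm.trans
    (MeasurableEquiv.sumPiEquivProdPi (fun _ : ι ⊕ κ => ℝ))

section Inversion

variable {ι κ : Type*} [Fintype ι] [Fintype κ]

theorem splitCoord_apply (v : EuclideanSpace ℝ (ι ⊕ κ)) :
    splitCoord ι κ v = (fun i => v (Sum.inl i), fun j => v (Sum.inr j)) := rfl

theorem measurePreserving_splitCoord : MeasurePreserving (splitCoord ι κ) :=
  (volume_measurePreserving_sumPiEquivProdPi (fun _ : ι ⊕ κ => ℝ)).comp
    (PiLp.volume_preserving_ofLp (ι ⊕ κ))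

theorem continuous_splitCoord : Continuous (splitCoord ι κ) := by
  show Continuous fun v : EuclideanSpace ℝ (ι ⊕ κ) =>
    ((fun i => v (Sum.inl i), fun j => v (Sum.inr j)) : (ι → ℝ) × (κ → ℝ))
  fun_prop

/-- Fourier inversion on `ℝ^ι × ℝ^κ`, with the kernel `exp (-i⟨t, y⟩)`. -/
theorem fourier_inversion_prod (f : (ι → ℝ) × (κ → ℝ) → ℂ) (hf : Integrable f)
    (g : (ι → ℝ) × (κ → ℝ) → ℂ) (hg : Integrable g)
    (hfg : ∀ t, g t = ∫ y : (ι → ℝ) × (κ → ℝ),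
      Complex.exp (-(((∑ i, t.1 i * y.1 i) + ∑ j, t.2 j * y.2 j : ℝ) : ℂ) * Complex.I) * f y)
    (y₀ : (ι → ℝ) × (κ → ℝ)) (hc : ContinuousAt f y₀) :
    ∫ t : (ι → ℝ) × (κ → ℝ),
      Complex.exp ((((∑ i, t.1 i * y₀.1 i) + ∑ j, t.2 j * y₀.2 j : ℝ) : ℂ) * Complex.I) * g t
      = (2 * Real.pi) ^ (Fintype.card ι + Fintype.card κ) * f y₀ := by
  -- The inversion formula lives on an inner product space, so everything is transported along a
  -- volume preserving identification with Euclidean space.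
  set e := splitCoord ι κ with he
  have hmp : MeasurePreserving e := measurePreserving_splitCoord
  have hint : ∀ h : (ι → ℝ) × (κ → ℝ) → ℂ, ∫ v, h (e v) = ∫ y, h y := fun h =>
    hmp.integral_comp' h
  have hF : Integrable (fun v => f (e v)) := hmp.integrable_comp_of_integrable hf
  have hinner : ∀ v w : EuclideanSpace ℝ (ι ⊕ κ), inner ℝ v w =
      (∑ i, (e w).1 i * (e v).1 i) + ∑ j, (e w).2 j * (e v).2 j := by
    intro v w
    rw [PiLp.inner_apply, Fintype.sum_sum_type]
    simp [he, splitCoord_apply]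
  have h2pi : (2 * Real.pi) ≠ 0 := by positivity
  have hsmul : ∀ (r : ℝ) (v : EuclideanSpace ℝ (ι ⊕ κ)), e (r • v) = r • e v := by
    intro r v; rfl
  -- The kernel of `𝓕` is `exp (-2πi⟨v, w⟩)`, whence the dilation by `2π`. Undoing it at the end has
  -- a Jacobian, which is the source of the power of `2π` in the conclusion.
  have hFF : ∀ w, 𝓕 (fun v => f (e v)) w = g (e ((2 * Real.pi) • w)) := by
    intro w
    rw [Real.fourier_eq', hfg, ← hint]
    refine integral_congr_ae (Eventually.of_forall fun v => ?_)
    simp only [smul_eq_mul]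
    congr 2
    rw [hinner, hsmul]
    simp only [Prod.smul_fst, Prod.smul_snd, Pi.smul_apply, smul_eq_mul, mul_assoc,
      ← Finset.mul_sum, ← mul_add]
    push_cast
    ring
  have hG : Integrable (fun v => g (e v)) := hmp.integrable_comp_of_integrable hg
  have hFint : Integrable (𝓕 (fun v => f (e v))) := by
    rw [show 𝓕 (fun v => f (e v)) = fun w => (fun v => g (e v)) ((2 * Real.pi) • w) from
      funext hFF]
    exact hG.comp_smul h2pi
  have hcont : ContinuousAt (fun v => f (e v)) (e.symm y₀) := by
    refine ContinuousAt.comp (f := e) ?_ continuous_splitCoord.continuousAt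
    simpa using hc
  have key := hF.fourierInv_fourier_eq hFint hcont
  rw [Real.fourierInv_eq'] at key
  simp only [hFF, hinner, MeasurableEquiv.apply_symm_apply, smul_eq_mul] at key
  rw [← key, ← hint]
  have hs := Measure.integral_comp_smul (volume : Measure (EuclideanSpace ℝ (ι ⊕ κ)))
    (fun v => Complex.exp ((((∑ i, (e v).1 i * y₀.1 i) + ∑ j, (e v).2 j * y₀.2 j : ℝ) : ℂ) *
      Complex.I) * g (e v)) (2 * Real.pi)
  have hcong : (fun v : EuclideanSpace ℝ (ι ⊕ κ) =>
      Complex.exp (((2 * Real.pi * ((∑ i, y₀.1 i * (e v).1 i) +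
      ∑ j, y₀.2 j * (e v).2 j) : ℝ) : ℂ) * Complex.I) * g (e ((2 * Real.pi) • v))) =
    fun v => (fun v => Complex.exp ((((∑ i, (e v).1 i * y₀.1 i) +
      ∑ j, (e v).2 j * y₀.2 j : ℝ) : ℂ) * Complex.I) * g (e v)) ((2 * Real.pi) • v) := by
    funext v
    simp only [hsmul, Prod.smul_fst, Prod.smul_snd, Pi.smul_apply, smul_eq_mul, mul_assoc,
      ← Finset.mul_sum, ← mul_add]
    simp only [mul_comm (y₀.1 _), mul_comm (y₀.2 _)]
  rw [hcong, hs, finrank_euclideanSpace, Fintype.card_sum, abs_of_nonneg (by positivity),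
    Complex.real_smul, ← mul_assoc]
  push_cast
  rw [mul_inv_cancel₀ (by exact_mod_cast pow_ne_zero _ h2pi), one_mul]

end Inversion

end FourierInversion

theorem integrable_comp_linearEquiv {E F : Type*} [NormedAddCommGroup E] [NormedSpace ℝ E]
    [MeasurableSpace E] [BorelSpace E] [FiniteDimensional ℝ E] (μ : Measure E)
    [μ.IsAddHaarMeasure] [NormedAddCommGroup F] {f : E → F} (hf : Integrable f μ) (L : E ≃ₗ[ℝ] E) :
    Integrable (fun x => f (L x)) μ := by
  have hdet : LinearMap.det (L : E →ₗ[ℝ] E) ≠ 0 := (LinearEquiv.isUnit_det' L).ne_zero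
  have hmap := Measure.map_linearMap_addHaar_eq_smul_addHaar μ hdet
  have hcont : Continuous (L : E →ₗ[ℝ] E) := LinearMap.continuous_of_finiteDimensional _
  have hf' : Integrable f (Measure.map (L : E →ₗ[ℝ] E) μ) := by
    rw [hmap]
    exact hf.smul_measure ENNReal.ofReal_ne_top
  exact hf'.comp_measurable hcont.measurable

/-! ### Absolute convergence of products of `1 / (1 + |t_i + τ_j|)`, by spanning stars of a
bipartite graph. -/

section Star

variable {R κ : Type*} [Fintype R] [Fintype κ]

/-- The product of the weights of the edges at `i₀` or at `j₀` of the complete bipartite graph. -/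
noncomputable def starProd (w : R → κ → ℝ) (i₀ : R) (j₀ : κ) : ℝ :=
  (∏ j, w i₀ j) * (∏ i, w i j₀) / w i₀ j₀

theorem starProd_pos {w : R → κ → ℝ} (hw : ∀ i j, 0 < w i j) (i₀ : R) (j₀ : κ) :
    0 < starProd w i₀ j₀ :=
  div_pos (mul_pos (Finset.prod_pos fun j _ => hw _ j) (Finset.prod_pos fun i _ => hw i _)) (hw _ _)

/-- An edge `(i, j)` belongs to the stars with `i₀ = i` or `j₀ = j`, so to `|R| + |κ| - 1` of them;
the additional factor on the left avoids the subtraction. -/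
theorem prod_starProd_mul (w : R → κ → ℝ) (hw : ∀ i j, 0 < w i j) :
    (∏ e : R × κ, starProd w e.1 e.2) * (∏ e : R × κ, w e.1 e.2) =
      (∏ e : R × κ, w e.1 e.2) ^ (Fintype.card R + Fintype.card κ) := by
  rw [← Finset.prod_mul_distrib]
  have : ∀ e : R × κ, starProd w e.1 e.2 * w e.1 e.2 = (∏ j, w e.1 j) * ∏ i, w i e.2 := by
    intro e
    rw [starProd, div_mul_cancel₀ _ (hw _ _).ne']
  simp_rw [this, Finset.prod_mul_distrib]
  rw [Fintype.prod_prod_type, Fintype.prod_prod_type_right, Fintype.prod_prod_type]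
  simp only [Finset.prod_const, Finset.card_univ, Finset.prod_pow]
  rw [Finset.prod_comm (f := fun (y : κ) (x : R) => w x y), pow_add, mul_comm]

/-- Arithmetic-geometric mean over all stars, with equal weights. The exponent `p` is the one for
which the geometric mean of the `p`-th powers is exactly the product of all edge weights. -/
theorem prod_le_sum_starProd_rpow (w : R → κ → ℝ) (hw : ∀ i j, 0 < w i j) [Nonempty R]
    [Nonempty κ] {p : ℝ}
    (hp : p * (Fintype.card R + Fintype.card κ - 1) = Fintype.card R * Fintype.card κ) :
    ∏ e : R × κ, w e.1 e.2 ≤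
      ∑ e : R × κ, (1 / (Fintype.card R * Fintype.card κ : ℝ)) * starProd w e.1 e.2 ^ p := by
  set r : ℝ := (Fintype.card R : ℝ) with hr
  set c : ℝ := (Fintype.card κ : ℝ) with hc
  have hr1 : 1 ≤ r := by rw [hr]; exact_mod_cast Fintype.card_pos
  have hc1 : 1 ≤ c := by rw [hc]; exact_mod_cast Fintype.card_pos
  have hprodpos : 0 < ∏ e : R × κ, w e.1 e.2 := Finset.prod_pos fun e _ => hw _ _
  have hS : ∀ e : R × κ, 0 < starProd w e.1 e.2 := fun e => starProd_pos hw _ _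
  have h := Real.geom_mean_le_arith_mean_weighted (Finset.univ : Finset (R × κ))
    (fun _ => 1 / (r * c)) (fun e => starProd w e.1 e.2 ^ p) (fun _ _ => by positivity)
    (by
      simp only [Finset.sum_const, Finset.card_univ, Fintype.card_prod, nsmul_eq_mul]
      push_cast
      rw [← hr, ← hc]
      field_simp) (fun e _ => (Real.rpow_pos_of_pos (hS e) _).le)
  refine le_trans (le_of_eq ?_) h
  have hprod : ∏ e : R × κ, starProd w e.1 e.2 = (∏ e : R × κ, w e.1 e.2) ^ (r + c - 1) := by
    have h1 := prod_starProd_mul w hw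
    rw [Real.rpow_sub_one hprodpos.ne', eq_div_iff hprodpos.ne', h1, hr, hc, ← Nat.cast_add,
      Real.rpow_natCast]
  simp_rw [← Real.rpow_mul (hS _).le]
  rw [Real.finsetProd_rpow _ _ (fun e _ => (hS e).le), hprod, ← Real.rpow_mul hprodpos.le]
  have : (r + c - 1) * (p * (1 / (r * c))) = 1 := by
    rw [← mul_assoc, mul_comm _ p, hp]
    field_simp
  rw [this, Real.rpow_one]

end Star

section Integrability

variable {ι κ : Type*}

/-- The kernel `1 / (1 + |t_i + τ_j|)`, with `t = 0` at the additional index `none`. -/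
noncomputable def bracketKernel (y : (ι → ℝ) × (κ → ℝ)) (i : Option ι) (j : κ) : ℝ :=
  (1 + |i.elim 0 y.1 + y.2 j|)⁻¹

theorem bracketKernel_pos (y : (ι → ℝ) × (κ → ℝ)) (i : Option ι) (j : κ) :
    0 < bracketKernel y i j := by
  unfold bracketKernel
  positivity

/-- The shear `(t, τ) ↦ (t + τ_{j₀}, τ)`. -/
def shearEquiv (ι : Type*) (j₀ : κ) : ((ι → ℝ) × (κ → ℝ)) ≃ₗ[ℝ] ((ι → ℝ) × (κ → ℝ)) where
  toFun y := (fun i => y.1 i + y.2 j₀, y.2)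
  invFun y := (fun i => y.1 i - y.2 j₀, y.2)
  left_inv y := by ext <;> simp
  right_inv y := by ext <;> simp
  map_add' y y' := by
    ext i
    · simp only [Prod.fst_add, Prod.snd_add, Pi.add_apply]; ring
    · simp
  map_smul' r y := by
    ext i
    · simp only [Prod.smul_fst, Prod.smul_snd, Pi.smul_apply, smul_eq_mul, RingHom.id_apply]; ring
    · simp

/-- The involution of `ℝ^ι × ℝ^κ` exchanging the role of `t_a` and of the base point `0`. -/
def swapBase [DecidableEq ι] (κ : Type*) (a : ι) : ((ι → ℝ) × (κ → ℝ)) ≃ₗ[ℝ] ((ι → ℝ) × (κ → ℝ)) where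
  toFun y := (fun i => (if i = a then 0 else y.1 i) - y.1 a, fun j => y.2 j + y.1 a)
  invFun y := (fun i => (if i = a then 0 else y.1 i) - y.1 a, fun j => y.2 j + y.1 a)
  left_inv y := by
    ext i
    · by_cases h : i = a <;> simp [h]
    · simp
  right_inv y := by
    ext i
    · by_cases h : i = a <;> simp [h]
    · simp
  map_add' y y' := by
    ext i
    · by_cases h : i = a
      · simp [h]; ring
      · simp [h]; ring
    · simp; ring
  map_smul' r y := by
    ext i
    · by_cases h : i = a
      · simp [h]
      · simp [h]; ring
    · simp; ring

variable [Fintype ι] [Fintype κ]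

instance : (volume : Measure ((ι → ℝ) × (κ → ℝ))).IsAddHaarMeasure := by
  rw [Measure.volume_eq_prod]
  exact Measure.prod.instIsAddHaarMeasure _ _

/-- A star is a spanning tree, so its edges carry as many independent linear forms as there are
variables. The shear makes these forms the coordinates, and the integral factors into integrals of
`(1 + |x|)^{-p}`. -/
theorem integrable_starProd_none (j₀ : κ) {p : ℝ} (hp : 1 < p) :
    Integrable (fun y : (ι → ℝ) × (κ → ℝ) => starProd (bracketKernel y) none j₀ ^ p) := by
  have h1 : Integrable (fun x : ℝ => (1 + ‖x‖) ^ (-p)) :=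
    integrable_one_add_norm (by simpa using hp)
  have h2 : Integrable (fun y : (ι → ℝ) × (κ → ℝ) =>
      (∏ i, (1 + ‖y.1 i‖) ^ (-p)) * ∏ j, (1 + ‖y.2 j‖) ^ (-p)) :=
    Integrable.mul_prod (f := fun t : ι → ℝ => ∏ i, (1 + ‖t i‖) ^ (-p))
      (g := fun τ : κ → ℝ => ∏ j, (1 + ‖τ j‖) ^ (-p))
      (Integrable.fintype_prod (μ := fun _ => volume) fun _ => h1)
      (Integrable.fintype_prod (μ := fun _ => volume) fun _ => h1)
  have h3 := integrable_comp_linearEquiv volume h2 (shearEquiv ι j₀)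
  refine h3.congr (Eventually.of_forall fun y => ?_)
  have hpos : ∀ x : ℝ, 0 ≤ (1 + |x|)⁻¹ := fun x => by positivity
  have hne : (1 + |(0 : ℝ) + y.2 j₀|)⁻¹ ≠ 0 := by positivity
  have hrp : ∀ x : ℝ, ((1 + |x|)⁻¹) ^ p = (1 + |x|) ^ (-p) := fun x => by
    rw [Real.rpow_neg (by positivity), Real.inv_rpow (by positivity)]
  simp only [starProd, bracketKernel, Fintype.prod_option, Option.elim, shearEquiv,
    LinearEquiv.coe_mk, LinearMap.coe_mk, AddHom.coe_mk, Real.norm_eq_abs]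
  rw [mul_comm (1 + |(0 : ℝ) + y.2 j₀|)⁻¹, ← mul_assoc, mul_div_assoc, div_self hne, mul_one,
    Real.mul_rpow (Finset.prod_nonneg fun _ _ => hpos _) (Finset.prod_nonneg fun _ _ => hpos _),
    ← Real.finsetProd_rpow _ _ (fun _ _ => hpos _), ← Real.finsetProd_rpow _ _ (fun _ _ => hpos _)]
  simp only [hrp, zero_add]
  rw [mul_comm]

variable [DecidableEq ι]

/-- Only the sums `t_i + τ_j` matter, and these are unchanged if a constant is moved from the `t_i`,
the base `0` included, to the `τ_j`. So the base vertex `none` is on a par with every other row. -/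
theorem starProd_swapBase (a : ι) (j₀ : κ) (y : (ι → ℝ) × (κ → ℝ)) :
    starProd (bracketKernel (swapBase κ a y)) none j₀ =
      starProd (bracketKernel y) (some a) j₀ := by
  have hne : ∀ x : ℝ, (1 + |x|)⁻¹ ≠ 0 := fun x => by positivity
  simp only [starProd, bracketKernel, Fintype.prod_option, Option.elim, swapBase,
    LinearEquiv.coe_mk, LinearMap.coe_mk, AddHom.coe_mk, zero_add]
  rw [← Finset.mul_prod_erase Finset.univ
      (fun i => (1 + |(if i = a then 0 else y.1 i) - y.1 a + (y.2 j₀ + y.1 a)|)⁻¹)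
      (Finset.mem_univ a),
    ← Finset.mul_prod_erase Finset.univ (fun i => (1 + |y.1 i + y.2 j₀|)⁻¹) (Finset.mem_univ a)]
  have hE : ∏ i ∈ Finset.univ.erase a,
        (1 + |(if i = a then 0 else y.1 i) - y.1 a + (y.2 j₀ + y.1 a)|)⁻¹ =
      ∏ i ∈ Finset.univ.erase a, (1 + |y.1 i + y.2 j₀|)⁻¹ := by
    refine Finset.prod_congr rfl fun i hi => ?_
    rw [if_neg (Finset.ne_of_mem_erase hi)]
    congr 3
    ring
  have hP : ∏ j, (1 + |y.2 j + y.1 a|)⁻¹ = ∏ j, (1 + |y.1 a + y.2 j|)⁻¹ :=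
    Finset.prod_congr rfl fun j _ => by rw [add_comm (y.2 j)]
  rw [hE, hP, if_pos rfl, show (0 : ℝ) - y.1 a + (y.2 j₀ + y.1 a) = y.2 j₀ by ring,
    add_comm (y.2 j₀) (y.1 a)]
  have h1 := hne (y.1 a + y.2 j₀)
  field_simp

theorem integrable_starProd (i₀ : Option ι) (j₀ : κ) {p : ℝ} (hp : 1 < p) :
    Integrable (fun y : (ι → ℝ) × (κ → ℝ) => starProd (bracketKernel y) i₀ j₀ ^ p) := by
  cases i₀ with
  | none => exact integrable_starProd_none j₀ hp
  | some a =>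
    have h := integrable_comp_linearEquiv volume (integrable_starProd_none (ι := ι) j₀ hp)
      (swapBase κ a)
    simpa only [starProd_swapBase] using h

/-- With `r` rows, the base included, and `c` columns, the exponent `rc / (r + c - 1)` exceeds `1`
because `(r - 1)(c - 1) > 0`. All stars are then integrable at this exponent, and they dominate the
full product. -/
theorem integrable_prod_bracketKernel (hι : 1 ≤ Fintype.card ι) (hκ : 2 ≤ Fintype.card κ) :
    Integrable (fun y : (ι → ℝ) × (κ → ℝ) =>
      ∏ e : Option ι × κ, bracketKernel y e.1 e.2) := by
  have : Nonempty κ := Fintype.card_pos_iff.1 (by omega)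
  have hr : (1 : ℝ) ≤ Fintype.card ι := by exact_mod_cast hι
  have hc : (2 : ℝ) ≤ Fintype.card κ := by exact_mod_cast hκ
  set r : ℝ := (Fintype.card (Option ι) : ℝ) with hrdef
  set c : ℝ := (Fintype.card κ : ℝ) with hcdef
  have hr2 : 2 ≤ r := by
    rw [hrdef, Fintype.card_option]
    push_cast
    linarith
  have hpos : 0 < r + c - 1 := by linarith
  have hp : 1 < r * c / (r + c - 1) := by
    rw [lt_div_iff₀ hpos]
    nlinarith
  have hsum : Integrable (fun y : (ι → ℝ) × (κ → ℝ) => ∑ e : Option ι × κ,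
      (1 / (r * c)) * starProd (bracketKernel y) e.1 e.2 ^ (r * c / (r + c - 1))) :=
    integrable_finsetSum _ fun e _ => (integrable_starProd e.1 e.2 hp).const_mul _
  refine hsum.mono' ?_ (Eventually.of_forall fun y => ?_)
  · refine Continuous.aestronglyMeasurable ?_
    unfold bracketKernel
    refine continuous_finsetProd _ fun e _ => ?_
    rcases e with ⟨_ | i, j⟩
    · simp only [Option.elim]
      refine Continuous.inv₀ (by fun_prop) fun y => by positivity
    · simp only [Option.elim]
      refine Continuous.inv₀ (by fun_prop) fun y => by positivity
  · rw [Real.norm_of_nonneg (Finset.prod_nonneg fun e _ => (bracketKernel_pos y _ _).le)]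
    refine prod_le_sum_starProd_rpow _ (fun i j => bracketKernel_pos y i j) ?_
    rw [div_mul_cancel₀ _ hpos.ne']

end Integrability

/-! ### The polytope of matrices with bounded margins and its volume. -/

theorem ae_linear_ne {J : Type*} [Fintype J] (f : (J → ℝ) →ₗ[ℝ] ℝ) (hf : f ≠ 0) (c : ℝ) :
    ∀ᵐ x : J → ℝ, f x ≠ c := by
  by_cases hne : ∃ x₀, f x₀ = c
  · obtain ⟨x₀, hx₀⟩ := hne
    have hker : LinearMap.ker f ≠ ⊤ := fun h => hf (LinearMap.ker_eq_top.1 h)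
    have h0 : volume (AffineSubspace.mk' x₀ (LinearMap.ker f) : Set (J → ℝ)) = 0 := by
      refine Measure.addHaar_affineSubspace volume _ fun h => hker ?_
      have := congrArg AffineSubspace.direction h
      simpa using this
    refine measure_mono_null (fun x hx => ?_) h0
    have hx' : f x = c := by simpa using hx
    simp [AffineSubspace.mem_mk', hx', hx₀]
  · push Not at hne
    exact Eventually.of_forall hne

/-- The matrices with nonnegative entries, row sums at most `ρ`, column sums at most the first
`d` entries of `γ`, and total defect of the row sums at most the last entry of `γ`. -/
def marginPolytope (d : ℕ) (ρ : Fin d → ℝ) (γ : Fin (d + 1) → ℝ) : Set (Fin d × Fin d → ℝ) :=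
  {x | (∀ e, 0 ≤ x e) ∧ (∀ i, ∑ j, x (i, j) ≤ ρ i) ∧ (∀ j, ∑ i, x (i, j) ≤ γ j.castSucc) ∧
    ∑ i, (ρ i - ∑ j, x (i, j)) ≤ γ (Fin.last d)}

/-- The volume of the Birkhoff polytope of bistochastic `(d + 1) × (d + 1)` matrices, in the
coordinates given by the upper left `d × d` block. -/
noncomputable def birkhoffVol (d : ℕ) : ℝ := volume.real (marginPolytope d 1 1)

/-- These hyperplanes carry the faces of `marginPolytope d 1 1` other than the coordinate ones;
total `d - 1` is the case of equality in the defect condition. -/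
theorem ae_margins_ne (d : ℕ) : ∀ᵐ x : Fin d × Fin d → ℝ,
    (∀ i, ∑ j, x (i, j) ≠ 1) ∧ (∀ j, ∑ i, x (i, j) ≠ 1) ∧ ∑ e, x e ≠ (d : ℝ) - 1 := by
  have hrow : ∀ i : Fin d, ∀ᵐ x : Fin d × Fin d → ℝ, ∑ j, x (i, j) ≠ 1 := by
    intro i
    have h := ae_linear_ne (∑ j, LinearMap.proj (i, j) : (Fin d × Fin d → ℝ) →ₗ[ℝ] ℝ) (fun h => by
      have h1 := LinearMap.congr_fun h (Pi.single (i, i) 1)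
      simp [LinearMap.sum_apply, Pi.single_apply] at h1) 1
    simpa [LinearMap.sum_apply] using h
  have hcol : ∀ j : Fin d, ∀ᵐ x : Fin d × Fin d → ℝ, ∑ i, x (i, j) ≠ 1 := by
    intro j
    have h := ae_linear_ne (∑ i, LinearMap.proj (i, j) : (Fin d × Fin d → ℝ) →ₗ[ℝ] ℝ) (fun h => by
      have h1 := LinearMap.congr_fun h (Pi.single (j, j) 1)
      simp [LinearMap.sum_apply, Pi.single_apply] at h1) 1
    simpa [LinearMap.sum_apply] using h
  have htot : ∀ᵐ x : Fin d × Fin d → ℝ, ∑ e, x e ≠ (d : ℝ) - 1 := by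
    rcases Nat.eq_zero_or_pos d with rfl | hd
    · refine Eventually.of_forall fun x => ?_
      simp
    · have h := ae_linear_ne (∑ e, LinearMap.proj e : (Fin d × Fin d → ℝ) →ₗ[ℝ] ℝ) (fun h => by
        have h1 := LinearMap.congr_fun h (Pi.single (⟨0, hd⟩, ⟨0, hd⟩) 1)
        simp [LinearMap.sum_apply, Pi.single_apply] at h1) ((d : ℝ) - 1)
      simpa [LinearMap.sum_apply] using h
  filter_upwards [ae_all_iff.2 hrow, ae_all_iff.2 hcol, htot] with x h1 h2 h3
  exact ⟨h1, h2, h3⟩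

theorem isClosed_setOf_mem_marginPolytope (d : ℕ) :
    IsClosed {z : (Fin d × Fin d → ℝ) × ((Fin d → ℝ) × (Fin (d + 1) → ℝ)) |
      z.1 ∈ marginPolytope d z.2.1 z.2.2} := by
  simp only [marginPolytope, Set.mem_ofPred_eq]
  simp only [Set.ofPred_and, Set.ofPred_forall]
  refine IsClosed.inter ?_ (IsClosed.inter ?_ (IsClosed.inter ?_ ?_))
  · exact isClosed_iInter fun e => isClosed_le (by fun_prop) (by fun_prop)
  · exact isClosed_iInter fun e => isClosed_le (by fun_prop) (by fun_prop)
  · exact isClosed_iInter fun e => isClosed_le (by fun_prop) (by fun_prop)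
  · exact isClosed_le (by fun_prop) (by fun_prop)

theorem measurableSet_marginPolytope (d : ℕ) (ρ : Fin d → ℝ) (γ : Fin (d + 1) → ℝ) :
    MeasurableSet (marginPolytope d ρ γ) :=
  ((isClosed_setOf_mem_marginPolytope d).preimage
    (f := fun x : Fin d × Fin d → ℝ => (x, (ρ, γ))) (by fun_prop)).measurableSet

theorem marginPolytope_subset_Icc {d : ℕ} {ρ : Fin d → ℝ} {γ : Fin (d + 1) → ℝ} {c : ℝ}
    (hρ : ∀ i, ρ i ≤ c) : marginPolytope d ρ γ ⊆ Set.Icc 0 (fun _ => c) := by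
  rintro x ⟨h0, h1, -, -⟩
  refine ⟨fun e => h0 e, fun e => ?_⟩
  calc x e ≤ ∑ j, x (e.1, j) :=
        Finset.single_le_sum (f := fun j => x (e.1, j)) (fun j _ => h0 _) (Finset.mem_univ e.2)
    _ ≤ c := (h1 _).trans (hρ _)

theorem birkhoffVol_pos (d : ℕ) : 0 < birkhoffVol d := by
  have hfin : volume (marginPolytope d 1 1) ≠ ⊤ :=
    ((measure_mono (marginPolytope_subset_Icc (c := 1) fun i => le_rfl)).trans_lt
      isCompact_Icc.measure_lt_top).ne
  refine ENNReal.toReal_pos ?_ hfin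
  have hopen : IsOpen {x : Fin d × Fin d → ℝ | (∀ e, 0 < x e) ∧ (∀ i, ∑ j, x (i, j) < 1) ∧
      (∀ j, ∑ i, x (i, j) < 1) ∧ ∑ i : Fin d, (1 - ∑ j, x (i, j)) < 1} := by
    simp only [Set.ofPred_and, Set.ofPred_forall]
    refine IsOpen.inter ?_ (IsOpen.inter ?_ (IsOpen.inter ?_ ?_))
    · exact isOpen_iInter_of_finite fun e => isOpen_lt (by fun_prop) (by fun_prop)
    · exact isOpen_iInter_of_finite fun e => isOpen_lt (by fun_prop) (by fun_prop)
    · exact isOpen_iInter_of_finite fun e => isOpen_lt (by fun_prop) (by fun_prop)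
    · exact isOpen_lt (by fun_prop) (by fun_prop)
  have hdpos : (0 : ℝ) < d + 1 := by positivity
  have hne : Set.Nonempty {x : Fin d × Fin d → ℝ | (∀ e, 0 < x e) ∧ (∀ i, ∑ j, x (i, j) < 1) ∧
      (∀ j, ∑ i, x (i, j) < 1) ∧ ∑ i : Fin d, (1 - ∑ j, x (i, j)) < 1} := by
    have h1 : (d : ℝ) * (1 / (d + 1)) < 1 := by
      rw [mul_one_div, div_lt_one hdpos]
      linarith
    -- The block of the bistochastic matrix with all entries equal is an interior point.
    refine ⟨fun _ => 1 / ((d : ℝ) + 1), fun e => by positivity, fun i => ?_, fun j => ?_, ?_⟩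
    · simpa using h1
    · simpa using h1
    · have h2 : (d : ℝ) * (1 - d * (1 / (d + 1))) < 1 := by
        have : (1 : ℝ) - d * (1 / (d + 1)) = 1 / (d + 1) := by field_simp; ring
        rw [this]
        exact h1
      simpa [mul_sub] using h2
  refine ((hopen.measure_pos volume hne).trans_le (measure_mono ?_)).ne'
  rintro x ⟨h0, h1, h2, h3⟩
  exact ⟨fun e => (h0 e).le, fun i => (h1 i).le, fun j => (h2 j).le, h3.le⟩

theorem eventually_le_iff_of_ne {Y : Type*} [TopologicalSpace Y] {f g : Y → ℝ} {y₀ : Y}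
    (hf : ContinuousAt f y₀) (hg : ContinuousAt g y₀) (h : f y₀ ≠ g y₀) :
    ∀ᶠ y in 𝓝 y₀, (f y ≤ g y ↔ f y₀ ≤ g y₀) := by
  rcases lt_or_gt_of_ne h with hlt | hgt
  · filter_upwards [hf.eventually_lt hg hlt] with y hy
    exact iff_of_true hy.le hlt.le
  · filter_upwards [hg.eventually_lt hf hgt] with y hy
    exact iff_of_false (not_le.2 hy) (not_le.2 hgt)

/-- For almost every `x` no margin inequality is an equality at `(1, 1)`, so membership of `x` is
locally constant in the margins there; dominated convergence on a fixed box does the rest. Pointwise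
Fourier inversion needs this. -/
theorem continuousAt_volume_marginPolytope (d : ℕ) :
    ContinuousAt (fun y : (Fin d → ℝ) × (Fin (d + 1) → ℝ) =>
      volume.real (marginPolytope d y.1 y.2)) (1, 1) := by
  have heq : (fun y : (Fin d → ℝ) × (Fin (d + 1) → ℝ) =>
      volume.real (marginPolytope d y.1 y.2)) = fun y =>
        ∫ x, (marginPolytope d y.1 y.2).indicator (fun _ => (1 : ℝ)) x := by
    funext y
    rw [integral_indicator (measurableSet_marginPolytope d _ _)]
    simp
  rw [heq]
  refine continuousAt_of_dominated
    (bound := (Set.Icc (0 : Fin d × Fin d → ℝ) (fun _ => 2)).indicator (fun _ => (1 : ℝ)))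
    (Eventually.of_forall fun y => ?_) ?_ ?_ ?_
  · exact (measurable_const.indicator (measurableSet_marginPolytope d _ _)).aestronglyMeasurable
  · have hev : ∀ᶠ y : (Fin d → ℝ) × (Fin (d + 1) → ℝ) in 𝓝 (1, 1), ∀ i, y.1 i ≤ 2 := by
      refine eventually_all.2 fun i => ?_
      have hc : ContinuousAt (fun y : (Fin d → ℝ) × (Fin (d + 1) → ℝ) => y.1 i) (1, 1) := by
        fun_prop
      exact (hc.eventually_lt continuousAt_const (by norm_num)).mono fun y hy => hy.le
    filter_upwards [hev] with y hy
    refine Eventually.of_forall fun x => ?_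
    by_cases hx : x ∈ marginPolytope d y.1 y.2
    · rw [Set.indicator_of_mem hx, Set.indicator_of_mem (marginPolytope_subset_Icc hy hx)]
      simp
    · rw [Set.indicator_of_notMem hx]
      simp only [norm_zero]
      exact Set.indicator_nonneg (fun _ _ => zero_le_one) _
  · exact (integrable_indicator_iff measurableSet_Icc).2
      (integrableOn_const isCompact_Icc.measure_lt_top.ne)
  · filter_upwards [ae_margins_ne d] with x hx
    obtain ⟨h1, h2, h3⟩ := hx
    have e1 : ∀ᶠ y : (Fin d → ℝ) × (Fin (d + 1) → ℝ) in 𝓝 (1, 1),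
        ∀ i, (∑ j, x (i, j) ≤ y.1 i ↔ ∑ j, x (i, j) ≤ 1) := eventually_all.2 fun i =>
      eventually_le_iff_of_ne (f := fun _ => ∑ j, x (i, j))
        (g := fun y : (Fin d → ℝ) × (Fin (d + 1) → ℝ) => y.1 i) continuousAt_const
        (by fun_prop) (h1 i)
    have e2 : ∀ᶠ y : (Fin d → ℝ) × (Fin (d + 1) → ℝ) in 𝓝 (1, 1),
        ∀ j : Fin d, (∑ i, x (i, j) ≤ y.2 j.castSucc ↔ ∑ i, x (i, j) ≤ 1) :=
      eventually_all.2 fun j =>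
      eventually_le_iff_of_ne (f := fun _ => ∑ i, x (i, j))
        (g := fun y : (Fin d → ℝ) × (Fin (d + 1) → ℝ) => y.2 j.castSucc) continuousAt_const
        (by fun_prop) (h2 j)
    have e3 : ∀ᶠ y : (Fin d → ℝ) × (Fin (d + 1) → ℝ) in 𝓝 (1, 1),
        (∑ i, (y.1 i - ∑ j, x (i, j)) ≤ y.2 (Fin.last d) ↔
          ∑ i : Fin d, (1 - ∑ j, x (i, j)) ≤ 1) := by
      refine eventually_le_iff_of_ne
        (f := fun y : (Fin d → ℝ) × (Fin (d + 1) → ℝ) => ∑ i, (y.1 i - ∑ j, x (i, j)))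
        (g := fun y => y.2 (Fin.last d)) (by fun_prop) (by fun_prop) ?_
      intro h
      refine h3 ?_
      simp only [Pi.one_apply, Finset.sum_sub_distrib, Finset.sum_const, Finset.card_univ,
        Fintype.card_fin, nsmul_eq_mul, mul_one] at h
      rw [Fintype.sum_prod_type]
      linarith
    refine continuousAt_const.congr (f := fun _ => (marginPolytope d 1 1).indicator
      (fun _ => (1 : ℝ)) x) ?_
    filter_upwards [e1, e2, e3] with y hy1 hy2 hy3
    have : x ∈ marginPolytope d y.1 y.2 ↔ x ∈ marginPolytope d 1 1 := by
      simp only [marginPolytope, Set.mem_ofPred_eq, hy1, hy2, hy3, Pi.one_apply]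
    by_cases hm : x ∈ marginPolytope d 1 1
    · rw [Set.indicator_of_mem hm, Set.indicator_of_mem (this.2 hm)]
    · rw [Set.indicator_of_notMem hm, Set.indicator_of_notMem (fun h => hm (this.1 h))]

/-! ### The Laplace transform of the polytope volume. -/

/-- The function `y ↦ exp (-z y)` cut off to `[0, ∞)`. -/
noncomputable def expTail (z : ℂ) (y : ℝ) : ℂ := if 0 ≤ y then Complex.exp (-z * y) else 0

theorem expTail_eq_indicator (z : ℂ) :
    expTail z = (Set.Ici (0 : ℝ)).indicator fun y : ℝ => Complex.exp (-z * y) := by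
  funext y
  simp [expTail, Set.indicator_apply]

theorem integrable_expTail {z : ℂ} (hz : 0 < z.re) : Integrable (expTail z) := by
  rw [expTail_eq_indicator, integrable_indicator_iff measurableSet_Ici, integrableOn_Ici_iff_integrableOn_Ioi]
  exact integrableOn_exp_mul_complex_Ioi (by simpa using hz) 0

theorem integral_expTail {z : ℂ} (hz : 0 < z.re) : ∫ y, expTail z y = 1 / z := by
  rw [expTail_eq_indicator, integral_indicator measurableSet_Ici, integral_Ici_eq_integral_Ioi,
    integral_exp_mul_complex_Ioi (by simpa using hz)]
  have : z ≠ 0 := fun h => by simp [h] at hz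
  simp

section

variable {d : ℕ}

/-- The threshold vector for the column variables. -/
def colThreshold (x : Fin d × Fin d → ℝ) (ρ : Fin d → ℝ) : Fin (d + 1) → ℝ :=
  Fin.snoc (fun j => ∑ i, x (i, j)) (∑ i, (ρ i - ∑ j, x (i, j)))

/-- The shear which turns the inequalities defining `marginPolytope` into nonnegativity. -/
def marginShear (z : (Fin d × Fin d → ℝ) × ((Fin d → ℝ) × (Fin (d + 1) → ℝ))) :
    (Fin d × Fin d → ℝ) × ((Fin d → ℝ) × (Fin (d + 1) → ℝ)) :=
  (z.1, (z.2.1 - fun i => ∑ j, z.1 (i, j), z.2.2 - colThreshold z.1 z.2.1))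

theorem continuous_colThreshold :
    Continuous fun z : (Fin d × Fin d → ℝ) × (Fin d → ℝ) => colThreshold z.1 z.2 := by
  refine continuous_pi fun j => ?_
  refine Fin.lastCases ?_ (fun j => ?_) j
  · simp only [colThreshold, Fin.snoc_last]
    fun_prop
  · simp only [colThreshold, Fin.snoc_castSucc]
    fun_prop

/-- The map is triangular: `ρ` is translated by a function of `x`, and `γ` by a function of `x` and
`ρ`. -/
theorem measurePreserving_marginShear : MeasurePreserving (marginShear (d := d)) := by
  refine MeasurePreserving.skew_product (MeasurePreserving.id _)
    (g := fun x (y : (Fin d → ℝ) × (Fin (d + 1) → ℝ)) =>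
      (y.1 - fun i => ∑ j, x (i, j), y.2 - colThreshold x y.1)) ?_
    (Eventually.of_forall fun x => ?_)
  · have h := continuous_colThreshold (d := d)
    have h2 : Continuous fun z : (Fin d × Fin d → ℝ) × ((Fin d → ℝ) × (Fin (d + 1) → ℝ)) =>
        colThreshold z.1 z.2.1 :=
      h.comp (g := fun z : (Fin d × Fin d → ℝ) × (Fin d → ℝ) => colThreshold z.1 z.2)
        (f := fun z : (Fin d × Fin d → ℝ) × ((Fin d → ℝ) × (Fin (d + 1) → ℝ)) => (z.1, z.2.1))
        (by fun_prop)
    refine Continuous.measurable ?_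
    unfold Function.uncurry
    fun_prop
  · refine (MeasurePreserving.skew_product (μb := volume) (μd := volume)
      (measurePreserving_sub_right volume (fun i => ∑ j, x (i, j)))
      (g := fun ρ (γ : Fin (d + 1) → ℝ) => γ - colThreshold x ρ) ?_
      (Eventually.of_forall fun ρ => ?_)).map_eq
    · have h2 : Continuous fun z : (Fin d → ℝ) × (Fin (d + 1) → ℝ) => colThreshold x z.1 :=
        (continuous_colThreshold (d := d)).comp
          (g := fun z : (Fin d × Fin d → ℝ) × (Fin d → ℝ) => colThreshold z.1 z.2)
          (f := fun z : (Fin d → ℝ) × (Fin (d + 1) → ℝ) => (x, z.1)) (by fun_prop)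
      refine Continuous.measurable ?_
      unfold Function.uncurry
      fun_prop
    · exact (measurePreserving_sub_right volume (colThreshold x ρ)).map_eq

/-- The exponential kernel carried by `marginPolytope`. -/
noncomputable def marginKernel (u : Fin d → ℂ) (v : Fin (d + 1) → ℂ)
    (z : (Fin d × Fin d → ℝ) × ((Fin d → ℝ) × (Fin (d + 1) → ℝ))) : ℂ :=
  {z : (Fin d × Fin d → ℝ) × ((Fin d → ℝ) × (Fin (d + 1) → ℝ)) |
    z.1 ∈ marginPolytope d z.2.1 z.2.2}.indicator
    (fun z => Complex.exp (-((∑ i, u i * z.2.1 i) + ∑ j, v j * z.2.2 j))) z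

/-- The kernel `marginKernel` in the coordinates given by `marginShear`. -/
noncomputable def productKernel (u : Fin d → ℂ) (v : Fin (d + 1) → ℂ)
    (z : (Fin d × Fin d → ℝ) × ((Fin d → ℝ) × (Fin (d + 1) → ℝ))) : ℂ :=
  (∏ e : Fin d × Fin d, expTail (u e.1 + v e.2.castSucc) (z.1 e)) *
    ((∏ i, expTail (u i + v (Fin.last d)) (z.2.1 i)) * ∏ j, expTail (v j) (z.2.2 j))

/-- The new coordinates are the slacks of the inequalities. Rewriting the linear exponent in them
gives the coefficient `u_i + v_j` to the entry `x_{ij}`, `u_i + v_{last}` to the row slack, and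
`v_j` to the column slack, the last one being the slack of the defect condition. -/
theorem productKernel_marginShear (u : Fin d → ℂ) (v : Fin (d + 1) → ℂ)
    (z : (Fin d × Fin d → ℝ) × ((Fin d → ℝ) × (Fin (d + 1) → ℝ))) :
    productKernel u v (marginShear z) = marginKernel u v z := by
  obtain ⟨x, ρ, γ⟩ := z
  simp only [productKernel, marginShear, marginKernel, expTail, Finset.prod_ite_zero,
    Finset.mem_univ, true_implies, Set.indicator_apply, Set.mem_ofPred_eq, marginPolytope,
    Pi.sub_apply, sub_nonneg]
  have hlast : (∀ j : Fin (d + 1), colThreshold x ρ j ≤ γ j) ↔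
      (∀ j : Fin d, ∑ i, x (i, j) ≤ γ j.castSucc) ∧
        ∑ i, (ρ i - ∑ j, x (i, j)) ≤ γ (Fin.last d) := by
    rw [Fin.forall_fin_succ']
    simp [colThreshold]
  by_cases h1 : ∀ e, 0 ≤ x e
  swap
  · rw [if_neg h1, zero_mul, if_neg (fun h => h1 h.1)]
  by_cases h2 : ∀ i, ∑ j, x (i, j) ≤ ρ i
  swap
  · rw [if_neg h2, zero_mul, mul_zero, if_neg (fun h => h2 h.2.1)]
  by_cases h3 : (∀ j : Fin d, ∑ i, x (i, j) ≤ γ j.castSucc) ∧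
        ∑ i, (ρ i - ∑ j, x (i, j)) ≤ γ (Fin.last d)
  swap
  · rw [if_neg (fun h => h3 (hlast.1 h)), mul_zero, mul_zero, if_neg (fun h => h3 h.2.2)]
  rw [if_pos h1, if_pos h2, if_pos (hlast.2 h3), if_pos ⟨h1, h2, h3⟩, ← Complex.exp_sum, ← Complex.exp_sum,
    ← Complex.exp_sum, ← Complex.exp_add, ← Complex.exp_add]
  congr 1
  rw [Fin.sum_univ_castSucc, Fin.sum_univ_castSucc, Fintype.sum_prod_type]
  simp only [colThreshold, Fin.snoc_castSucc, Fin.snoc_last]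
  push_cast
  have hA : ∑ i, ∑ j : Fin d, -(u i + v j.castSucc) * (x (i, j) : ℂ) =
      -(∑ i, u i * ∑ j, (x (i, j) : ℂ)) - ∑ j : Fin d, v j.castSucc * ∑ i, (x (i, j) : ℂ) := by
    simp only [neg_mul, add_mul, Finset.sum_neg_distrib, Finset.sum_add_distrib, Finset.mul_sum]
    rw [Finset.sum_comm (f := fun (i : Fin d) (j : Fin d) => v j.castSucc * (x (i, j) : ℂ))]
    ring
  have hB : ∑ i, -(u i + v (Fin.last d)) * ((ρ i : ℂ) - ∑ j, (x (i, j) : ℂ)) =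
      -(∑ i, u i * (ρ i : ℂ)) + (∑ i, u i * ∑ j, (x (i, j) : ℂ)) -
        v (Fin.last d) * ∑ i, ((ρ i : ℂ) - ∑ j, (x (i, j) : ℂ)) := by
    rw [Finset.mul_sum, ← Finset.sum_neg_distrib, ← Finset.sum_add_distrib,
      ← Finset.sum_sub_distrib]
    refine Finset.sum_congr rfl fun i _ => ?_
    ring
  have hC : ∑ j : Fin d, -v j.castSucc * ((γ j.castSucc : ℂ) - ∑ i, (x (i, j) : ℂ)) =
      -(∑ j : Fin d, v j.castSucc * (γ j.castSucc : ℂ)) +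
        ∑ j : Fin d, v j.castSucc * ∑ i, (x (i, j) : ℂ) := by
    rw [← Finset.sum_neg_distrib, ← Finset.sum_add_distrib]
    refine Finset.sum_congr rfl fun i _ => ?_
    ring
  rw [hA, hB, hC]
  ring

variable {u : Fin d → ℂ} {v : Fin (d + 1) → ℂ}

theorem integrable_productKernel (hu : ∀ i, 0 < (u i).re) (hv : ∀ j, 0 < (v j).re) :
    Integrable (productKernel u v) := by
  have h1 : Integrable fun x : Fin d × Fin d → ℝ =>
      ∏ e : Fin d × Fin d, expTail (u e.1 + v e.2.castSucc) (x e) :=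
    Integrable.fintype_prod (μ := fun _ => volume) fun e =>
      integrable_expTail (by simpa using add_pos (hu _) (hv _))
  have h2 : Integrable fun ρ : Fin d → ℝ => ∏ i, expTail (u i + v (Fin.last d)) (ρ i) :=
    Integrable.fintype_prod (μ := fun _ => volume) fun e =>
      integrable_expTail (by simpa using add_pos (hu _) (hv _))
  have h3 : Integrable fun γ : Fin (d + 1) → ℝ => ∏ j, expTail (v j) (γ j) :=
    Integrable.fintype_prod (μ := fun _ => volume) fun e => integrable_expTail (hv _)
  exact h1.mul_prod (h2.mul_prod h3)

theorem integrable_marginKernel (hu : ∀ i, 0 < (u i).re) (hv : ∀ j, 0 < (v j).re) :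
    Integrable (marginKernel u v) := by
  have h := measurePreserving_marginShear.integrable_comp_of_integrable
    (integrable_productKernel hu hv)
  refine h.congr (Eventually.of_forall fun z => productKernel_marginShear u v z)

/-- In slack coordinates the integral is a product of one-dimensional integrals `∫ exp (-z y) = 1/z`
over `[0, ∞)`; the row slacks supply the factors with `j = last`. -/
theorem integral_marginKernel (hu : ∀ i, 0 < (u i).re) (hv : ∀ j, 0 < (v j).re) :
    ∫ z, marginKernel u v z = (∏ i, ∏ j, 1 / (u i + v j)) * ∏ j, 1 / v j := by
  have h1 : ∫ z, marginKernel u v z = ∫ z, productKernel u v z := by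
    have hm := measurePreserving_marginShear (d := d)
    conv_rhs => rw [← hm.map_eq]
    rw [integral_map hm.measurable.aemeasurable]
    · exact integral_congr_ae (Eventually.of_forall fun z => (productKernel_marginShear u v z).symm)
    · rw [hm.map_eq]
      exact (integrable_productKernel hu hv).aestronglyMeasurable
  rw [h1]
  unfold productKernel
  have h2 := integral_prod_mul (μ := (volume : Measure (Fin d × Fin d → ℝ)))
    (ν := (volume : Measure ((Fin d → ℝ) × (Fin (d + 1) → ℝ))))
    (fun x => ∏ e : Fin d × Fin d, expTail (u e.1 + v e.2.castSucc) (x e))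
    (fun y => (∏ i, expTail (u i + v (Fin.last d)) (y.1 i)) * ∏ j, expTail (v j) (y.2 j))
  have h3 := integral_prod_mul (μ := (volume : Measure (Fin d → ℝ)))
    (ν := (volume : Measure (Fin (d + 1) → ℝ)))
    (fun ρ => (∏ i, expTail (u i + v (Fin.last d)) (ρ i))) (fun γ => ∏ j, expTail (v j) (γ j))
  rw [← Measure.volume_eq_prod] at h2 h3
  rw [h2, h3, integral_fintype_prod_volume_eq_prod (f := fun e : Fin d × Fin d =>
      expTail (u e.1 + v e.2.castSucc)),
    integral_fintype_prod_volume_eq_prod (f := fun i : Fin d => expTail (u i + v (Fin.last d))),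
    integral_fintype_prod_volume_eq_prod (f := fun j : Fin (d + 1) => expTail (v j))]
  have hs : ∀ i j, 0 < (u i + v j).re := fun i j => by simpa using add_pos (hu i) (hv j)
  simp only [integral_expTail (hs _ _), integral_expTail (hv _)]
  rw [Fintype.prod_prod_type, ← mul_assoc, ← Finset.prod_mul_distrib]
  congr 1
  refine Finset.prod_congr rfl fun i _ => ?_
  rw [Fin.prod_univ_castSucc]

/-- Integrating over `x` first exhibits the same integral as a Laplace transform in the margins. -/
theorem integral_marginKernel_left (y : (Fin d → ℝ) × (Fin (d + 1) → ℝ)) :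
    ∫ x, marginKernel u v (x, y) = Complex.exp (-((∑ i, u i * y.1 i) + ∑ j, v j * y.2 j)) *
      (volume.real (marginPolytope d y.1 y.2) : ℂ) := by
  have : (fun x => marginKernel u v (x, y)) = (marginPolytope d y.1 y.2).indicator
      (fun _ => Complex.exp (-((∑ i, u i * y.1 i) + ∑ j, v j * y.2 j))) := by
    funext x
    classical simp only [marginKernel, Set.indicator_apply, Set.mem_ofPred_eq]
  rw [this, integral_indicator_const _ (measurableSet_marginPolytope d _ _), Complex.real_smul,
    mul_comm]

end

/-! ### Evaluation of the constant `β(k)` as a volume. -/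

theorem norm_one_div_linePoint_le {r : ℝ} (hr : 0 < r) (s : ℝ) :
    ‖1 / linePoint r s‖ ≤ 2 / min r 1 * (1 + |s|)⁻¹ := by
  have hm : 0 < min r 1 := lt_min hr one_pos
  have h1 : r ≤ ‖linePoint r s‖ := by
    have := Complex.re_le_norm (linePoint r s)
    simpa [linePoint] using this
  have h2 : |s| ≤ ‖linePoint r s‖ := by
    have := Complex.abs_im_le_norm (linePoint r s)
    simpa [linePoint] using this
  have h3 : min r 1 / 2 * (1 + |s|) ≤ ‖linePoint r s‖ := by
    have h4 : min r 1 * |s| ≤ |s| := mul_le_of_le_one_left (abs_nonneg s) (min_le_right _ _)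
    have h5 : min r 1 ≤ r := min_le_left _ _
    nlinarith
  rw [norm_div, norm_one]
  calc 1 / ‖linePoint r s‖ ≤ 1 / (min r 1 / 2 * (1 + |s|)) :=
        one_div_le_one_div_of_le (by positivity) h3
    _ = 2 / min r 1 * (1 + |s|)⁻¹ := by
        field_simp

theorem linePoint_add (b b' t t' : ℝ) :
    linePoint b t + linePoint b' t' = linePoint (b + b') (t + t') := by
  simp only [linePoint]
  push_cast
  ring

theorem linePoint_re (b t : ℝ) : (linePoint b t).re = b := by simp [linePoint]

theorem linePoint_ne_zero {b : ℝ} (hb : 0 < b) (t : ℝ) : linePoint b t ≠ 0 := fun h => by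
  have := linePoint_re b t
  rw [h] at this
  simp at this
  linarith

/-- The factors `1 / v_j` play the role of the base row `none` of `bracketKernel`. For `d = 0` a
single factor `1 / v` would remain, which is not absolutely integrable on a vertical line. -/
theorem integrable_prod_one_div_linePoint {d : ℕ} (hd : 1 ≤ d) {b : Fin d → ℝ}
    (hb : ∀ i, 0 < b i) {c : Fin (d + 1) → ℝ} (hc : ∀ j, 0 < c j) :
    Integrable fun t : (Fin d → ℝ) × (Fin (d + 1) → ℝ) =>
      (∏ i, ∏ j, 1 / (linePoint (b i) (t.1 i) + linePoint (c j) (t.2 j))) *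
        ∏ j, 1 / linePoint (c j) (t.2 j) := by
  have h := (integrable_prod_bracketKernel (ι := Fin d) (κ := Fin (d + 1)) (by simpa using hd)
    (by simp; omega)).const_mul ((∏ i, ∏ j, 2 / min (b i + c j) 1) * ∏ j, 2 / min (c j) 1)
  refine h.mono' ?_ (Eventually.of_forall fun t => ?_)
  · refine Continuous.aestronglyMeasurable ?_
    simp only [linePoint_add]
    have hlp : ∀ r : ℝ, Continuous fun s => linePoint r s := fun r => by
      unfold linePoint
      fun_prop
    refine Continuous.mul (continuous_finsetProd _ fun i _ => continuous_finsetProd _ fun j _ => ?_)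
      (continuous_finsetProd _ fun j _ => ?_)
    · refine Continuous.div continuous_const ((hlp _).comp (by fun_prop)) fun t => ?_
      exact linePoint_ne_zero (add_pos (hb i) (hc j)) _
    · refine Continuous.div continuous_const ((hlp _).comp (by fun_prop)) fun t => ?_
      exact linePoint_ne_zero (hc j) _
  · simp only [linePoint_add]
    rw [norm_mul, norm_prod, norm_prod, Fintype.prod_prod_type, Fintype.prod_option,
      mul_comm (∏ j, bracketKernel t none j), mul_mul_mul_comm, ← Finset.prod_mul_distrib,
      ← Finset.prod_mul_distrib]
    refine mul_le_mul ?_ ?_ (Finset.prod_nonneg fun _ _ => norm_nonneg _)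
      (Finset.prod_nonneg fun i _ => ?_)
    · refine Finset.prod_le_prod (fun _ _ => norm_nonneg _) fun i _ => ?_
      rw [norm_prod, ← Finset.prod_mul_distrib]
      refine Finset.prod_le_prod (fun _ _ => norm_nonneg _) fun j _ => ?_
      exact norm_one_div_linePoint_le (add_pos (hb i) (hc j)) _
    · refine Finset.prod_le_prod (fun _ _ => norm_nonneg _) fun j _ => ?_
      simpa [bracketKernel] using norm_one_div_linePoint_le (hc j) (t.2 j)
    · refine mul_nonneg (Finset.prod_nonneg fun j _ => ?_)
        (Finset.prod_nonneg fun j _ => (bracketKernel_pos t _ _).le)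
      have : 0 < min (b i + c j) 1 := lt_min (add_pos (hb i) (hc j)) one_pos
      positivity

theorem betaIntegrand_succ (d : ℕ) (u : Fin d → ℂ) (v : Fin (d + 1) → ℂ) :
    betaIntegrand (d + 1) u v = (∏ i : Fin d, ∏ j, 1 / (u i + v j)) *
      Complex.exp ((∑ i : Fin d, u i) + ∑ j, v j) * ∏ j, 1 / v j := rfl

/-- On the vertical lines, the Laplace transform of the volume becomes the Fourier transform of the
damped volume `f`. Inversion at `(1, 1)` yields `(2π)^{2d+1}` times the damped volume; the prefactor
of `β`, the power of `i` from `ds = i dt`, and `exp (∑ b + ∑ c)` cancel everything but `birkhoffVol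
d`. -/
theorem beta_eq_birkhoffVol {d : ℕ} (hd : 1 ≤ d) {b : Fin d → ℝ} (hb : ∀ i, 0 < b i)
    {c : Fin (d + 1) → ℝ} (hc : ∀ j, 0 < c j) :
    beta (d + 1) b c = (birkhoffVol d : ℂ) := by
  set f : (Fin d → ℝ) × (Fin (d + 1) → ℝ) → ℂ := fun y =>
    Complex.exp (-((∑ i, (b i : ℂ) * y.1 i) + ∑ j, (c j : ℂ) * y.2 j)) *
      (volume.real (marginPolytope d y.1 y.2) : ℂ) with hf
  set g : (Fin d → ℝ) × (Fin (d + 1) → ℝ) → ℂ := fun t =>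
    (∏ i, ∏ j, 1 / (linePoint (b i) (t.1 i) + linePoint (c j) (t.2 j))) *
        ∏ j, 1 / linePoint (c j) (t.2 j) with hg
  have hfint : Integrable f := by
    have h := integrable_marginKernel (u := fun i => (b i : ℂ)) (v := fun j => (c j : ℂ))
      (by simpa using hb) (by simpa using hc)
    rw [Measure.volume_eq_prod] at h
    refine h.integral_prod_right.congr (Eventually.of_forall fun y => ?_)
    exact integral_marginKernel_left y
  have hgint : Integrable g := integrable_prod_one_div_linePoint hd hb hc
  have hfg : ∀ t, g t = ∫ y : (Fin d → ℝ) × (Fin (d + 1) → ℝ),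
      Complex.exp (-(((∑ i, t.1 i * y.1 i) + ∑ j, t.2 j * y.2 j : ℝ) : ℂ) * Complex.I) * f y := by
    intro t
    have hu : ∀ i, 0 < (linePoint (b i) (t.1 i)).re := fun i => by rw [linePoint_re]; exact hb i
    have hv : ∀ j, 0 < (linePoint (c j) (t.2 j)).re := fun j => by rw [linePoint_re]; exact hc j
    have h1 := integral_marginKernel hu hv
    have h2 := integrable_marginKernel hu hv
    rw [Measure.volume_eq_prod] at h1 h2
    rw [integral_prod_symm _ h2] at h1
    simp only [hg]
    rw [← h1]
    refine integral_congr_ae (Eventually.of_forall fun y => ?_)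
    simp only [integral_marginKernel_left, hf]
    rw [← mul_assoc, ← Complex.exp_add]
    congr 2
    simp only [linePoint]
    push_cast
    simp only [add_mul, Finset.sum_add_distrib]
    simp only [neg_add, neg_mul, add_mul, Finset.sum_mul]
    have e1 : ∑ i, (t.1 i : ℂ) * Complex.I * (y.1 i : ℂ) =
        ∑ i, (t.1 i : ℂ) * (y.1 i : ℂ) * Complex.I := Finset.sum_congr rfl fun i _ => by ring
    have e2 : ∑ i, (t.2 i : ℂ) * Complex.I * (y.2 i : ℂ) =
        ∑ i, (t.2 i : ℂ) * (y.2 i : ℂ) * Complex.I := Finset.sum_congr rfl fun i _ => by ring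
    rw [e1, e2]
    ring
  have hcont : ContinuousAt f (1, 1) := by
    refine ContinuousAt.mul (by fun_prop) ?_
    exact Complex.continuous_ofReal.continuousAt.comp (continuousAt_volume_marginPolytope d)
  have key := fourier_inversion_prod f hfint g hgint hfg (1, 1) hcont
  have hbeta : ∫ t : (Fin d → ℝ) × (Fin (d + 1) → ℝ),
      betaIntegrand (d + 1) (fun i => linePoint (b i) (t.1 i)) (fun j => linePoint (c j) (t.2 j)) *
          Complex.I ^ (2 * (d + 1) - 1) =
      Complex.I ^ (2 * (d + 1) - 1) * (Complex.exp ((∑ i, (b i : ℂ)) + ∑ j, (c j : ℂ)) *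
      ∫ t : (Fin d → ℝ) × (Fin (d + 1) → ℝ),
      Complex.exp ((((∑ i, t.1 i * (1 : Fin d → ℝ) i) +
        ∑ j, t.2 j * (1 : Fin (d + 1) → ℝ) j : ℝ) : ℂ) * Complex.I) * g t) := by
    rw [← integral_const_mul, ← integral_const_mul]
    refine integral_congr_ae (Eventually.of_forall fun t => ?_)
    simp only [betaIntegrand_succ, hg]
    have hexp : Complex.exp ((∑ i, linePoint (b i) (t.1 i)) + ∑ j, linePoint (c j) (t.2 j)) =
        Complex.exp ((∑ i, (b i : ℂ)) + ∑ j, (c j : ℂ)) *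
        Complex.exp ((((∑ i, t.1 i * (1 : Fin d → ℝ) i) +
        ∑ j, t.2 j * (1 : Fin (d + 1) → ℝ) j : ℝ) : ℂ) * Complex.I) := by
      rw [← Complex.exp_add]
      congr 1
      simp only [linePoint, Finset.sum_add_distrib, Pi.one_apply, mul_one]
      push_cast
      rw [add_mul, Finset.sum_mul, Finset.sum_mul]
      ring
    rw [hexp]
    ring
  have hbeta' : beta (d + 1) b c = 1 / (2 * (Real.pi : ℂ) * Complex.I) ^ (2 * (d + 1) - 1) *
    ∫ t : (Fin d → ℝ) × (Fin (d + 1) → ℝ),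
      betaIntegrand (d + 1) (fun i => linePoint (b i) (t.1 i)) (fun j => linePoint (c j) (t.2 j)) *
          Complex.I ^ (2 * (d + 1) - 1) := by
    rw [beta, if_neg (by omega)]
    rfl
  rw [hbeta', hbeta]
  rw [key]
  have hI : Complex.I ^ (2 * (d + 1) - 1) ≠ 0 := pow_ne_zero _ Complex.I_ne_zero
  have hpi : (2 * (Real.pi : ℂ)) ^ (2 * (d + 1) - 1) ≠ 0 :=
    pow_ne_zero _ (by exact_mod_cast (by positivity : (2 * Real.pi) ≠ 0))
  have hcard : Fintype.card (Fin d) + Fintype.card (Fin (d + 1)) = 2 * (d + 1) - 1 := by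
    simp
    omega
  rw [hcard, mul_pow]
  have hf1 : f (1, 1) = (Complex.exp ((∑ i, (b i : ℂ)) + ∑ j, (c j : ℂ)))⁻¹ *
      (birkhoffVol d : ℂ) := by
    rw [← Complex.exp_neg]
    simp [hf, birkhoffVol]
  rw [hf1]
  have hE := Complex.exp_ne_zero ((∑ i, (b i : ℂ)) + ∑ j, (c j : ℂ))
  field_simp

/-! ### The inner sum over the last row, last column and corner, written as an integral. -/

/-- A finitely supported sum over `J → ℕ` with product weights, as an integral. -/
theorem integral_comp_discrete {J : Type*} [Fintype J] (μ : J → Measure ℝ)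
    [∀ j, SigmaFinite (μ j)] (g : J → ℝ → ℕ) (hg : ∀ j, Measurable (g j)) (ω : J → ℕ → ℝ)
    (hω₀ : ∀ j a, 0 ≤ ω j a) (hω : ∀ j a, μ j (g j ⁻¹' {a}) = ENNReal.ofReal (ω j a))
    (F : (J → ℕ) → ℝ) (S : Finset (J → ℕ)) (hS : ∀ a ∉ S, F a = 0) :
    ∫ s, F (fun j => g j (s j)) ∂(Measure.pi μ) = ∑ a ∈ S, F a * ∏ j, ω j (a j) := by
  classical
  have hset : ∀ a : J → ℕ, MeasurableSet (Set.pi Set.univ fun j => g j ⁻¹' {a j}) := fun a =>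
    MeasurableSet.univ_pi fun j => hg j (measurableSet_singleton _)
  have hmeas : ∀ a : J → ℕ, Measure.pi μ (Set.pi Set.univ fun j => g j ⁻¹' {a j}) =
      ENNReal.ofReal (∏ j, ω j (a j)) := fun a => by
    rw [Measure.pi_pi, ENNReal.ofReal_prod_of_nonneg fun j _ => hω₀ j _]
    simp only [hω]
  have hF : (fun s : J → ℝ => F (fun j => g j (s j))) = fun s => ∑ a ∈ S,
      (Set.pi Set.univ fun j => g j ⁻¹' {a j}).indicator (fun _ => F a) s := by
    funext s
    have hmem : ∀ a : J → ℕ, (s ∈ Set.pi Set.univ fun j => g j ⁻¹' {a j}) ↔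
        a = fun j => g j (s j) := fun a => by
      simp only [Set.mem_pi, Set.mem_univ, true_implies, Set.mem_preimage, Set.mem_singleton_iff]
      exact ⟨fun h => funext fun j => (h j).symm, fun h j => by rw [h]⟩
    simp only [Set.indicator_apply, hmem]
    rw [Finset.sum_ite_eq']
    split_ifs with h
    · rfl
    · exact hS _ h
  rw [hF, integral_finsetSum]
  · refine Finset.sum_congr rfl fun a _ => ?_
    rw [integral_indicator_const _ (hset a), measureReal_def, hmeas,
      ENNReal.toReal_ofReal (Finset.prod_nonneg fun j _ => hω₀ j _), smul_eq_mul, mul_comm]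
  · intro a _
    refine (integrable_indicator_iff (hset a)).2 (integrableOn_const ?_)
    rw [hmeas]
    exact ENNReal.ofReal_ne_top

/-- For positive `a` the fibre is an interval `((a - 1)/R, a/R]`, and the fibre of `0` misses the
half-line `s > 0`. So the substitution `y = ⌈R s⌉` gives equal mass to all positive integers. -/
theorem volume_restrict_ceil_preimage {R : ℝ} (hR : 0 < R) (a : ℕ) :
    (volume.restrict (Set.Ioi (0 : ℝ))) ((fun s : ℝ => ⌈R * s⌉₊) ⁻¹' {a}) =
      ENNReal.ofReal (if a = 0 then 0 else 1 / R) := by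
  have hm : Measurable fun s : ℝ => ⌈R * s⌉₊ := Nat.measurable_ceil.comp (measurable_const_mul R)
  rw [Measure.restrict_apply (hm (measurableSet_singleton a))]
  by_cases ha : a = 0
  · rw [if_pos ha, ENNReal.ofReal_zero]
    convert measure_empty (μ := (volume : Measure ℝ))
    ext s
    simp only [ha, Set.mem_inter_iff, Set.mem_preimage, Set.mem_singleton_iff, Nat.ceil_eq_zero,
      Set.mem_Ioi, Set.mem_empty_iff_false, iff_false, not_and, not_lt]
    intro h
    by_contra hs
    exact absurd h (not_le.2 (mul_pos hR (not_le.1 hs)))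
  · rw [if_neg ha]
    have : (fun s : ℝ => ⌈R * s⌉₊) ⁻¹' {a} ∩ Set.Ioi 0 =
        Set.Ioc (((a - 1 : ℕ) : ℝ) / R) ((a : ℝ) / R) := by
      ext s
      simp only [Set.mem_inter_iff, Set.mem_preimage, Set.mem_singleton_iff, Set.mem_Ioi,
        Set.mem_Ioc, Nat.ceil_eq_iff ha, div_lt_iff₀ hR, le_div_iff₀ hR]
      constructor
      · rintro ⟨⟨h1, h2⟩, -⟩
        exact ⟨by linarith, by linarith⟩
      · rintro ⟨h1, h2⟩
        refine ⟨⟨by linarith, by linarith⟩, ?_⟩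
        have h0 : (0 : ℝ) ≤ ((a - 1 : ℕ) : ℝ) := Nat.cast_nonneg _
        exact pos_of_mul_pos_left (h0.trans_lt h1) hR.le
    rw [this, Real.volume_Ioc]
    congr 1
    rw [Nat.cast_sub (by omega), Nat.cast_one]
    field_simp
    ring

section Inner

variable {d : ℕ}

/-- The number of admissible `w` for given row and column variables `y`, when the row variables
are at most `R (inl i)`, and the column variables at most `R (inr j)`. -/
noncomputable def innerTerm (R : Fin d ⊕ Fin d → ℝ) (Z : ℝ) (y : Fin d ⊕ Fin d → ℕ) : ℝ :=
  if ∀ j, 1 ≤ y j ∧ (y j : ℝ) ≤ R j then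
    (⌊Z * min (∏ i, R (Sum.inl i) / y (Sum.inl i)) (∏ i, R (Sum.inr i) / y (Sum.inr i))⌋₊ : ℝ)
  else 0

/-- The normalized sum of `innerTerm`. -/
noncomputable def innerDensity (R : Fin d ⊕ Fin d → ℝ) (Z : ℝ) : ℝ :=
  (∑ y ∈ Fintype.piFinset fun j => Finset.Icc 1 ⌊R j⌋₊, innerTerm R Z y) / (Z * ∏ j, R j)

/-- The limit of the integrand representing `innerDensity`. -/
noncomputable def innerLimit (s : Fin d ⊕ Fin d → ℝ) : ℝ :=
  if ∀ j, s j ≤ 1 then min (∏ i, 1 / s (Sum.inl i)) (∏ i, 1 / s (Sum.inr i)) else 0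

/-- The majorant of the integrand representing `innerDensity`. -/
noncomputable def innerBound (s : Fin d ⊕ Fin d → ℝ) : ℝ :=
  ∏ j, (Set.Ioc (0 : ℝ) 1).indicator (fun t => t ^ (-(1 / 2) : ℝ)) (s j)

/-- Lebesgue measure on the positive orthant. -/
noncomputable abbrev orthant (J : Type*) [Fintype J] : Measure (J → ℝ) :=
  Measure.pi fun _ => volume.restrict (Set.Ioi 0)

/-- The limit of `innerDensity`. -/
noncomputable def innerConst (d : ℕ) : ℝ := ∫ s, innerLimit (d := d) s ∂(orthant (Fin d ⊕ Fin d))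

theorem ae_orthant {J : Type*} [Fintype J] : ∀ᵐ s ∂(orthant J), ∀ j, 0 < s j :=
  ae_all_iff.2 fun j => (Measure.quasiMeasurePreserving_eval
    (fun _ : J => volume.restrict (Set.Ioi (0 : ℝ))) j).ae (ae_restrict_mem measurableSet_Ioi)

theorem ae_orthant_ne {J : Type*} [Fintype J] (c : ℝ) : ∀ᵐ s ∂(orthant J), ∀ j, s j ≠ c :=
  ae_all_iff.2 fun j => (Measure.quasiMeasurePreserving_eval
    (fun _ : J => volume.restrict (Set.Ioi (0 : ℝ))) j).ae
      (ae_restrict_of_ae (Measure.ae_ne volume c))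

theorem orthant_eq_restrict {J : Type*} [Fintype J] :
    orthant J = volume.restrict (Set.pi Set.univ fun _ : J => Set.Ioi (0 : ℝ)) :=
  (Measure.restrict_pi_pi (fun _ : J => (volume : Measure ℝ)) fun _ => Set.Ioi (0 : ℝ)).symm

theorem integrable_innerBound : Integrable (innerBound (d := d)) (orthant (Fin d ⊕ Fin d)) := by
  refine Integrable.fintype_prod
    (f := fun _ => (Set.Ioc (0 : ℝ) 1).indicator (fun t => t ^ (-(1 / 2) : ℝ))) fun j => ?_
  refine Integrable.mono_measure ?_ Measure.restrict_le_self
  rw [integrable_indicator_iff measurableSet_Ioc,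
    ← intervalIntegrable_iff_integrableOn_Ioc_of_le zero_le_one]
  exact intervalIntegral.intervalIntegrable_rpow' (by norm_num)

theorem innerTerm_nonneg (R : Fin d ⊕ Fin d → ℝ) (Z : ℝ) (y : Fin d ⊕ Fin d → ℕ) :
    0 ≤ innerTerm R Z y := by
  unfold innerTerm
  split_ifs
  · exact Nat.cast_nonneg _
  · exact le_rfl

/-- The fibre masses multiply to `1 / ∏ R`, part of the normalization. In integral form, limits
follow from dominated convergence, with no error terms to track. -/
theorem innerDensity_eq_integral {R : Fin d ⊕ Fin d → ℝ} (hR : ∀ j, 0 < R j) (Z : ℝ) :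
    innerDensity R Z =
      ∫ s, innerTerm R Z (fun j => ⌈R j * s j⌉₊) / Z ∂(orthant (Fin d ⊕ Fin d)) := by
  have h := integral_comp_discrete (fun _ : Fin d ⊕ Fin d => volume.restrict (Set.Ioi (0 : ℝ)))
    (fun j s => ⌈R j * s⌉₊) (fun j => Nat.measurable_ceil.comp (measurable_const_mul (R j)))
    (fun j a => if a = 0 then 0 else 1 / R j)
    (fun j a => by
      split_ifs
      · exact le_rfl
      · exact (one_div_pos.2 (hR j)).le)
    (fun j a => volume_restrict_ceil_preimage (hR j) a) (innerTerm R Z)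
    (Fintype.piFinset fun j => Finset.Icc 1 ⌊R j⌋₊) (fun a ha => by
      unfold innerTerm
      rw [if_neg]
      intro hc
      refine ha (Fintype.mem_piFinset.2 fun j => Finset.mem_Icc.2 ⟨(hc j).1, ?_⟩)
      exact Nat.le_floor (hc j).2)
  rw [integral_div, h, innerDensity, mul_comm Z, ← div_div]
  congr 1
  rw [Finset.sum_div]
  refine Finset.sum_congr rfl fun y hy => ?_
  rw [div_eq_mul_inv, ← Finset.prod_inv_distrib]
  congr 1
  refine Finset.prod_congr rfl fun j _ => ?_
  have := (Finset.mem_Icc.1 (Fintype.mem_piFinset.1 hy j)).1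
  rw [if_neg (by omega), one_div]

theorem min_le_sqrt_mul {a b : ℝ} (ha : 0 ≤ a) (hb : 0 ≤ b) : min a b ≤ Real.sqrt (a * b) := by
  refine Real.le_sqrt_of_sq_le ?_
  rw [sq]
  exact mul_le_mul (min_le_left _ _) (min_le_right _ _) (le_min ha hb) ha

/-- Since `R / ⌈R s⌉ ≤ 1 / s`, the minimum is at most that of two products of `1 / s_j`, hence at
most their geometric mean `∏ s_j^{-1/2}`. Unlike either product, this is integrable at `0`, and it
depends on neither `R` nor `Z`. -/
theorem innerTerm_div_le {R : Fin d ⊕ Fin d → ℝ} (hR : ∀ j, 0 < R j) {Z : ℝ} (hZ : 0 < Z)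
    {s : Fin d ⊕ Fin d → ℝ} (hs : ∀ j, 0 < s j) :
    innerTerm R Z (fun j => ⌈R j * s j⌉₊) / Z ≤ innerBound s := by
  unfold innerTerm
  split_ifs with h
  swap
  · rw [zero_div]
    refine Finset.prod_nonneg fun j _ => Set.indicator_nonneg (fun t ht => ?_) _
    exact Real.rpow_nonneg ht.1.le _
  have hle : ∀ j, R j / (⌈R j * s j⌉₊ : ℝ) ≤ 1 / s j := fun j => by
    rw [div_le_div_iff₀ (lt_of_lt_of_le (mul_pos (hR j) (hs j)) (Nat.le_ceil _)) (hs j), one_mul]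
    exact Nat.le_ceil _
  have hpos : ∀ j, 0 ≤ R j / (⌈R j * s j⌉₊ : ℝ) := fun j => div_nonneg (hR j).le (Nat.cast_nonneg _)
  have hs1 : ∀ j, s j ≤ 1 := fun j => by
    have h1 := (Nat.le_ceil (R j * s j)).trans (h j).2
    exact le_of_mul_le_mul_left (by simpa using h1) (hR j)
  have hP : ∀ f : Fin d → Fin d ⊕ Fin d, 0 ≤ ∏ i, 1 / s (f i) := fun f =>
    Finset.prod_nonneg fun i _ => (one_div_pos.2 (hs _)).le
  have hmin : min (∏ i, R (Sum.inl i) / (⌈R (Sum.inl i) * s (Sum.inl i)⌉₊ : ℝ))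
      (∏ i, R (Sum.inr i) / (⌈R (Sum.inr i) * s (Sum.inr i)⌉₊ : ℝ)) ≤
      min (∏ i, 1 / s (Sum.inl i)) (∏ i, 1 / s (Sum.inr i)) :=
    min_le_min (Finset.prod_le_prod (fun i _ => hpos _) fun i _ => hle _)
      (Finset.prod_le_prod (fun i _ => hpos _) fun i _ => hle _)
  have hfl := Nat.floor_le (a := Z * min (∏ i, R (Sum.inl i) / (⌈R (Sum.inl i) * s (Sum.inl i)⌉₊ : ℝ))
      (∏ i, R (Sum.inr i) / (⌈R (Sum.inr i) * s (Sum.inr i)⌉₊ : ℝ)))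
    (mul_nonneg hZ.le (le_min (Finset.prod_nonneg fun i _ => hpos _)
      (Finset.prod_nonneg fun i _ => hpos _)))
  rw [div_le_iff₀ hZ]
  refine hfl.trans ?_
  rw [mul_comm]
  refine mul_le_mul_of_nonneg_right (hmin.trans ((min_le_sqrt_mul (hP _) (hP _)).trans ?_)) hZ.le
  rw [← Fintype.prod_sum_type (fun j => 1 / s j), innerBound, Real.sqrt_eq_rpow,
    ← Real.finsetProd_rpow _ _ (fun j _ => (one_div_pos.2 (hs _)).le)]
  refine le_of_eq (Finset.prod_congr rfl fun j _ => ?_)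
  rw [Set.indicator_of_mem (Set.mem_Ioc.2 ⟨hs j, hs1 j⟩), one_div, Real.inv_rpow (hs j).le,
    ← Real.rpow_neg (hs j).le]

theorem innerDensity_nonneg {R : Fin d ⊕ Fin d → ℝ} (hR : ∀ j, 0 < R j) {Z : ℝ} (hZ : 0 < Z) :
    0 ≤ innerDensity R Z :=
  div_nonneg (Finset.sum_nonneg fun y _ => innerTerm_nonneg R Z y)
    (mul_nonneg hZ.le (Finset.prod_nonneg fun j _ => (hR j).le))

theorem measurable_innerTerm_ceil (R : Fin d ⊕ Fin d → ℝ) (Z : ℝ) :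
    Measurable fun s : Fin d ⊕ Fin d → ℝ => innerTerm R Z (fun j => ⌈R j * s j⌉₊) / Z := by
  refine Measurable.div_const ?_ _
  refine (measurable_of_countable (innerTerm R Z)).comp ?_
  refine measurable_pi_iff.2 fun j => ?_
  have hm : Measurable fun s : Fin d ⊕ Fin d → ℝ => R j * s j := by fun_prop
  exact Nat.measurable_ceil.comp hm

theorem innerDensity_le {R : Fin d ⊕ Fin d → ℝ} (hR : ∀ j, 0 < R j) {Z : ℝ} (hZ : 0 < Z) :
    innerDensity R Z ≤ ∫ s, innerBound (d := d) s ∂(orthant (Fin d ⊕ Fin d)) := by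
  rw [innerDensity_eq_integral hR]
  refine integral_mono_of_nonneg (Eventually.of_forall fun s =>
    div_nonneg (innerTerm_nonneg _ _ _) hZ.le) integrable_innerBound ?_
  filter_upwards [ae_orthant] with s hs
  exact innerTerm_div_le hR hZ hs

theorem innerDensity_eq_zero {R : Fin d ⊕ Fin d → ℝ} {Z : ℝ} {j : Fin d ⊕ Fin d} (hj : R j < 1) :
    innerDensity R Z = 0 := by
  unfold innerDensity
  rw [Finset.sum_eq_zero, zero_div]
  intro y _
  unfold innerTerm
  rw [if_neg]
  intro h
  have h1 : (1 : ℝ) ≤ y j := by exact_mod_cast (h j).1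
  linarith [(h j).2]

theorem tendsto_innerDensity_of_ae {ι : Type*} {l : Filter ι} [l.IsCountablyGenerated]
    {R : ι → Fin d ⊕ Fin d → ℝ} {Z : ι → ℝ} (hR : ∀ᶠ n in l, ∀ j, 0 < R n j)
    (hZ : ∀ᶠ n in l, 0 < Z n) {g : (Fin d ⊕ Fin d → ℝ) → ℝ}
    (h : ∀ᵐ s ∂(orthant (Fin d ⊕ Fin d)),
      Tendsto (fun n => innerTerm (R n) (Z n) (fun j => ⌈R n j * s j⌉₊) / Z n) l (𝓝 (g s))) :
    Tendsto (fun n => innerDensity (R n) (Z n)) l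
      (𝓝 (∫ s, g s ∂(orthant (Fin d ⊕ Fin d)))) := by
  have h1 := tendsto_integral_filter_of_dominated_convergence (μ := orthant (Fin d ⊕ Fin d))
    (l := l) (F := fun n s => innerTerm (R n) (Z n) (fun j => ⌈R n j * s j⌉₊) / Z n) (f := g)
    innerBound (Eventually.of_forall fun n =>
      (measurable_innerTerm_ceil (R n) (Z n)).aestronglyMeasurable) (by
      filter_upwards [hR, hZ] with n hRn hZn
      filter_upwards [ae_orthant] with s hs
      rw [Real.norm_of_nonneg (div_nonneg (innerTerm_nonneg _ _ _) hZn.le)]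
      exact innerTerm_div_le hRn hZn hs) integrable_innerBound h
  refine h1.congr' ?_
  filter_upwards [hR, hZ] with n hRn hZn
  rw [innerDensity_eq_integral hRn]

theorem tendsto_ceil_mul_div {ι : Type*} {l : Filter ι} {r : ι → ℝ} (hr : Tendsto r l atTop)
    {s : ℝ} (hs : 0 ≤ s) : Tendsto (fun n => (⌈r n * s⌉₊ : ℝ) / r n) l (𝓝 s) := by
  have h := (tendsto_nat_ceil_mul_div_atTop hs).comp hr
  refine h.congr fun n => ?_
  simp [mul_comm]

theorem tendsto_floor_mul_div {ι : Type*} {l : Filter ι} {Z m : ι → ℝ} {a : ℝ}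
    (hZ : Tendsto Z l atTop) (hm : Tendsto m l (𝓝 a)) (hm0 : ∀ᶠ n in l, 0 ≤ m n) :
    Tendsto (fun n => (⌊Z n * m n⌋₊ : ℝ) / Z n) l (𝓝 a) := by
  have hlow : Tendsto (fun n => m n - 1 / Z n) l (𝓝 a) := by
    have h0 : Tendsto (fun n => 1 / Z n) l (𝓝 0) := hZ.const_div_atTop 1
    simpa using hm.sub h0
  refine tendsto_of_tendsto_of_tendsto_of_le_of_le' hlow hm ?_ ?_
  · filter_upwards [hZ.eventually_gt_atTop 0] with n hn
    rw [le_div_iff₀ hn, sub_mul, one_div, inv_mul_cancel₀ hn.ne', mul_comm]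
    exact (Nat.sub_one_lt_floor _).le
  · filter_upwards [hZ.eventually_gt_atTop 0, hm0] with n hn h0
    rw [div_le_iff₀ hn, mul_comm (m n)]
    exact Nat.floor_le (mul_nonneg hn.le h0)

theorem tendsto_innerDensity {ι : Type*} {l : Filter ι} [l.IsCountablyGenerated]
    {R : ι → Fin d ⊕ Fin d → ℝ} {Z : ι → ℝ} (hR : ∀ j, Tendsto (fun n => R n j) l atTop)
    (hZ : Tendsto Z l atTop) :
    Tendsto (fun n => innerDensity (R n) (Z n)) l (𝓝 (innerConst d)) := by
  refine tendsto_innerDensity_of_ae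
    (eventually_all.2 fun j => (hR j).eventually_gt_atTop 0) (hZ.eventually_gt_atTop 0) ?_
  filter_upwards [ae_orthant, ae_orthant_ne 1] with s hs hs1
  have hRpos : ∀ᶠ n in l, ∀ j, 0 < R n j := eventually_all.2 fun j => (hR j).eventually_gt_atTop 0
  unfold innerLimit
  split_ifs with hle
  · have hlt : ∀ j, s j < 1 := fun j => lt_of_le_of_ne (hle j) (hs1 j)
    have hq : ∀ j, Tendsto (fun n => R n j / (⌈R n j * s j⌉₊ : ℝ)) l (𝓝 (1 / s j)) := fun j => by
      have h := (tendsto_ceil_mul_div (hR j) (hs j).le).inv₀ (hs j).ne'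
      simpa [inv_div] using h
    have hm : Tendsto (fun n => min (∏ i, R n (Sum.inl i) / (⌈R n (Sum.inl i) * s (Sum.inl i)⌉₊ : ℝ))
        (∏ i, R n (Sum.inr i) / (⌈R n (Sum.inr i) * s (Sum.inr i)⌉₊ : ℝ))) l
        (𝓝 (min (∏ i, 1 / s (Sum.inl i)) (∏ i, 1 / s (Sum.inr i)))) :=
      (tendsto_finsetProd _ fun i _ => hq _).min (tendsto_finsetProd _ fun i _ => hq _)
    refine (tendsto_floor_mul_div hZ hm ?_).congr' ?_
    · filter_upwards [hRpos] with n hn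
      exact le_min (Finset.prod_nonneg fun i _ => div_nonneg (hn _).le (Nat.cast_nonneg _))
        (Finset.prod_nonneg fun i _ => div_nonneg (hn _).le (Nat.cast_nonneg _))
    · have hev : ∀ᶠ n in l, ∀ j, (⌈R n j * s j⌉₊ : ℝ) / R n j < 1 := eventually_all.2 fun j =>
        (tendsto_ceil_mul_div (hR j) (hs j).le).eventually_lt_const (hlt j)
      filter_upwards [hRpos, hev] with n hn hn1
      unfold innerTerm
      rw [if_pos]
      intro j
      refine ⟨Nat.one_le_iff_ne_zero.2 (Nat.ceil_pos.2 (mul_pos (hn j) (hs j))).ne', ?_⟩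
      have := (div_lt_one (hn j)).1 (hn1 j)
      exact this.le
  · push Not at hle
    obtain ⟨j, hj⟩ := hle
    refine tendsto_const_nhds.congr' ?_
    filter_upwards [hRpos] with n hn
    unfold innerTerm
    rw [if_neg, zero_div]
    intro h
    have h1 := (Nat.le_ceil (R n j * s j)).trans (h j).2
    have h2 : R n j * 1 < R n j * s j := mul_lt_mul_of_pos_left hj (hn j)
    linarith

/-- For fixed `s` the argument of the floor is at most `Z ∏ 1/s_i`, so the floor is eventually `0`,
whatever the size of `R`. -/
theorem tendsto_innerDensity_zero {ι : Type*} {l : Filter ι} [l.IsCountablyGenerated]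
    {R : ι → Fin d ⊕ Fin d → ℝ} {Z : ι → ℝ} (hR : ∀ᶠ n in l, ∀ j, 0 < R n j)
    (hZpos : ∀ᶠ n in l, 0 < Z n) (hZ : Tendsto Z l (𝓝 0)) :
    Tendsto (fun n => innerDensity (R n) (Z n)) l (𝓝 0) := by
  have h0 : ∫ s, (fun _ => (0 : ℝ)) s ∂(orthant (Fin d ⊕ Fin d)) = 0 := by simp
  rw [← h0]
  refine tendsto_innerDensity_of_ae hR hZpos ?_
  filter_upwards [ae_orthant] with s hs
  refine tendsto_const_nhds.congr' ?_
  have hP : 0 < ∏ i, 1 / s (Sum.inl i) := Finset.prod_pos fun i _ => one_div_pos.2 (hs _)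
  have hsm : ∀ᶠ n in l, Z n * ∏ i, 1 / s (Sum.inl i) < 1 := by
    have := hZ.mul_const (∏ i, 1 / s (Sum.inl i))
    rw [zero_mul] at this
    exact this.eventually_lt_const one_pos
  filter_upwards [hR, hZpos, hsm] with n hn hz hlt
  unfold innerTerm
  split_ifs with h
  swap
  · simp
  have hle : ∀ j, R n j / (⌈R n j * s j⌉₊ : ℝ) ≤ 1 / s j := fun j => by
    rw [div_le_div_iff₀ (lt_of_lt_of_le (mul_pos (hn j) (hs j)) (Nat.le_ceil _)) (hs j), one_mul]
    exact Nat.le_ceil _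
  rw [Nat.floor_eq_zero.2]
  · simp
  refine lt_of_le_of_lt (mul_le_mul_of_nonneg_left ((min_le_left _ _).trans
    (Finset.prod_le_prod (fun i _ => div_nonneg (hn _).le (Nat.cast_nonneg _)) fun i _ => hle _))
    hz.le) hlt

end Inner

/-! ### The inner constant is a central binomial coefficient. -/

/-- The truncated exponential series `∑_{j < d} r^j / j!`. -/
noncomputable def expTrunc (d : ℕ) (r : ℝ) : ℝ := ∑ j ∈ Finset.range d, r ^ j / (j.factorial : ℝ)

theorem expTrunc_succ (d : ℕ) (r : ℝ) :
    expTrunc (d + 1) r = expTrunc d r + r ^ d / (d.factorial : ℝ) :=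
  Finset.sum_range_succ _ _

theorem expTrunc_nonneg (d : ℕ) {r : ℝ} (hr : 0 ≤ r) : 0 ≤ expTrunc d r :=
  Finset.sum_nonneg fun j _ => by positivity

theorem continuous_expTrunc (d : ℕ) : Continuous (expTrunc d) := by
  unfold expTrunc
  fun_prop

theorem expTrunc_succ_zero (d : ℕ) : expTrunc (d + 1) 0 = 1 := by
  induction d with
  | zero => simp [expTrunc]
  | succ d ih => rw [expTrunc_succ, ih]; simp

theorem hasDerivAt_expTrunc_succ (d : ℕ) (r : ℝ) :
    HasDerivAt (expTrunc (d + 1)) (expTrunc d r) r := by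
  induction d with
  | zero =>
    have : expTrunc 1 = fun _ => (1 : ℝ) := by funext x; simp [expTrunc]
    rw [this]
    simpa [expTrunc] using hasDerivAt_const r (1 : ℝ)
  | succ d ih =>
    have h : expTrunc (d + 1 + 1) =
        fun r => expTrunc (d + 1) r + r ^ (d + 1) / ((d + 1).factorial : ℝ) := by
      funext x
      exact expTrunc_succ _ _
    rw [h, expTrunc_succ]
    refine ih.add ?_
    have h2 := (hasDerivAt_pow (d + 1) r).div_const ((d + 1).factorial : ℝ)
    refine h2.congr_deriv ?_
    rw [Nat.factorial_succ]
    push_cast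
    have : ((d : ℝ) + 1) ≠ 0 := by positivity
    have h3 : (d.factorial : ℝ) ≠ 0 := by positivity
    field_simp

/-- The volume of `{s ∈ (0, 1]^d : w ∏ s ≤ 1}`. -/
noncomputable def prodLeVol (d : ℕ) (w : ℝ) : ℝ :=
  if w ≤ 1 then 1 else 1 / w * expTrunc d (Real.log w)

theorem prodLeVol_nonneg (d : ℕ) (w : ℝ) : 0 ≤ prodLeVol d w := by
  unfold prodLeVol
  split_ifs with h
  · exact zero_le_one
  · have h' : 1 < w := not_le.1 h
    exact mul_nonneg (by positivity) (expTrunc_nonneg d (Real.log_nonneg h'.le))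

/-- The recursion that integrates out one coordinate. For `w > 1` the range is cut at `t = 1/w`:
below, the integrand is `1`; above, it is the derivative of `w⁻¹ expTrunc (d + 1) (log (w t))`. -/
theorem lintegral_prodLeVol_mul (d : ℕ) {w : ℝ} (hw : 0 < w) :
    ∫⁻ t in Set.Ioc (0 : ℝ) 1, ENNReal.ofReal (prodLeVol d (w * t)) =
      ENNReal.ofReal (prodLeVol (d + 1) w) := by
  by_cases h1 : w ≤ 1
  · rw [prodLeVol, if_pos h1]
    rw [setLIntegral_congr_fun (g := fun _ => (1 : ENNReal)) measurableSet_Ioc]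
    · simp
    · intro t ht
      have : w * t ≤ 1 := mul_le_one₀ h1 ht.1.le ht.2
      simp [prodLeVol, this]
  · have hw1 : 1 < w := not_le.1 h1
    have hwi : 1 / w < 1 := (div_lt_one hw).2 hw1
    have hwi0 : 0 < 1 / w := by positivity
    rw [← Set.Ioc_union_Ioc_eq_Ioc hwi0.le hwi.le,
      lintegral_union measurableSet_Ioc (Set.Ioc_disjoint_Ioc_of_le le_rfl)]
    have hA : ∫⁻ t in Set.Ioc (0 : ℝ) (1 / w), ENNReal.ofReal (prodLeVol d (w * t)) =
        ENNReal.ofReal (1 / w) := by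
      rw [setLIntegral_congr_fun (g := fun _ => (1 : ENNReal)) measurableSet_Ioc]
      · simp
      · intro t ht
        have : w * t ≤ 1 := by
          have := mul_le_mul_of_nonneg_left ht.2 hw.le
          rwa [mul_one_div_cancel hw.ne'] at this
        simp [prodLeVol, this]
    have hlt : ∀ t ∈ Set.Ioc (1 / w) 1, 1 < w * t := fun t ht => by
      have := mul_lt_mul_of_pos_left ht.1 hw
      rwa [mul_one_div_cancel hw.ne'] at this
    have hder : ∀ t ∈ Set.uIcc (1 / w) 1, HasDerivAt
        (fun t => 1 / w * expTrunc (d + 1) (Real.log (w * t)))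
        (1 / (w * t) * expTrunc d (Real.log (w * t))) t := by
      intro t ht
      rw [Set.uIcc_of_le hwi.le] at ht
      have ht0 : 0 < t := hwi0.trans_le ht.1
      have hl : HasDerivAt (fun t => Real.log (w * t)) (w / (w * t)) t := by
        have := ((hasDerivAt_id t).const_mul w).log (mul_pos hw ht0).ne'
        simpa using this
      have hc := ((hasDerivAt_expTrunc_succ d (Real.log (w * t))).comp t hl).const_mul (1 / w)
      refine hc.congr_deriv ?_
      field_simp
    have hcont : ContinuousOn (fun t => 1 / (w * t) * expTrunc d (Real.log (w * t)))
        (Set.Icc (1 / w) 1) := by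
      have hne : ∀ t ∈ Set.Icc (1 / w) 1, w * t ≠ 0 := fun t ht =>
        (mul_pos hw (hwi0.trans_le ht.1)).ne'
      refine ContinuousOn.mul (continuousOn_const.div (by fun_prop) hne) ?_
      exact (continuous_expTrunc d).comp_continuousOn (ContinuousOn.log (by fun_prop) hne)
    have hint : IntervalIntegrable (fun t => 1 / (w * t) * expTrunc d (Real.log (w * t)))
        volume (1 / w) 1 := by
      refine ContinuousOn.intervalIntegrable ?_
      rwa [Set.uIcc_of_le hwi.le]
    have hftc := intervalIntegral.integral_eq_sub_of_hasDerivAt hder hint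
    have hB : ∫⁻ t in Set.Ioc (1 / w) 1, ENNReal.ofReal (prodLeVol d (w * t)) =
        ENNReal.ofReal (1 / w * expTrunc (d + 1) (Real.log w) - 1 / w) := by
      have e1 : 1 / w * expTrunc (d + 1) (Real.log w) - 1 / w =
          ∫ t in Set.Ioc (1 / w) 1, prodLeVol d (w * t) := by
        rw [setIntegral_congr_fun (g := fun t => 1 / (w * t) * expTrunc d (Real.log (w * t)))
          measurableSet_Ioc, ← intervalIntegral.integral_of_le hwi.le, hftc]
        · rw [mul_one, mul_one_div_cancel hw.ne', Real.log_one, expTrunc_succ_zero, mul_one]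
        · intro t ht
          simp only [prodLeVol]
          rw [if_neg (not_le.2 (hlt t ht))]
      rw [e1, ofReal_integral_eq_lintegral_ofReal]
      · refine IntegrableOn.congr_fun
          ((intervalIntegrable_iff_integrableOn_Ioc_of_le hwi.le).1 hint) ?_ measurableSet_Ioc
        intro t ht
        simp only [prodLeVol]
        rw [if_neg (not_le.2 (hlt t ht))]
      · exact Eventually.of_forall fun t => prodLeVol_nonneg d _
    rw [hA, hB, ← ENNReal.ofReal_add hwi0.le]
    · rw [prodLeVol, if_neg h1]
      congr 1
      ring
    · rw [expTrunc, Finset.sum_range_succ']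
      simp only [pow_zero, Nat.factorial_zero, Nat.cast_one, div_one, mul_add, mul_one,
        add_sub_cancel_right]
      refine mul_nonneg hwi0.le (Finset.sum_nonneg fun j _ => ?_)
      have := Real.log_nonneg hw1.le
      positivity

theorem lintegral_prod_mul_le_one (d : ℕ) {w : ℝ} (hw : 0 < w) :
    ∫⁻ s : Fin d → ℝ, (if w * ∏ i, s i ≤ 1 then 1 else 0)
      ∂(Measure.pi fun _ => volume.restrict (Set.Ioc (0 : ℝ) 1)) =
      ENNReal.ofReal (prodLeVol d w) := by
  induction d generalizing w with
  | zero =>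
    simp only [Finset.univ_eq_empty, Finset.prod_empty, mul_one]
    rw [lintegral_const]
    simp [prodLeVol, expTrunc]
    split_ifs <;> simp
  | succ d ih =>
    have hmp := (measurePreserving_piFinSuccAbove
      (fun _ : Fin (d + 1) => volume.restrict (Set.Ioc (0 : ℝ) 1)) 0).symm
    rw [← hmp.lintegral_comp_emb (MeasurableEquiv.measurableEmbedding _)]
    simp only [MeasurableEquiv.piFinSuccAbove_symm_apply, Fin.insertNthEquiv, Equiv.coe_fn_mk,
      Fin.prod_univ_succ, Fin.insertNth_zero, Fin.cons_zero, Fin.cons_succ,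
      Fin.zero_succAbove, cast_eq]
    rw [lintegral_prod]
    · rw [← lintegral_prodLeVol_mul d hw]
      refine setLIntegral_congr_fun measurableSet_Ioc fun t ht => ?_
      have h := ih (mul_pos hw ht.1)
      simp only [← mul_assoc]
      exact h
    · refine Measurable.aemeasurable ?_
      refine Measurable.ite (measurableSet_le ?_ measurable_const) measurable_const measurable_const
      fun_prop

/-- With `w = e^r` this is the Gamma integral; the primitive is `-w⁻¹ expTrunc (m + 1) (log w)`, as
consecutive truncations differ by `r^m / m!`. -/
theorem integral_log_pow_div_sq (m : ℕ) :
    IntegrableOn (fun w : ℝ => 1 / w ^ 2 * (Real.log w ^ m / (m.factorial : ℝ))) (Set.Ioi 1) ∧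
      ∫ w in Set.Ioi (1 : ℝ), 1 / w ^ 2 * (Real.log w ^ m / (m.factorial : ℝ)) = 1 := by
  have hder : ∀ w ∈ Set.Ici (1 : ℝ), HasDerivAt (fun w => -(w⁻¹ * expTrunc (m + 1) (Real.log w)))
      (1 / w ^ 2 * (Real.log w ^ m / (m.factorial : ℝ))) w := by
    intro w hw
    have hw0 : w ≠ 0 := (zero_lt_one.trans_le hw).ne'
    have h1 := (hasDerivAt_expTrunc_succ m (Real.log w)).comp w (Real.hasDerivAt_log hw0)
    refine ((hasDerivAt_inv hw0).mul h1).neg.congr_deriv ?_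
    simp only [Function.comp, expTrunc_succ]
    field_simp
    ring
  have hlim : Tendsto (fun w => -(w⁻¹ * expTrunc (m + 1) (Real.log w))) atTop (𝓝 0) := by
    have h : Tendsto (fun w : ℝ => ∑ j ∈ Finset.range (m + 1),
        Real.log w ^ j / (1 * w + 0) * (1 / (j.factorial : ℝ))) atTop
        (𝓝 (∑ j ∈ Finset.range (m + 1), 0 * (1 / (j.factorial : ℝ)))) :=
      tendsto_finsetSum _ fun j _ =>
        (Real.tendsto_pow_log_div_mul_add_atTop 1 0 j one_ne_zero).mul_const _
    simp only [zero_mul, Finset.sum_const_zero] at h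
    rw [← neg_zero]
    refine (h.congr fun w => ?_).neg
    rw [expTrunc, Finset.mul_sum]
    refine Finset.sum_congr rfl fun j _ => ?_
    simp only [one_mul, add_zero]
    ring
  have hpos : ∀ w ∈ Set.Ioi (1 : ℝ), 0 ≤ 1 / w ^ 2 * (Real.log w ^ m / (m.factorial : ℝ)) := by
    intro w hw
    have := Real.log_nonneg (le_of_lt hw)
    positivity
  have hint := integrableOn_Ioi_deriv_of_nonneg' hder hpos hlim
  refine ⟨hint, ?_⟩
  rw [integral_Ioi_of_hasDerivAt_of_tendsto' hder hint hlim, Real.log_one, expTrunc_succ_zero]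
  norm_num

theorem sum_range_choose_add (i j : ℕ) :
    ∑ b ∈ Finset.range j, (i + b).choose i = (i + j).choose (i + 1) := by
  induction j with
  | zero => simp
  | succ j ih =>
    rw [Finset.sum_range_succ, ih, ← Nat.add_assoc, Nat.choose_succ_succ, add_comm]

/-- The hockey stick identity, used once in each index. -/
theorem one_add_sum_sum_choose (i j : ℕ) :
    1 + ∑ a ∈ Finset.range i, ∑ b ∈ Finset.range j, (a + b).choose a = (i + j).choose i := by
  induction i with
  | zero => simp
  | succ i ih =>
    rw [Finset.sum_range_succ, ← add_assoc, ih, sum_range_choose_add,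
      show i + 1 + j = (i + j) + 1 by ring, Nat.choose_succ_succ]

/-- The interval `(0, 1]` contributes `1`. Beyond it, the square of the truncated exponential
expands into terms `log^{a+b} w / (a! b! w²)`, each with integral `C(a+b, a)`. -/
theorem integral_prodLeVol_sq (d : ℕ) :
    ∫⁻ w in Set.Ioi (0 : ℝ), ENNReal.ofReal (prodLeVol d w) * ENNReal.ofReal (prodLeVol d w) =
      ENNReal.ofReal (d.centralBinom : ℝ) := by
  rw [← Set.Ioc_union_Ioi_eq_Ioi (zero_le_one' ℝ),
    lintegral_union measurableSet_Ioi Set.Ioc_disjoint_Ioi_same]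
  have hA : ∫⁻ w in Set.Ioc (0 : ℝ) 1,
      ENNReal.ofReal (prodLeVol d w) * ENNReal.ofReal (prodLeVol d w) = ENNReal.ofReal 1 := by
    rw [setLIntegral_congr_fun (g := fun _ => (1 : ENNReal)) measurableSet_Ioc]
    · simp
    · intro t ht
      simp [prodLeVol, ht.2]
  have hexp : ∀ w ∈ Set.Ioi (1 : ℝ), prodLeVol d w * prodLeVol d w =
      ∑ a ∈ Finset.range d, ∑ b ∈ Finset.range d, ((a + b).choose a : ℝ) *
        (1 / w ^ 2 * (Real.log w ^ (a + b) / ((a + b).factorial : ℝ))) := by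
    intro w hw
    rw [prodLeVol, if_neg (not_le.2 hw), mul_mul_mul_comm, expTrunc, Finset.sum_mul_sum,
      Finset.mul_sum]
    refine Finset.sum_congr rfl fun a _ => ?_
    rw [Finset.mul_sum]
    refine Finset.sum_congr rfl fun b _ => ?_
    have h := Nat.add_choose_mul_factorial_mul_factorial a b
    have h' : ((a + b).choose a : ℝ) * a.factorial * b.factorial = (a + b).factorial := by
      rw [Nat.choose_symm_add]
      exact_mod_cast h
    have hw0 : w ≠ 0 := (zero_lt_one.trans hw).ne'
    rw [← h']
    have h1 : (a.factorial : ℝ) ≠ 0 := by positivity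
    have h2 : (b.factorial : ℝ) ≠ 0 := by positivity
    have h3 : ((a + b).choose a : ℝ) ≠ 0 := by
      exact_mod_cast (Nat.choose_pos (Nat.le_add_right a b)).ne'
    field_simp
    ring
  have hterm : ∀ a b : ℕ, IntegrableOn (fun w : ℝ => ((a + b).choose a : ℝ) *
      (1 / w ^ 2 * (Real.log w ^ (a + b) / ((a + b).factorial : ℝ)))) (Set.Ioi 1) := fun a b =>
    (integral_log_pow_div_sq (a + b)).1.const_mul _
  have hB : ∫⁻ w in Set.Ioi (1 : ℝ),
      ENNReal.ofReal (prodLeVol d w) * ENNReal.ofReal (prodLeVol d w) =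
      ENNReal.ofReal (∑ a ∈ Finset.range d, ∑ b ∈ Finset.range d, ((a + b).choose a : ℝ)) := by
    have e : ∫ w in Set.Ioi (1 : ℝ), prodLeVol d w * prodLeVol d w =
        ∑ a ∈ Finset.range d, ∑ b ∈ Finset.range d, ((a + b).choose a : ℝ) := by
      rw [setIntegral_congr_fun measurableSet_Ioi hexp, integral_finsetSum]
      · refine Finset.sum_congr rfl fun a _ => ?_
        rw [integral_finsetSum _ fun b _ => hterm a b]
        refine Finset.sum_congr rfl fun b _ => ?_
        rw [integral_const_mul, (integral_log_pow_div_sq (a + b)).2, mul_one]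
      · exact fun a _ => integrable_finsetSum _ fun b _ => hterm a b
    rw [← e, ofReal_integral_eq_lintegral_ofReal]
    · simp only [ENNReal.ofReal_mul (prodLeVol_nonneg d _)]
    · refine IntegrableOn.congr_fun (f := fun w => ∑ a ∈ Finset.range d, ∑ b ∈ Finset.range d,
        ((a + b).choose a : ℝ) *
        (1 / w ^ 2 * (Real.log w ^ (a + b) / ((a + b).factorial : ℝ)))) ?_
        (fun w hw => (hexp w hw).symm) measurableSet_Ioi
      exact integrable_finsetSum _ fun a _ => integrable_finsetSum _ fun b _ => hterm a b
    · exact Eventually.of_forall fun w => mul_nonneg (prodLeVol_nonneg d _) (prodLeVol_nonneg d _)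
  rw [hA, hB, ← ENNReal.ofReal_add zero_le_one
    (Finset.sum_nonneg fun a _ => Finset.sum_nonneg fun b _ => Nat.cast_nonneg _)]
  congr 1
  have h := one_add_sum_sum_choose d d
  rw [Nat.centralBinom_eq_two_mul_choose, two_mul, ← h]
  push_cast
  rfl

/-- The measure on `(0, 1]^d`. -/
noncomputable abbrev unitCube (J : Type*) [Fintype J] : Measure (J → ℝ) :=
  Measure.pi fun _ => volume.restrict (Set.Ioc 0 1)

theorem orthant_restrict_le_one (J : Type*) [Fintype J] :
    (orthant J).restrict (Set.pi Set.univ fun _ => Set.Iic 1) = unitCube J := by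
  rw [orthant, Measure.restrict_pi_pi]
  congr 1
  funext j
  rw [Measure.restrict_restrict measurableSet_Iic, Set.inter_comm, Set.Ioi_inter_Iic]

theorem ae_unitCube {J : Type*} [Fintype J] : ∀ᵐ s ∂(unitCube J), ∀ j, 0 < s j :=
  ae_all_iff.2 fun j => (Measure.quasiMeasurePreserving_eval
    (fun _ : J => volume.restrict (Set.Ioc (0 : ℝ) 1)) j).ae
      ((ae_restrict_mem measurableSet_Ioc).mono fun _ h => h.1)

theorem lintegral_layer_min {a b : ℝ} (ha : 0 < a) (hb : 0 < b) :
    ∫⁻ w in Set.Ioi (0 : ℝ), ((if w * a ≤ 1 then 1 else 0) * (if w * b ≤ 1 then 1 else 0)) =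
      ENNReal.ofReal (min (1 / a) (1 / b)) := by
  have : ∀ w : ℝ, ((if w * a ≤ 1 then 1 else 0) * (if w * b ≤ 1 then 1 else 0) : ENNReal) =
      (Set.Iic (min (1 / a) (1 / b))).indicator (fun _ => 1) w := by
    intro w
    have h1 : w * a ≤ 1 ↔ w ≤ 1 / a := (le_div_iff₀ ha).symm
    have h2 : w * b ≤ 1 ↔ w ≤ 1 / b := (le_div_iff₀ hb).symm
    simp only [h1, h2, Set.indicator_apply, Set.mem_Iic, le_min_iff]
    by_cases hA : w ≤ 1 / a <;> by_cases hB : w ≤ 1 / b <;> simp only [hA, hB] <;> simp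
  simp only [this]
  rw [lintegral_indicator measurableSet_Iic, Measure.restrict_restrict measurableSet_Iic,
    lintegral_const, Measure.restrict_apply_univ, Set.inter_comm, Set.Ioi_inter_Iic,
    Real.volume_Ioc, one_mul, sub_zero]

/-- Layer cake: `min (1/P) (1/P')` is the measure of the `w > 0` with `wP ≤ 1` and `wP' ≤ 1`. For
fixed `w` the two conditions involve disjoint sets of variables, so swapping the integrals leaves
the square of `prodLeVol d w`. -/
theorem innerConst_eq_centralBinom (d : ℕ) : innerConst d = d.centralBinom := by
  have hcube : ∫ s, innerLimit (d := d) s ∂(orthant (Fin d ⊕ Fin d)) =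
      ∫ s, min (1 / ∏ i, s (Sum.inl i)) (1 / ∏ i, s (Sum.inr i)) ∂(unitCube (Fin d ⊕ Fin d)) := by
    rw [← orthant_restrict_le_one, ← integral_indicator (MeasurableSet.univ_pi fun _ =>
      measurableSet_Iic)]
    refine integral_congr_ae (Eventually.of_forall fun s => ?_)
    classical simp only [innerLimit, Set.indicator_apply, Set.mem_pi, Set.mem_univ, true_implies,
      Set.mem_Iic, Finset.prod_div_distrib, Finset.prod_const_one]
  rw [innerConst, hcube, integral_eq_lintegral_of_nonneg_ae]
  rotate_left
  · filter_upwards [ae_unitCube] with s hs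
    exact le_min (one_div_nonneg.2 (Finset.prod_nonneg fun i _ => (hs _).le))
      (one_div_nonneg.2 (Finset.prod_nonneg fun i _ => (hs _).le))
  · refine Measurable.aestronglyMeasurable ?_
    refine Measurable.min (measurable_const.div ?_) (measurable_const.div ?_) <;> fun_prop
  have hmeas : Measurable fun p : (Fin d → ℝ) × ℝ =>
      (if p.2 * ∏ i, p.1 i ≤ 1 then (1 : ENNReal) else 0) := by
    refine Measurable.ite (measurableSet_le ?_ measurable_const) measurable_const measurable_const
    fun_prop
  have hl : ∫⁻ s, ENNReal.ofReal (min (1 / ∏ i, s (Sum.inl i)) (1 / ∏ i, s (Sum.inr i)))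
      ∂(unitCube (Fin d ⊕ Fin d)) = ENNReal.ofReal (d.centralBinom : ℝ) := by
    have h1 : ∫⁻ s, ENNReal.ofReal (min (1 / ∏ i, s (Sum.inl i)) (1 / ∏ i, s (Sum.inr i)))
        ∂(unitCube (Fin d ⊕ Fin d)) = ∫⁻ s, (∫⁻ w in Set.Ioi (0 : ℝ),
          ((if w * ∏ i, s (Sum.inl i) ≤ 1 then 1 else 0) *
            (if w * ∏ i, s (Sum.inr i) ≤ 1 then 1 else 0))) ∂(unitCube (Fin d ⊕ Fin d)) := by
      refine lintegral_congr_ae ?_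
      filter_upwards [ae_unitCube] with s hs
      rw [lintegral_layer_min (Finset.prod_pos fun i _ => hs _) (Finset.prod_pos fun i _ => hs _)]
    rw [h1, lintegral_lintegral_swap]
    · rw [← integral_prodLeVol_sq d]
      refine setLIntegral_congr_fun measurableSet_Ioi fun w hw => ?_
      have hmp := (measurePreserving_sumPiEquivProdPi
        (X := fun _ : Fin d ⊕ Fin d => ℝ) (fun _ => volume.restrict (Set.Ioc (0 : ℝ) 1))).symm
      rw [← hmp.lintegral_comp_emb (MeasurableEquiv.measurableEmbedding _)]
      simp only [MeasurableEquiv.coe_sumPiEquivProdPi_symm, Equiv.sumPiEquivProdPi_symm_apply]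
      rw [lintegral_prod_mul (f := fun s : Fin d → ℝ => if w * ∏ i, s i ≤ 1 then (1 : ENNReal) else 0)
        (g := fun s : Fin d → ℝ => if w * ∏ i, s i ≤ 1 then (1 : ENNReal) else 0),
        lintegral_prod_mul_le_one d hw]
      · exact (hmeas.comp (measurable_id.prodMk measurable_const)).aemeasurable
      · exact (hmeas.comp (measurable_id.prodMk measurable_const)).aemeasurable
    · refine Measurable.aemeasurable ?_
      unfold Function.uncurry
      refine Measurable.mul (Measurable.ite (measurableSet_le ?_ measurable_const) measurable_const
        measurable_const) (Measurable.ite (measurableSet_le ?_ measurable_const) measurable_const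
        measurable_const) <;> fun_prop
  rw [hl, ENNReal.toReal_ofReal (Nat.cast_nonneg _)]

/-! ### Counting matrices block by block. -/

/-- The matrices of positive integers with `n i * (i-th row product) ≤ X` and
`m j * (j-th column product) ≤ X`. -/
def matSet (k X : ℕ) (n m : Fin k → ℕ) : Finset (Fin k → Fin k → ℕ) :=
  (Fintype.piFinset fun _ => Fintype.piFinset fun _ => Finset.Icc 1 X).filter fun a =>
    (∀ i, n i * ∏ j, a i j ≤ X) ∧ ∀ j, m j * ∏ i, a i j ≤ X

theorem mem_matSet {k X : ℕ} {n m : Fin k → ℕ} {a : Fin k → Fin k → ℕ} :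
    a ∈ matSet k X n m ↔ (∀ i j, a i j ∈ Finset.Icc 1 X) ∧
      (∀ i, n i * ∏ j, a i j ≤ X) ∧ ∀ j, m j * ∏ i, a i j ≤ X := by
  simp only [matSet, Finset.mem_filter, Fintype.mem_piFinset]

section Outer

variable {d : ℕ}

/-- The upper bounds for the last column and the last row, when the upper left block is `A`. -/
noncomputable def blockScale (X : ℕ) (n m : Fin (d + 1) → ℕ) (A : Fin d × Fin d → ℕ) :
    Fin d ⊕ Fin d → ℝ :=
  Sum.elim (fun i => (X : ℝ) / (n i.castSucc * ∏ j, (A (i, j) : ℝ)))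
    (fun j => (X : ℝ) / (m j.castSucc * ∏ i, (A (i, j) : ℝ)))

/-- The typical size of the lower right entry, when the upper left block is `A`. -/
noncomputable def blockCorner (X : ℕ) (n m : Fin (d + 1) → ℕ) (A : Fin d × Fin d → ℕ) : ℝ :=
  (X : ℝ) / m (Fin.last d) / ∏ i, blockScale X n m A (Sum.inl i)

variable {X : ℕ} {n m : Fin (d + 1) → ℕ} {A : Fin d × Fin d → ℕ}

theorem blockScale_pos (hX : 1 ≤ X) (hn : ∀ i, 1 ≤ n i) (hm : ∀ j, 1 ≤ m j) (hA : ∀ e, 1 ≤ A e)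
    (j : Fin d ⊕ Fin d) : 0 < blockScale X n m A j := by
  have hX' : (0 : ℝ) < X := by exact_mod_cast hX
  have hn' : ∀ i, (0 : ℝ) < n i := fun i => by exact_mod_cast hn i
  have hm' : ∀ i, (0 : ℝ) < m i := fun i => by exact_mod_cast hm i
  have hA' : ∀ e, (0 : ℝ) < A e := fun i => by exact_mod_cast hA i
  rcases j with i | j
  · exact div_pos hX' (mul_pos (hn' _) (Finset.prod_pos fun _ _ => hA' _))
  · exact div_pos hX' (mul_pos (hm' _) (Finset.prod_pos fun _ _ => hA' _))

theorem blockCorner_pos (hX : 1 ≤ X) (hn : ∀ i, 1 ≤ n i) (hm : ∀ j, 1 ≤ m j)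
    (hA : ∀ e, 1 ≤ A e) : 0 < blockCorner X n m A := by
  have hX' : (0 : ℝ) < X := by exact_mod_cast hX
  have hm' : ∀ i, (0 : ℝ) < m i := fun i => by exact_mod_cast hm i
  exact div_pos (div_pos hX' (hm' _)) (Finset.prod_pos fun i _ => blockScale_pos hX hn hm hA _)

theorem blockCorner_mul_prod_inl (hX : 1 ≤ X) (hn : ∀ i, 1 ≤ n i) (hm : ∀ j, 1 ≤ m j)
    (hA : ∀ e, 1 ≤ A e) :
    blockCorner X n m A * ∏ i, blockScale X n m A (Sum.inl i) = (X : ℝ) / m (Fin.last d) :=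
  div_mul_cancel₀ _ (Finset.prod_pos fun _ _ => blockScale_pos hX hn hm hA _).ne'

theorem prod_blockScale_inl :
    ∏ i, blockScale X n m A (Sum.inl i) =
      (X : ℝ) ^ d / ((∏ i : Fin d, (n i.castSucc : ℝ)) * ∏ e, (A e : ℝ)) := by
  simp only [blockScale, Sum.elim_inl]
  rw [Finset.prod_div_distrib, Finset.prod_mul_distrib, Fintype.prod_prod_type]
  simp

theorem prod_blockScale_inr :
    ∏ i, blockScale X n m A (Sum.inr i) =
      (X : ℝ) ^ d / ((∏ i : Fin d, (m i.castSucc : ℝ)) * ∏ e, (A e : ℝ)) := by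
  simp only [blockScale, Sum.elim_inr]
  rw [Finset.prod_div_distrib, Finset.prod_mul_distrib, Fintype.prod_prod_type_right]
  simp

/-- The corner is bounded once through the last row and once through the last column. Equality of `∏
n` and `∏ m` is what lets one scale `blockCorner` serve both bounds. -/
theorem blockCorner_mul_prod_inr (hX : 1 ≤ X) (hn : ∀ i, 1 ≤ n i) (hm : ∀ j, 1 ≤ m j)
    (hA : ∀ e, 1 ≤ A e) (hnm : ∏ i, n i = ∏ j, m j) :
    blockCorner X n m A * ∏ i, blockScale X n m A (Sum.inr i) = (X : ℝ) / n (Fin.last d) := by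
  have hX' : (X : ℝ) ≠ 0 := by exact_mod_cast (by omega : X ≠ 0)
  have hn' : ∀ i, (n i : ℝ) ≠ 0 := fun i => by
    exact_mod_cast (Nat.one_le_iff_ne_zero.1 (hn i))
  have hm' : ∀ i, (m i : ℝ) ≠ 0 := fun i => by
    exact_mod_cast (Nat.one_le_iff_ne_zero.1 (hm i))
  have hA' : ∏ e, (A e : ℝ) ≠ 0 := Finset.prod_ne_zero_iff.2 fun e _ => by
    exact_mod_cast (Nat.one_le_iff_ne_zero.1 (hA e))
  have h1 : ∏ i : Fin d, (n i.castSucc : ℝ) ≠ 0 := Finset.prod_ne_zero_iff.2 fun i _ => hn' _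
  have h2 : ∏ i : Fin d, (m i.castSucc : ℝ) ≠ 0 := Finset.prod_ne_zero_iff.2 fun i _ => hm' _
  have h : (∏ i : Fin d, (n i.castSucc : ℝ)) * n (Fin.last d) =
      (∏ i : Fin d, (m i.castSucc : ℝ)) * m (Fin.last d) := by
    rw [← Fin.prod_univ_castSucc (fun i => (n i : ℝ)), ← Fin.prod_univ_castSucc (fun i => (m i : ℝ))]
    exact_mod_cast hnm
  have hnl := hn' (Fin.last d)
  have hml := hm' (Fin.last d)
  rw [blockCorner, prod_blockScale_inl, prod_blockScale_inr]
  field_simp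
  linear_combination h

/-- This is the denominator of `innerDensity`; it depends on the block only through `1 / ∏ A`, so a
block enters the count with weight `1 / ∏ A`. -/
theorem blockCorner_mul_prod (hX : 1 ≤ X) (hn : ∀ i, 1 ≤ n i) (hm : ∀ j, 1 ≤ m j)
    (hA : ∀ e, 1 ≤ A e) :
    blockCorner X n m A * ∏ j, blockScale X n m A j =
      (X : ℝ) ^ (d + 1) / ((∏ j, (m j : ℝ)) * ∏ e, (A e : ℝ)) := by
  have hml : (m (Fin.last d) : ℝ) ≠ 0 := by exact_mod_cast (Nat.one_le_iff_ne_zero.1 (hm _))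
  rw [Fintype.prod_sum_type, ← mul_assoc, blockCorner_mul_prod_inl hX hn hm hA,
    prod_blockScale_inr, Fin.prod_univ_castSucc, div_mul_div_comm, pow_succ']
  congr 1
  ring

theorem le_blockScale_inl_iff (hn : ∀ i, 1 ≤ n i) (hA : ∀ e, 1 ≤ A e) (i : Fin d) (u : ℕ) :
    (u : ℝ) ≤ blockScale X n m A (Sum.inl i) ↔ n i.castSucc * ((∏ j, A (i, j)) * u) ≤ X := by
  have hn' : (0 : ℝ) < n i.castSucc := by exact_mod_cast hn _
  have hA' : (0 : ℝ) < ∏ j, (A (i, j) : ℝ) := Finset.prod_pos fun j _ => by exact_mod_cast hA _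
  rw [blockScale, Sum.elim_inl, le_div_iff₀ (mul_pos hn' hA'), ← Nat.cast_le (α := ℝ)]
  push_cast
  rw [show (u : ℝ) * (n i.castSucc * ∏ j, (A (i, j) : ℝ)) =
    n i.castSucc * ((∏ j, (A (i, j) : ℝ)) * u) by ring]

theorem le_blockScale_inr_iff (hm : ∀ i, 1 ≤ m i) (hA : ∀ e, 1 ≤ A e) (j : Fin d) (u : ℕ) :
    (u : ℝ) ≤ blockScale X n m A (Sum.inr j) ↔ m j.castSucc * ((∏ i, A (i, j)) * u) ≤ X := by
  have hn' : (0 : ℝ) < m j.castSucc := by exact_mod_cast hm _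
  have hA' : (0 : ℝ) < ∏ i, (A (i, j) : ℝ) := Finset.prod_pos fun j _ => by exact_mod_cast hA _
  rw [blockScale, Sum.elim_inr, le_div_iff₀ (mul_pos hn' hA'), ← Nat.cast_le (α := ℝ)]
  push_cast
  rw [show (u : ℝ) * (m j.castSucc * ∏ i, (A (i, j) : ℝ)) =
    m j.castSucc * ((∏ i, (A (i, j) : ℝ)) * u) by ring]

theorem card_filter_mul_le {X a b : ℕ} (ha : 1 ≤ a) (hb : 1 ≤ b) :
    ((Finset.Icc 1 X).filter fun w => a * w ≤ X ∧ b * w ≤ X).card =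
      ⌊min ((X : ℝ) / a) ((X : ℝ) / b)⌋₊ := by
  have ha' : (0 : ℝ) < a := by exact_mod_cast ha
  have hb' : (0 : ℝ) < b := by exact_mod_cast hb
  have : ((Finset.Icc 1 X).filter fun w => a * w ≤ X ∧ b * w ≤ X) =
      Finset.Icc 1 ⌊min ((X : ℝ) / a) ((X : ℝ) / b)⌋₊ := by
    ext w
    simp only [Finset.mem_filter, Finset.mem_Icc]
    rw [Nat.le_floor_iff (by positivity), le_min_iff, le_div_iff₀ ha', le_div_iff₀ hb']
    constructor
    · rintro ⟨⟨h1, -⟩, h2, h3⟩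
      refine ⟨h1, ?_, ?_⟩
      · rw [mul_comm]; exact_mod_cast h2
      · rw [mul_comm]; exact_mod_cast h3
    · rintro ⟨h1, h2, h3⟩
      have h2' : a * w ≤ X := by rw [mul_comm]; exact_mod_cast h2
      have h3' : b * w ≤ X := by rw [mul_comm]; exact_mod_cast h3
      refine ⟨⟨h1, ?_⟩, h2', h3'⟩
      exact (Nat.le_mul_of_pos_left w ha).trans h2'
  rw [this, Nat.card_Icc, Nat.add_sub_cancel]

/-- The conditions on the last column, the last row and the corner. -/
def blockCond (X : ℕ) (n m : Fin (d + 1) → ℕ) (A : Fin d × Fin d → ℕ) (y : Fin d ⊕ Fin d → ℕ) :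
    Prop :=
  (∀ i, n i.castSucc * ((∏ j, A (i, j)) * y (Sum.inl i)) ≤ X) ∧
    ∀ j, m j.castSucc * ((∏ i, A (i, j)) * y (Sum.inr j)) ≤ X

open scoped Classical in
theorem sum_corner_eq_innerTerm (hX : 1 ≤ X) (hn : ∀ i, 1 ≤ n i) (hm : ∀ j, 1 ≤ m j)
    (hA : ∀ e, 1 ≤ A e) (hnm : ∏ i, n i = ∏ j, m j) {y : Fin d ⊕ Fin d → ℕ} (hy : ∀ j, 1 ≤ y j) :
    (((Finset.Icc 1 X).filter fun w => blockCond X n m A y ∧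
      n (Fin.last d) * ((∏ j, y (Sum.inr j)) * w) ≤ X ∧
        m (Fin.last d) * ((∏ i, y (Sum.inl i)) * w) ≤ X).card : ℝ) =
      innerTerm (blockScale X n m A) (blockCorner X n m A) y := by
  have hcond : (∀ j, 1 ≤ y j ∧ (y j : ℝ) ≤ blockScale X n m A j) ↔ blockCond X n m A y := by
    constructor
    · intro h
      exact ⟨fun i => (le_blockScale_inl_iff hn hA i _).1 (h _).2,
        fun j => (le_blockScale_inr_iff hm hA j _).1 (h _).2⟩
    · rintro ⟨h1, h2⟩ (i | j)
      · exact ⟨hy _, (le_blockScale_inl_iff hn hA i _).2 (h1 i)⟩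
      · exact ⟨hy _, (le_blockScale_inr_iff hm hA j _).2 (h2 j)⟩
  unfold innerTerm
  by_cases hc : blockCond X n m A y
  · rw [if_pos (hcond.2 hc)]
    simp only [hc, true_and]
    rw [Finset.prod_div_distrib, Finset.prod_div_distrib,
      mul_min_of_nonneg _ _ (blockCorner_pos hX hn hm hA).le, ← mul_div_assoc, ← mul_div_assoc,
      blockCorner_mul_prod_inl hX hn hm hA, blockCorner_mul_prod_inr hX hn hm hA hnm]
    simp only [← mul_assoc]
    rw [card_filter_mul_le
      (Nat.mul_pos (hn _) (Finset.prod_pos fun j _ => hy _))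
      (Nat.mul_pos (hm _) (Finset.prod_pos fun j _ => hy _)), min_comm]
    push_cast
    rw [div_div, div_div]
  · rw [if_neg (fun h => hc (hcond.1 h))]
    simp [hc]

/-- The upper left block, the last column and row, and the corner of a matrix. -/
def blockEquiv (d : ℕ) : (Fin (d + 1) → Fin (d + 1) → ℕ) ≃
    (Fin d × Fin d → ℕ) × (Fin d ⊕ Fin d → ℕ) × ℕ where
  toFun a := (fun e => a e.1.castSucc e.2.castSucc,
    Sum.elim (fun i => a i.castSucc (Fin.last d)) (fun j => a (Fin.last d) j.castSucc),
    a (Fin.last d) (Fin.last d))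
  invFun t := Fin.snoc (α := fun _ => Fin (d + 1) → ℕ)
    (fun i => Fin.snoc (α := fun _ => ℕ) (fun j => t.1 (i, j)) (t.2.1 (Sum.inl i)))
    (Fin.snoc (α := fun _ => ℕ) (fun j => t.2.1 (Sum.inr j)) t.2.2)
  left_inv a := by
    funext i j
    refine Fin.lastCases ?_ (fun i => ?_) i <;> refine Fin.lastCases ?_ (fun j => ?_) j <;> simp
  right_inv t := by
    obtain ⟨A, y, w⟩ := t
    refine Prod.ext ?_ (Prod.ext ?_ ?_)
    · funext e
      simp
    · funext e
      rcases e with i | j <;> simp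
    · simp

open scoped Classical in
theorem card_matSet_eq_sum (hX : 1 ≤ X) (hn : ∀ i, 1 ≤ n i) (hm : ∀ j, 1 ≤ m j)
    (hnm : ∏ i, n i = ∏ j, m j) :
    ((matSet (d + 1) X n m).card : ℝ) =
      ∑ A ∈ Fintype.piFinset fun _ : Fin d × Fin d => Finset.Icc 1 X,
        ∑ y ∈ Fintype.piFinset fun _ : Fin d ⊕ Fin d => Finset.Icc 1 X,
          innerTerm (blockScale X n m A) (blockCorner X n m A) y := by
  set S := ((Fintype.piFinset fun _ : Fin d × Fin d => Finset.Icc 1 X) ×ˢ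
    ((Fintype.piFinset fun _ : Fin d ⊕ Fin d => Finset.Icc 1 X) ×ˢ Finset.Icc 1 X)).filter
    (fun t => blockCond X n m t.1 t.2.1 ∧
      n (Fin.last d) * ((∏ j, t.2.1 (Sum.inr j)) * t.2.2) ≤ X ∧
        m (Fin.last d) * ((∏ i, t.2.1 (Sum.inl i)) * t.2.2) ≤ X) with hS
  have hcard : (matSet (d + 1) X n m).card = S.card := by
    refine Finset.card_equiv (blockEquiv d) fun a => ?_
    rw [mem_matSet, hS, Finset.mem_filter, Finset.mem_product, Finset.mem_product,
      Fintype.mem_piFinset, Fintype.mem_piFinset]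
    simp only [blockEquiv, Equiv.coe_fn_mk, Fin.forall_fin_succ', Fin.prod_univ_castSucc,
      blockCond, Sum.forall, Sum.elim_inl, Sum.elim_inr, Prod.forall]
    constructor
    · rintro ⟨⟨h1, h2, h3⟩, ⟨h4, h5⟩, h6, h7⟩
      exact ⟨⟨fun i j => (h1 i).1 j, ⟨fun i => (h1 i).2, h2⟩, h3⟩, ⟨h4, h6⟩, h5, h7⟩
    · rintro ⟨⟨h1, ⟨h2, h2'⟩, h3⟩, ⟨h4, h6⟩, h5, h7⟩
      exact ⟨⟨fun i => ⟨h1 i, h2 i⟩, h2', h3⟩, ⟨h4, h5⟩, h6, h7⟩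
  rw [hcard, hS, Finset.card_filter, Finset.sum_product]
  push_cast
  refine Finset.sum_congr rfl fun A hA => ?_
  rw [Finset.sum_product]
  refine Finset.sum_congr rfl fun y hy => ?_
  have hA' : ∀ e, 1 ≤ A e := fun e => (Finset.mem_Icc.1 (Fintype.mem_piFinset.1 hA e)).1
  have hy' : ∀ e, 1 ≤ y e := fun e => (Finset.mem_Icc.1 (Fintype.mem_piFinset.1 hy e)).1
  rw [← sum_corner_eq_innerTerm hX hn hm hA' hnm hy', Finset.card_filter]
  push_cast
  rfl

theorem blockScale_inl_le (hn : ∀ i, 1 ≤ n i) (hA : ∀ e, 1 ≤ A e) (i j : Fin d) :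
    blockScale X n m A (Sum.inl i) ≤ (X : ℝ) / A (i, j) := by
  have hAp : (0 : ℝ) < A (i, j) := by exact_mod_cast hA _
  refine div_le_div_of_nonneg_left (Nat.cast_nonneg _) hAp ?_
  have h1 : (A (i, j) : ℝ) ≤ ∏ j, (A (i, j) : ℝ) := by
    have : A (i, j) ≤ ∏ j, A (i, j) :=
      Finset.single_le_prod' (f := fun j => A (i, j)) (fun j _ => hA _) (Finset.mem_univ j)
    exact_mod_cast this
  have h2 : (1 : ℝ) ≤ n i.castSucc := by exact_mod_cast hn _
  nlinarith

theorem blockScale_le (hn : ∀ i, 1 ≤ n i) (hm : ∀ i, 1 ≤ m i) (hA : ∀ e, 1 ≤ A e)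
    (j : Fin d ⊕ Fin d) : blockScale X n m A j ≤ X := by
  have hX : (0 : ℝ) ≤ X := Nat.cast_nonneg _
  have hp : ∀ f : Fin d → Fin d × Fin d, (1 : ℝ) ≤ ∏ j, (A (f j) : ℝ) := fun f => by
    have : 1 ≤ ∏ j, A (f j) := Nat.succ_le_of_lt (Finset.prod_pos fun j _ => hA _)
    exact_mod_cast this
  rcases j with i | j
  · refine div_le_self hX ?_
    have h2 : (1 : ℝ) ≤ n i.castSucc := by exact_mod_cast hn _
    exact one_le_mul_of_one_le_of_one_le h2 (hp fun j => (i, j))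
  · refine div_le_self hX ?_
    have h2 : (1 : ℝ) ≤ m j.castSucc := by exact_mod_cast hm _
    exact one_le_mul_of_one_le_of_one_le h2 (hp fun i => (i, j))

/-- The number of matrices in `matSet`, normalized. -/
noncomputable def matDensity (d X : ℕ) (n m : Fin (d + 1) → ℕ) : ℝ :=
  (matSet (d + 1) X n m).card * (∏ i, (n i : ℝ)) / ((X : ℝ) ^ (d + 1) * Real.log X ^ (d ^ 2))

theorem card_matSet_mul_div (hX : 1 ≤ X) (hn : ∀ i, 1 ≤ n i) (hm : ∀ j, 1 ≤ m j)
    (hnm : ∏ i, n i = ∏ j, m j) :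
    ((matSet (d + 1) X n m).card : ℝ) * (∏ i, (n i : ℝ)) / (X : ℝ) ^ (d + 1) =
      ∑ A ∈ Fintype.piFinset fun _ : Fin d × Fin d => Finset.Icc 1 X,
        innerDensity (blockScale X n m A) (blockCorner X n m A) / ∏ e, (A e : ℝ) := by
  rw [card_matSet_eq_sum hX hn hm hnm, Finset.sum_mul, Finset.sum_div]
  refine Finset.sum_congr rfl fun A hA => ?_
  have hA' : ∀ e, 1 ≤ A e := fun e => (Finset.mem_Icc.1 (Fintype.mem_piFinset.1 hA e)).1
  have hsub : ∑ y ∈ Fintype.piFinset fun _ : Fin d ⊕ Fin d => Finset.Icc 1 X,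
      innerTerm (blockScale X n m A) (blockCorner X n m A) y =
      ∑ y ∈ Fintype.piFinset fun j => Finset.Icc 1 ⌊blockScale X n m A j⌋₊,
        innerTerm (blockScale X n m A) (blockCorner X n m A) y := by
    symm
    refine Finset.sum_subset (fun y hy => ?_) fun y _ hy => ?_
    · refine Fintype.mem_piFinset.2 fun j => ?_
      have hj := Finset.mem_Icc.1 (Fintype.mem_piFinset.1 hy j)
      refine Finset.mem_Icc.2 ⟨hj.1, hj.2.trans ?_⟩
      have := Nat.floor_le_floor (blockScale_le (X := X) hn hm hA' j)
      rwa [Nat.floor_natCast] at this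
    · unfold innerTerm
      rw [if_neg]
      intro hc
      exact hy (Fintype.mem_piFinset.2 fun j =>
        Finset.mem_Icc.2 ⟨(hc j).1, Nat.le_floor (hc j).2⟩)
  rw [hsub, innerDensity, blockCorner_mul_prod hX hn hm hA']
  have hX' : (X : ℝ) ≠ 0 := by exact_mod_cast (by omega : X ≠ 0)
  have hA'' : ∏ e, (A e : ℝ) ≠ 0 := Finset.prod_ne_zero_iff.2 fun e _ => by
    exact_mod_cast (Nat.one_le_iff_ne_zero.1 (hA' e))
  have hm' : ∏ j, (m j : ℝ) ≠ 0 := Finset.prod_ne_zero_iff.2 fun i _ => by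
    exact_mod_cast (Nat.one_le_iff_ne_zero.1 (hm i))
  have hnm' : ∏ i, (n i : ℝ) = ∏ j, (m j : ℝ) := by exact_mod_cast hnm
  rw [hnm']
  field_simp

end Outer

/-! ### The sum over the upper left block in logarithmic coordinates. -/

theorem volume_restrict_floor_rpow_preimage {X : ℕ} (hX : 2 ≤ X) (a : ℕ) :
    (volume.restrict (Set.Ioi (0 : ℝ))) ((fun t : ℝ => ⌊(X : ℝ) ^ t⌋₊) ⁻¹' {a}) =
      ENNReal.ofReal (if a = 0 then 0 else Real.log (1 + 1 / a) / Real.log X) := by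
  have hX1 : (1 : ℝ) < X := by exact_mod_cast (by omega : 1 < X)
  have hX0 : (0 : ℝ) < X := zero_lt_one.trans hX1
  have hL : 0 < Real.log X := Real.log_pos hX1
  have hcont : Continuous fun t : ℝ => (X : ℝ) ^ t := Real.continuous_const_rpow hX0.ne'
  have hm : Measurable fun t : ℝ => ⌊(X : ℝ) ^ t⌋₊ := Nat.measurable_floor.comp hcont.measurable
  rw [Measure.restrict_apply (hm (measurableSet_singleton a))]
  by_cases ha : a = 0
  · rw [if_pos ha, ENNReal.ofReal_zero]
    convert measure_empty (μ := (volume : Measure ℝ))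
    ext s
    simp only [ha, Set.mem_inter_iff, Set.mem_preimage, Set.mem_singleton_iff, Nat.floor_eq_zero,
      Set.mem_Ioi, Set.mem_empty_iff_false, iff_false, not_and, not_lt]
    intro h
    by_contra hs
    exact absurd h (not_lt.2 (Real.one_le_rpow hX1.le (not_le.1 hs).le))
  · rw [if_neg ha]
    have ha0 : (0 : ℝ) < a := by exact_mod_cast Nat.pos_of_ne_zero ha
    have ha1 : (1 : ℝ) ≤ a := by exact_mod_cast Nat.pos_of_ne_zero ha
    have hmem : ∀ t : ℝ, ⌊(X : ℝ) ^ t⌋₊ = a ↔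
        Real.log a / Real.log X ≤ t ∧ t < Real.log (a + 1) / Real.log X := fun t => by
      rw [Nat.floor_eq_iff (Real.rpow_pos_of_pos hX0 t).le, div_le_iff₀ hL, lt_div_iff₀ hL,
        ← Real.log_rpow hX0, Real.log_le_log_iff ha0 (Real.rpow_pos_of_pos hX0 t),
        Real.log_lt_log_iff (Real.rpow_pos_of_pos hX0 t) (by positivity)]
    have hval : Real.log (a + 1) / Real.log X - Real.log a / Real.log X =
        Real.log (1 + 1 / a) / Real.log X := by
      rw [← sub_div, ← Real.log_div (by positivity) ha0.ne']
      congr 2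
      field_simp
    -- The fibre is `[log a, log (a + 1))` divided by `log X`; restricting to `t > 0` can only
    -- remove its left endpoint, when `a = 1`.
    refine le_antisymm ?_ ?_
    · refine (measure_mono (t := Set.Ico (Real.log a / Real.log X)
        (Real.log (a + 1) / Real.log X)) fun t ht => ?_).trans ?_
      · exact (hmem t).1 ht.1
      · rw [Real.volume_Ico, hval]
    · rw [← hval, ← Real.volume_Ioo]
      refine measure_mono fun t ht => ⟨(hmem t).2 ⟨ht.1.le, ht.2⟩, ?_⟩
      exact (div_nonneg (Real.log_nonneg ha1) hL.le).trans_lt ht.1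

/-- The ratio of `1 / a` and `log (1 + 1 / a)`. -/
noncomputable def logRatio (a : ℕ) : ℝ := 1 / (a * Real.log (1 + 1 / a))

theorem half_le_mul_log {a : ℕ} (ha : 1 ≤ a) : 1 / 2 ≤ (a : ℝ) * Real.log (1 + 1 / a) := by
  have ha0 : (1 : ℝ) ≤ a := by exact_mod_cast ha
  have h := Real.one_sub_inv_le_log_of_pos (x := 1 + 1 / (a : ℝ)) (by positivity)
  have h2 : (1 : ℝ) - (1 + 1 / (a : ℝ))⁻¹ = 1 / (a + 1) := by
    field_simp
    ring
  rw [h2] at h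
  have h3 : (a : ℝ) * (1 / (a + 1)) ≤ a * Real.log (1 + 1 / a) :=
    mul_le_mul_of_nonneg_left h (by positivity)
  refine le_trans ?_ h3
  rw [mul_one_div, div_le_div_iff₀ (by norm_num) (by positivity)]
  linarith

theorem logRatio_nonneg (a : ℕ) : 0 ≤ logRatio a := by
  unfold logRatio
  refine one_div_nonneg.2 (mul_nonneg (Nat.cast_nonneg _) (Real.log_nonneg ?_))
  have : (0 : ℝ) ≤ 1 / (a : ℝ) := by positivity
  linarith

theorem logRatio_le {a : ℕ} (ha : 1 ≤ a) : logRatio a ≤ 2 := by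
  have h := half_le_mul_log ha
  unfold logRatio
  calc 1 / ((a : ℝ) * Real.log (1 + 1 / a)) ≤ 1 / (1 / 2) :=
        one_div_le_one_div_of_le (by norm_num) h
    _ = 2 := by norm_num

theorem logRatio_mul {a : ℕ} (ha : 1 ≤ a) : logRatio a * Real.log (1 + 1 / a) = 1 / a := by
  have h := half_le_mul_log ha
  have hl : Real.log (1 + 1 / (a : ℝ)) ≠ 0 := fun h0 => by rw [h0] at h; norm_num at h
  rw [logRatio, one_div, mul_inv, mul_assoc, inv_mul_cancel₀ hl, mul_one, one_div]

theorem tendsto_logRatio : Tendsto logRatio atTop (𝓝 1) := by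
  have h := (Real.tendsto_mul_log_one_add_div_atTop 1).comp
    (tendsto_natCast_atTop_atTop (R := ℝ))
  have h2 := h.inv₀ one_ne_zero
  rw [inv_one] at h2
  refine h2.congr fun a => ?_
  simp [logRatio]

section Outer

variable {d : ℕ}

/-- The summand of the outer sum, relative to the weights `∏ log (1 + 1 / A e)`. -/
noncomputable def outerTerm (X : ℕ) (n m : Fin (d + 1) → ℕ) (A : Fin d × Fin d → ℕ) : ℝ :=
  if ∀ e, 1 ≤ A e then
    innerDensity (blockScale X n m A) (blockCorner X n m A) * ∏ e, logRatio (A e) else 0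

theorem outerTerm_eq_zero {X : ℕ} {n m : Fin (d + 1) → ℕ} {A : Fin d × Fin d → ℕ}
    (hn : ∀ i, 1 ≤ n i) {e : Fin d × Fin d} (he : X < A e) : outerTerm X n m A = 0 := by
  unfold outerTerm
  split_ifs with hA
  · rw [innerDensity_eq_zero (j := Sum.inl e.1), zero_mul]
    refine (blockScale_inl_le hn hA e.1 e.2).trans_lt ?_
    have : (0 : ℝ) < A e := by exact_mod_cast hA e
    rw [div_lt_one this]
    exact_mod_cast he
  · rfl

/-- Under `A = ⌊X^t⌋` an integer `a` has mass `log (1 + 1/a) / log X`, and `logRatio` corrects it to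
`1 / (a log X)`. The `d²` entries account for the power of `log X` in `matDensity`. -/
theorem matDensity_eq_integral {X : ℕ} {n m : Fin (d + 1) → ℕ} (hX : 2 ≤ X) (hn : ∀ i, 1 ≤ n i)
    (hm : ∀ j, 1 ≤ m j) (hnm : ∏ i, n i = ∏ j, m j) :
    matDensity d X n m =
      ∫ t, outerTerm X n m (fun e => ⌊(X : ℝ) ^ t e⌋₊) ∂(orthant (Fin d × Fin d)) := by
  have hX1 : (1 : ℝ) < X := by exact_mod_cast (by omega : 1 < X)
  have hL : 0 < Real.log X := Real.log_pos hX1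
  have hcont : Continuous fun t : ℝ => (X : ℝ) ^ t :=
    Real.continuous_const_rpow (zero_lt_one.trans hX1).ne'
  have h := integral_comp_discrete (fun _ : Fin d × Fin d => volume.restrict (Set.Ioi (0 : ℝ)))
    (fun _ t => ⌊(X : ℝ) ^ t⌋₊) (fun _ => Nat.measurable_floor.comp hcont.measurable)
    (fun _ a => if a = 0 then 0 else Real.log (1 + 1 / a) / Real.log X)
    (fun _ a => by
      split_ifs
      · exact le_rfl
      · refine div_nonneg (Real.log_nonneg ?_) hL.le
        have : (0 : ℝ) ≤ 1 / (a : ℝ) := by positivity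
        linarith)
    (fun _ a => volume_restrict_floor_rpow_preimage hX a) (outerTerm X n m)
    (Fintype.piFinset fun _ => Finset.Icc 1 X) (fun A hA => by
      by_cases h1 : ∀ e, 1 ≤ A e
      · have : ∃ e, X < A e := by
          by_contra hc
          push Not at hc
          exact hA (Fintype.mem_piFinset.2 fun e => Finset.mem_Icc.2 ⟨h1 e, hc e⟩)
        obtain ⟨e, he⟩ := this
        exact outerTerm_eq_zero hn he
      · rw [outerTerm, if_neg h1])
  rw [h, matDensity, ← div_div, card_matSet_mul_div (by omega) hn hm hnm, Finset.sum_div]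
  refine Finset.sum_congr rfl fun A hA => ?_
  have hA' : ∀ e, 1 ≤ A e := fun e => (Finset.mem_Icc.1 (Fintype.mem_piFinset.1 hA e)).1
  rw [outerTerm, if_pos hA', mul_assoc, ← Finset.prod_mul_distrib, div_div, div_eq_mul_inv]
  congr 1
  have : ∀ e, logRatio (A e) * (if A e = 0 then 0 else Real.log (1 + 1 / (A e : ℝ)) / Real.log X) =
      (A e * Real.log X : ℝ)⁻¹ := fun e => by
    rw [if_neg (Nat.one_le_iff_ne_zero.1 (hA' e)), ← mul_div_assoc, logRatio_mul (hA' e),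
      mul_inv, one_div, div_eq_mul_inv]
  simp only [this]
  rw [Finset.prod_inv_distrib, Finset.prod_mul_distrib, Finset.prod_const, Finset.card_univ,
    Fintype.card_prod, Fintype.card_fin, sq]

/-- The majorant of the integrand representing `matDensity`. -/
noncomputable def outerBound (d : ℕ) (t : Fin d × Fin d → ℝ) : ℝ :=
  (∫ s, innerBound (d := d) s ∂(orthant (Fin d ⊕ Fin d))) * 2 ^ (d * d) *
    ∏ e, (Set.Ioc (0 : ℝ) 2).indicator (fun _ => (1 : ℝ)) (t e)

theorem integrable_outerBound (d : ℕ) : Integrable (outerBound d) (orthant (Fin d × Fin d)) := by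
  refine Integrable.const_mul (Integrable.fintype_prod
    (f := fun _ => (Set.Ioc (0 : ℝ) 2).indicator (fun _ => (1 : ℝ))) fun j => ?_) _
  refine Integrable.mono_measure ?_ Measure.restrict_le_self
  rw [integrable_indicator_iff measurableSet_Ioc]
  exact integrableOn_const measure_Ioc_lt_top.ne

theorem innerBound_integral_nonneg (d : ℕ) :
    0 ≤ ∫ s, innerBound (d := d) s ∂(orthant (Fin d ⊕ Fin d)) := by
  refine integral_nonneg fun s => Finset.prod_nonneg fun j _ =>
    Set.indicator_nonneg (fun t ht => Real.rpow_nonneg ht.1.le _) _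

theorem outerTerm_nonneg {X : ℕ} {n m : Fin (d + 1) → ℕ} (hX : 1 ≤ X) (hn : ∀ i, 1 ≤ n i)
    (hm : ∀ j, 1 ≤ m j) (A : Fin d × Fin d → ℕ) : 0 ≤ outerTerm X n m A := by
  unfold outerTerm
  split_ifs with hA
  · exact mul_nonneg (innerDensity_nonneg (blockScale_pos hX hn hm hA) (blockCorner_pos hX hn hm hA))
      (Finset.prod_nonneg fun e _ => logRatio_nonneg _)
  · exact le_rfl

theorem outerTerm_le {X : ℕ} {n m : Fin (d + 1) → ℕ} (hX : 2 ≤ X) (hn : ∀ i, 1 ≤ n i)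
    (hm : ∀ j, 1 ≤ m j) {t : Fin d × Fin d → ℝ} (ht : ∀ e, 0 < t e) :
    outerTerm X n m (fun e => ⌊(X : ℝ) ^ t e⌋₊) ≤ outerBound d t := by
  have hX1 : (1 : ℝ) < X := by exact_mod_cast (by omega : 1 < X)
  have hnn : 0 ≤ outerBound d t := mul_nonneg (mul_nonneg (innerBound_integral_nonneg d)
    (by positivity)) (Finset.prod_nonneg fun e _ => Set.indicator_nonneg (fun _ _ => zero_le_one) _)
  by_cases hbig : ∃ e, X < ⌊(X : ℝ) ^ t e⌋₊
  · obtain ⟨e, he⟩ := hbig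
    rw [outerTerm_eq_zero (A := fun e => ⌊(X : ℝ) ^ t e⌋₊) hn he]
    exact hnn
  · push Not at hbig
    -- From `⌊X^t⌋ ≤ X` follows `X^t < X + 1`, and `X + 1 ≤ X²` for `X ≥ 2`.
    have hle2 : ∀ e, t e ≤ 2 := fun e => by
      have h1 : (X : ℝ) ^ t e < X + 1 :=
        (Nat.lt_floor_add_one _).trans_le (by exact_mod_cast Nat.succ_le_succ (hbig e))
      by_contra hc
      have h2 : (X : ℝ) ^ (2 : ℝ) ≤ (X : ℝ) ^ t e :=
        Real.rpow_le_rpow_of_exponent_le hX1.le (not_le.1 hc).le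
      rw [Real.rpow_two] at h2
      have : (2 : ℝ) ≤ X := by exact_mod_cast hX
      nlinarith
    unfold outerTerm
    split_ifs with hA
    · refine (mul_le_mul_of_nonneg_right (innerDensity_le (blockScale_pos (by omega) hn hm hA)
          (blockCorner_pos (by omega) hn hm hA))
          (Finset.prod_nonneg fun e _ => logRatio_nonneg _)).trans ?_
      · unfold outerBound
        have hone : ∏ e, (Set.Ioc (0 : ℝ) 2).indicator (fun _ => (1 : ℝ)) (t e) = 1 :=
          Finset.prod_eq_one fun e _ => Set.indicator_of_mem (Set.mem_Ioc.2 ⟨ht e, hle2 e⟩) _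
        rw [hone, mul_one]
        refine mul_le_mul_of_nonneg_left ?_ (innerBound_integral_nonneg d)
        calc ∏ e, logRatio ⌊(X : ℝ) ^ t e⌋₊ ≤ ∏ _e : Fin d × Fin d, (2 : ℝ) :=
              Finset.prod_le_prod (fun e _ => logRatio_nonneg _) fun e _ => logRatio_le (hA e)
          _ = 2 ^ (d * d) := by simp
    · exact hnn

/-- The bound involves neither the weights nor `X`; all later uniformity rests on this. -/
theorem matDensity_le {X : ℕ} {n m : Fin (d + 1) → ℕ} (hX : 2 ≤ X) (hn : ∀ i, 1 ≤ n i)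
    (hm : ∀ j, 1 ≤ m j) (hnm : ∏ i, n i = ∏ j, m j) :
    matDensity d X n m ≤ ∫ t, outerBound d t ∂(orthant (Fin d × Fin d)) := by
  rw [matDensity_eq_integral hX hn hm hnm]
  refine integral_mono_of_nonneg (Eventually.of_forall fun t =>
    outerTerm_nonneg (by omega) hn hm _) (integrable_outerBound d) ?_
  filter_upwards [ae_orthant] with t ht
  exact outerTerm_le hX hn hm ht

theorem tendsto_floor_rpow_div {t : ℝ} (ht : 0 < t) :
    Tendsto (fun X : ℕ => (⌊(X : ℝ) ^ t⌋₊ : ℝ) / (X : ℝ) ^ t) atTop (𝓝 1) :=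
  (tendsto_nat_floor_div_atTop (R := ℝ)).comp
    ((tendsto_rpow_atTop ht).comp tendsto_natCast_atTop_atTop)

theorem tendsto_prod_floor_rpow_div {J : Type*} [Fintype J] {t : J → ℝ} (ht : ∀ e, 0 < t e) :
    Tendsto (fun X : ℕ => (∏ e, (⌊(X : ℝ) ^ t e⌋₊ : ℝ)) / (X : ℝ) ^ (∑ e, t e)) atTop (𝓝 1) := by
  have h : Tendsto (fun X : ℕ => ∏ e, ((⌊(X : ℝ) ^ t e⌋₊ : ℝ) / (X : ℝ) ^ t e)) atTop
      (𝓝 (∏ _e : J, (1 : ℝ))) := tendsto_finsetProd _ fun e _ => tendsto_floor_rpow_div (ht e)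
  rw [Finset.prod_const_one] at h
  refine h.congr' ?_
  filter_upwards [eventually_gt_atTop 0] with X hX
  rw [Finset.prod_div_distrib, Real.rpow_sum_of_pos (by exact_mod_cast hX)]

theorem tendsto_mul_div_prod_floor {J : Type*} [Fintype J] {t : J → ℝ} (ht : ∀ e, 0 < t e)
    {c : ℝ} (hc : 0 < c) (h : ∑ e, t e < 1) :
    Tendsto (fun X : ℕ => (X : ℝ) / (c * ∏ e, (⌊(X : ℝ) ^ t e⌋₊ : ℝ))) atTop atTop := by
  have h1 := ((tendsto_prod_floor_rpow_div ht).const_mul c).inv₀ (by simpa using hc.ne')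
  have h2 : Tendsto (fun X : ℕ => (X : ℝ) ^ (1 - ∑ e, t e)) atTop atTop :=
    (tendsto_rpow_atTop (by linarith)).comp tendsto_natCast_atTop_atTop
  refine (h2.atTop_mul_pos (by simpa using hc) h1).congr' ?_
  filter_upwards [eventually_gt_atTop 0] with X hX
  have hX0 : (0 : ℝ) < X := by exact_mod_cast hX
  rw [Real.rpow_sub hX0, Real.rpow_one]
  have := (Real.rpow_pos_of_pos hX0 (∑ e, t e)).ne'
  field_simp

theorem tendsto_mul_div_prod_floor_zero {J : Type*} [Fintype J] {t : J → ℝ} (ht : ∀ e, 0 < t e)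
    {c : ℝ} (hc : 0 < c) (h : 1 < ∑ e, t e) :
    Tendsto (fun X : ℕ => (X : ℝ) / (c * ∏ e, (⌊(X : ℝ) ^ t e⌋₊ : ℝ))) atTop (𝓝 0) := by
  have h1 := ((tendsto_prod_floor_rpow_div ht).const_mul c).inv₀ (by simpa using hc.ne')
  have h2 : Tendsto (fun X : ℕ => (X : ℝ) ^ (-(∑ e, t e - 1))) atTop (𝓝 0) :=
    (tendsto_rpow_neg_atTop (by linarith)).comp tendsto_natCast_atTop_atTop
  have h3 := h2.mul h1
  rw [zero_mul] at h3
  refine h3.congr' ?_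
  filter_upwards [eventually_gt_atTop 0] with X hX
  have hX0 : (0 : ℝ) < X := by exact_mod_cast hX
  rw [neg_sub, Real.rpow_sub hX0, Real.rpow_one]
  have := (Real.rpow_pos_of_pos hX0 (∑ e, t e)).ne'
  field_simp

theorem blockCorner_eq {X : ℕ} (hX : 0 < X) (n m : Fin (d + 1) → ℕ) (t : Fin d × Fin d → ℝ) :
    blockCorner X n m (fun e => ⌊(X : ℝ) ^ t e⌋₊) =
      (X : ℝ) ^ (∑ e, t e - (d - 1)) * (((∏ i : Fin d, (n i.castSucc : ℝ)) / m (Fin.last d)) *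
        ((∏ e, (⌊(X : ℝ) ^ t e⌋₊ : ℝ)) / (X : ℝ) ^ (∑ e, t e))) := by
  have hX0 : (0 : ℝ) < X := by exact_mod_cast hX
  rw [blockCorner, prod_blockScale_inl, Real.rpow_sub hX0, Real.rpow_sub hX0, Real.rpow_one,
    Real.rpow_natCast]
  have := (Real.rpow_pos_of_pos hX0 (∑ e, t e)).ne'
  rw [div_div_eq_mul_div]
  field_simp

/-- Up to constants, the range at row `i` is `X` to the power `1 - ∑_j t_{ij}`, likewise for
columns, and the corner scale is `X^{∑ t - (d-1)}`. A negative exponent kills the term; if all are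
positive, every range grows and the inner density tends to its constant. The weights affect
constants only, so the limit does not see them. -/
theorem tendsto_outerTerm {n m : Fin (d + 1) → ℕ} (hn : ∀ i, 1 ≤ n i) (hm : ∀ j, 1 ≤ m j)
    {t : Fin d × Fin d → ℝ} (ht : ∀ e, 0 < t e)
    (hgen : (∀ i, ∑ j, t (i, j) ≠ 1) ∧ (∀ j, ∑ i, t (i, j) ≠ 1) ∧ ∑ e, t e ≠ (d : ℝ) - 1) :
    Tendsto (fun X : ℕ => outerTerm X n m (fun e => ⌊(X : ℝ) ^ t e⌋₊)) atTop
      (𝓝 ((marginPolytope d 1 1).indicator (fun _ => innerConst d) t)) := by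
  obtain ⟨hrow, hcol, htot⟩ := hgen
  have hn' : ∀ i, (0 : ℝ) < n i := fun i => by exact_mod_cast hn i
  have hm' : ∀ i, (0 : ℝ) < m i := fun i => by exact_mod_cast hm i
  have hone : ∀ᶠ X : ℕ in atTop, ∀ e, 1 ≤ ⌊(X : ℝ) ^ t e⌋₊ := by
    filter_upwards [eventually_ge_atTop 1] with X hX e
    refine Nat.le_floor ?_
    rw [Nat.cast_one]
    exact Real.one_le_rpow (by exact_mod_cast hX) (ht e).le
  have hfl : ∀ e, Tendsto (fun X : ℕ => ⌊(X : ℝ) ^ t e⌋₊) atTop atTop := fun e =>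
    tendsto_nat_floor_atTop.comp ((tendsto_rpow_atTop (ht e)).comp tendsto_natCast_atTop_atTop)
  have hrho : Tendsto (fun X : ℕ => ∏ e, logRatio ⌊(X : ℝ) ^ t e⌋₊) atTop (𝓝 1) := by
    have h : Tendsto (fun X : ℕ => ∏ e, logRatio ⌊(X : ℝ) ^ t e⌋₊) atTop
        (𝓝 (∏ _e : Fin d × Fin d, (1 : ℝ))) :=
      tendsto_finsetProd _ fun e _ => tendsto_logRatio.comp (hfl e)
    rwa [Finset.prod_const_one] at h
  have hred : ∀ c : ℝ, Tendsto (fun X : ℕ =>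
      innerDensity (blockScale X n m fun e => ⌊(X : ℝ) ^ t e⌋₊)
        (blockCorner X n m fun e => ⌊(X : ℝ) ^ t e⌋₊)) atTop (𝓝 c) →
      Tendsto (fun X : ℕ => outerTerm X n m (fun e => ⌊(X : ℝ) ^ t e⌋₊)) atTop (𝓝 c) := by
    intro c hc
    have h := hc.mul hrho
    rw [mul_one] at h
    refine h.congr' ?_
    filter_upwards [hone] with X hX
    rw [outerTerm, if_pos hX]
  have hpos : ∀ᶠ X : ℕ in atTop, ∀ j, 0 < blockScale X n m (fun e => ⌊(X : ℝ) ^ t e⌋₊) j := by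
    filter_upwards [hone, eventually_ge_atTop 1] with X hX hX1 j
    exact blockScale_pos hX1 hn hm hX j
  have hposZ : ∀ᶠ X : ℕ in atTop, 0 < blockCorner X n m (fun e => ⌊(X : ℝ) ^ t e⌋₊) := by
    filter_upwards [hone, eventually_ge_atTop 1] with X hX hX1
    exact blockCorner_pos hX1 hn hm hX
  have hC : 0 < (∏ i : Fin d, (n i.castSucc : ℝ)) / m (Fin.last d) :=
    div_pos (Finset.prod_pos fun i _ => hn' _) (hm' _)
  have hfac := (tendsto_prod_floor_rpow_div ht).const_mul
    ((∏ i : Fin d, (n i.castSucc : ℝ)) / m (Fin.last d))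
  rw [mul_one] at hfac
  have hsumrow : ∑ i : Fin d, (1 - ∑ j, t (i, j)) = d - ∑ e, t e := by
    rw [Finset.sum_sub_distrib, Fintype.sum_prod_type]
    simp
  by_cases hr : ∃ i, 1 < ∑ j, t (i, j)
  · obtain ⟨i, hi⟩ := hr
    have hnot : t ∉ marginPolytope d 1 1 := fun h => absurd (h.2.1 i) (not_le.2 hi)
    rw [Set.indicator_of_notMem hnot]
    refine hred 0 (tendsto_const_nhds.congr' ?_)
    have h := tendsto_mul_div_prod_floor_zero (t := fun j => t (i, j)) (fun j => ht _)
      (hn' i.castSucc) hi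
    filter_upwards [h.eventually_lt_const one_pos] with X hX
    exact (innerDensity_eq_zero (j := Sum.inl i) hX).symm
  by_cases hcl : ∃ j, 1 < ∑ i, t (i, j)
  · obtain ⟨j, hj⟩ := hcl
    have hnot : t ∉ marginPolytope d 1 1 := fun h => absurd (h.2.2.1 j) (not_le.2 hj)
    rw [Set.indicator_of_notMem hnot]
    refine hred 0 (tendsto_const_nhds.congr' ?_)
    have h := tendsto_mul_div_prod_floor_zero (t := fun i => t (i, j)) (fun i => ht _)
      (hm' j.castSucc) hj
    filter_upwards [h.eventually_lt_const one_pos] with X hX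
    exact (innerDensity_eq_zero (j := Sum.inr j) hX).symm
  push Not at hr hcl
  rcases lt_or_gt_of_ne htot with hlt | hgt
  · have hnot : t ∉ marginPolytope d 1 1 := fun h => by
      have h4 := h.2.2.2
      simp only [Pi.one_apply] at h4
      rw [hsumrow] at h4
      linarith
    rw [Set.indicator_of_notMem hnot]
    refine hred 0 (tendsto_innerDensity_zero hpos hposZ ?_)
    have h2 : Tendsto (fun X : ℕ => (X : ℝ) ^ (-((d - 1) - ∑ e, t e))) atTop (𝓝 0) :=
      (tendsto_rpow_neg_atTop (by linarith)).comp tendsto_natCast_atTop_atTop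
    have h3 := h2.mul hfac
    rw [zero_mul] at h3
    refine h3.congr' ?_
    filter_upwards [eventually_gt_atTop 0] with X hX
    rw [blockCorner_eq hX, neg_sub]
  · have hin : t ∈ marginPolytope d 1 1 := by
      refine ⟨fun e => (ht e).le, hr, hcl, ?_⟩
      simp only [Pi.one_apply]
      rw [hsumrow]
      linarith
    rw [Set.indicator_of_mem hin]
    refine hred _ (tendsto_innerDensity (fun j => ?_) ?_)
    · rcases j with i | j
      · exact tendsto_mul_div_prod_floor (t := fun j => t (i, j)) (fun j => ht _)
          (hn' i.castSucc) (lt_of_le_of_ne (hr i) (hrow i))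
      · exact tendsto_mul_div_prod_floor (t := fun i => t (i, j)) (fun i => ht _)
          (hm' j.castSucc) (lt_of_le_of_ne (hcl j) (hcol j))
    · have h2 : Tendsto (fun X : ℕ => (X : ℝ) ^ (∑ e, t e - (d - 1))) atTop atTop :=
        (tendsto_rpow_atTop (by linarith)).comp tendsto_natCast_atTop_atTop
      refine (h2.atTop_mul_pos hC hfac).congr' ?_
      filter_upwards [eventually_gt_atTop 0] with X hX
      rw [blockCorner_eq hX]

theorem tendsto_matDensity {n m : Fin (d + 1) → ℕ} (hn : ∀ i, 1 ≤ n i) (hm : ∀ j, 1 ≤ m j)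
    (hnm : ∏ i, n i = ∏ j, m j) :
    Tendsto (fun X : ℕ => matDensity d X n m) atTop
      (𝓝 ((d.centralBinom : ℝ) * birkhoffVol d)) := by
  have hlim : ∫ t, (marginPolytope d 1 1).indicator (fun _ => innerConst d) t
      ∂(orthant (Fin d × Fin d)) = (d.centralBinom : ℝ) * birkhoffVol d := by
    rw [integral_indicator_const _ (measurableSet_marginPolytope d _ _), smul_eq_mul, mul_comm,
      innerConst_eq_centralBinom, birkhoffVol, orthant_eq_restrict, measureReal_def,
      Measure.restrict_apply (measurableSet_marginPolytope d _ _), measureReal_def]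
    congr 2
    refine measure_congr ?_
    -- The integral is over the open orthant, the polytope meets the closed one; the coordinate
    -- hyperplanes are null.
    have hne : ∀ᵐ x : Fin d × Fin d → ℝ, ∀ e, x e ≠ 0 := ae_all_iff.2 fun e =>
      (Measure.quasiMeasurePreserving_eval (fun _ : Fin d × Fin d => (volume : Measure ℝ)) e).ae
        (Measure.ae_ne volume 0)
    filter_upwards [hne] with x hx
    refine propext ⟨fun h => h.1, fun h => ⟨h, fun e _ => ?_⟩⟩
    exact lt_of_le_of_ne (h.1 e) (hx e).symm
  rw [← hlim]
  have h1 := tendsto_integral_filter_of_dominated_convergence (μ := orthant (Fin d × Fin d))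
    (l := atTop) (F := fun (X : ℕ) t => outerTerm X n m (fun e => ⌊(X : ℝ) ^ t e⌋₊))
    (f := (marginPolytope d 1 1).indicator (fun _ => innerConst d)) (outerBound d)
    (by
      filter_upwards [eventually_gt_atTop 0] with X hX
      refine Measurable.aestronglyMeasurable ?_
      refine (measurable_of_countable (outerTerm X n m)).comp (measurable_pi_iff.2 fun e => ?_)
      have hcont : Continuous fun t : ℝ => (X : ℝ) ^ t :=
        Real.continuous_const_rpow (by exact_mod_cast hX.ne')
      exact (Nat.measurable_floor.comp hcont.measurable).comp (measurable_pi_apply e))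
    (by
      filter_upwards [eventually_ge_atTop 2] with X hX
      filter_upwards [ae_orthant] with t ht
      rw [Real.norm_of_nonneg (outerTerm_nonneg (by omega) hn hm _)]
      exact outerTerm_le hX hn hm ht) (integrable_outerBound d) (by
      have hgen : ∀ᵐ t ∂(orthant (Fin d × Fin d)), (∀ i, ∑ j, t (i, j) ≠ 1) ∧
          (∀ j, ∑ i, t (i, j) ≠ 1) ∧ ∑ e, t e ≠ (d : ℝ) - 1 := by
        rw [orthant_eq_restrict]
        exact ae_restrict_of_ae (ae_margins_ne d)
      filter_upwards [ae_orthant, hgen] with t ht hg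
      exact tendsto_outerTerm hn hm ht hg)
  refine h1.congr' ?_
  filter_upwards [eventually_ge_atTop 2] with X hX
  rw [matDensity_eq_integral hX hn hm hnm]

end Outer

/-! ### The divisor function and its Dirichlet series over factored numbers. -/

section DivisorFunction

theorem eq_of_mul_eq_mul_of_coprime {a b c e : ℕ} (h : a * b = c * e) (hae : a.Coprime e)
    (hcb : c.Coprime b) : a = c :=
  Nat.dvd_antisymm (hae.dvd_of_dvd_mul_right (h ▸ Dvd.intro _ rfl))
    (hcb.dvd_of_dvd_mul_right (h.symm ▸ Dvd.intro _ rfl))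

theorem divisorFun_one (k : ℕ) : divisorFun k 1 = 1 := by
  simp [divisorFun, Nat.finMulAntidiag_one]

theorem divisorFun_prime (k : ℕ) {p : ℕ} (hp : p.Prime) : divisorFun k p = k := by
  rw [divisorFun, Nat.card_finMulAntidiag_of_squarefree hp.squarefree,
    ArithmeticFunction.cardDistinctFactors_apply_prime hp, pow_one]

/-- A factorization of `ab` splits entrywise by gcds with `a` and with `b`, and entrywise
multiplication is the inverse. -/
theorem divisorFun_mul_of_coprime (k : ℕ) {a b : ℕ} (hab : a.Coprime b) :
    divisorFun k (a * b) = divisorFun k a * divisorFun k b := by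
  rcases Nat.eq_zero_or_pos a with rfl | ha
  · simp [divisorFun, Nat.finMulAntidiag_zero_right]
  rcases Nat.eq_zero_or_pos b with rfl | hb
  · simp [divisorFun, Nat.finMulAntidiag_zero_right]
  rw [divisorFun, divisorFun, divisorFun, ← Finset.card_product]
  refine Finset.card_nbij' (fun h => (fun i => (h i).gcd a, fun i => (h i).gcd b))
    (fun fg => fun i => fg.1 i * fg.2 i) ?_ ?_ ?_ ?_
  · intro h hh
    have hh' := Nat.mem_finMulAntidiag.mp hh
    have hsplit : ∀ i, (h i).gcd a * (h i).gcd b = h i := fun i => by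
      rw [← Nat.Coprime.gcd_mul _ hab]
      exact Nat.gcd_eq_left (Nat.dvd_of_mem_finMulAntidiag hh i)
    have hprod : (∏ i, (h i).gcd a) * ∏ i, (h i).gcd b = a * b := by
      rw [← Finset.prod_mul_distrib, Finset.prod_congr rfl fun i _ => hsplit i, hh'.1]
    have h1 : Nat.Coprime (∏ i, (h i).gcd a) b :=
      Nat.Coprime.prod_left fun i _ => hab.coprime_dvd_left (Nat.gcd_dvd_right _ _)
    have h2 : Nat.Coprime a (∏ i, (h i).gcd b) :=
      Nat.Coprime.prod_right fun i _ => hab.coprime_dvd_right (Nat.gcd_dvd_right _ _)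
    have h3 := eq_of_mul_eq_mul_of_coprime hprod h1 h2
    simp only [Finset.coe_product, Set.mem_prod, Finset.mem_coe, Nat.mem_finMulAntidiag]
    refine ⟨⟨h3, ha.ne'⟩, ?_, hb.ne'⟩
    rw [h3] at hprod
    exact Nat.eq_of_mul_eq_mul_left ha hprod
  · intro fg hfg
    simp only [Finset.coe_product, Set.mem_prod, Finset.mem_coe, Nat.mem_finMulAntidiag] at hfg ⊢
    rw [Finset.prod_mul_distrib, hfg.1.1, hfg.2.1]
    exact ⟨rfl, (Nat.mul_pos ha hb).ne'⟩
  · intro h hh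
    funext i
    change (h i).gcd a * (h i).gcd b = h i
    rw [← Nat.Coprime.gcd_mul _ hab]
    exact Nat.gcd_eq_left (Nat.dvd_of_mem_finMulAntidiag hh i)
  · rintro ⟨f, g⟩ hfg
    simp only [Finset.coe_product, Set.mem_prod, Finset.mem_coe] at hfg
    have hf := fun i => Nat.dvd_of_mem_finMulAntidiag hfg.1 i
    have hg := fun i => Nat.dvd_of_mem_finMulAntidiag hfg.2 i
    refine Prod.ext (funext fun i => ?_) (funext fun i => ?_)
    · change (f i * g i).gcd a = f i
      rw [Nat.Coprime.gcd_mul_right_cancel _ ((hab.coprime_dvd_right (hg i)).symm)]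
      exact Nat.gcd_eq_left (hf i)
    · change (f i * g i).gcd b = g i
      rw [Nat.Coprime.gcd_mul_left_cancel _ (hab.coprime_dvd_left (hf i))]
      exact Nat.gcd_eq_left (hg i)

theorem divisorFun_prime_pow_le (k : ℕ) {p : ℕ} (hp : p.Prime) (m : ℕ) :
    divisorFun k (p ^ m) ≤ (m + 1) ^ k := by
  rw [divisorFun, Nat.finMulAntidiag_eq_piFinset_divisors_filter dvd_rfl
    (pow_ne_zero m hp.ne_zero)]
  refine (Finset.card_filter_le _ _).trans ?_
  rw [Fintype.card_piFinset, Finset.prod_const, Finset.card_univ, Fintype.card_fin,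
    Nat.divisors_prime_pow hp, Finset.card_map, Finset.card_range]

/-- The summand of the Dirichlet series of `d_k²` at `1`. -/
noncomputable def divisorTerm (k n : ℕ) : ℝ := (divisorFun k n : ℝ) ^ 2 / n

theorem divisorTerm_nonneg (k n : ℕ) : 0 ≤ divisorTerm k n := by
  unfold divisorTerm; positivity

/-- A factor `p^{-r}` is kept and the rest is bounded through `p ≥ 2`. The case `r = 0` gives
convergence and a bound uniform in `p`; `r = 2` controls the terms of second order. -/
theorem divisorTerm_prime_pow_add_le (k : ℕ) {p : ℕ} (hp : p.Prime) (r m : ℕ) :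
    divisorTerm k (p ^ (m + r)) ≤ (1 / p : ℝ) ^ r * ((m + r + 1 : ℝ) ^ (2 * k) * (1 / 2) ^ m) := by
  have hp0 : (0 : ℝ) < p := by exact_mod_cast hp.pos
  have hp2 : (2 : ℝ) ≤ p := by exact_mod_cast hp.two_le
  have h1 : (divisorFun k (p ^ (m + r)) : ℝ) ≤ (m + r + 1 : ℝ) ^ k := by
    exact_mod_cast divisorFun_prime_pow_le k hp (m + r)
  calc divisorTerm k (p ^ (m + r))
      = (1 / p : ℝ) ^ r * ((divisorFun k (p ^ (m + r)) : ℝ) ^ 2 * (1 / p : ℝ) ^ m) := by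
        rw [divisorTerm, Nat.cast_pow, one_div_pow, one_div_pow, pow_add (p : ℝ)]; field_simp
    _ ≤ (1 / p : ℝ) ^ r * (((m + r + 1 : ℝ) ^ k) ^ 2 * (1 / 2) ^ m) := by gcongr
    _ = _ := by rw [← pow_mul, mul_comm k 2]

theorem summable_add_pow_mul_half_pow (r l : ℕ) :
    Summable fun m : ℕ => (m + r + 1 : ℝ) ^ l * (1 / 2) ^ m := by
  have h := (summable_nat_add_iff (f := fun n : ℕ => (n : ℝ) ^ l * (1 / 2 : ℝ) ^ n) (r + 1)).mpr
    (summable_pow_mul_geometric_of_norm_lt_one l (by norm_num))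
  refine (h.mul_left (2 ^ (r + 1))).congr fun m => ?_
  push_cast
  rw [pow_add (1 / 2 : ℝ) m, mul_left_comm, mul_left_comm _ ((1 / 2 : ℝ) ^ m), ← mul_pow]
  norm_num [add_assoc]

theorem summable_divisorTerm_prime_pow (k : ℕ) {p : ℕ} (hp : p.Prime) :
    Summable fun m => divisorTerm k (p ^ m) := by
  refine Summable.of_nonneg_of_le (fun _ => divisorTerm_nonneg _ _) (fun m => ?_)
    (summable_add_pow_mul_half_pow 0 (2 * k))
  simpa using divisorTerm_prime_pow_add_le k hp 0 m

theorem localSum_eq_tsum (k p : ℕ) : localSum k p = ∑' m : ℕ, divisorTerm k (p ^ m) := by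
  simp [localSum, divisorTerm]

theorem one_le_localSum (k : ℕ) {p : ℕ} (hp : p.Prime) : 1 ≤ localSum k p := by
  rw [localSum_eq_tsum]
  refine le_trans ?_ ((summable_divisorTerm_prime_pow k hp).le_tsum 0
    fun _ _ => divisorTerm_nonneg _ _)
  simp [divisorTerm, divisorFun_one]

theorem exists_localSum_le (k : ℕ) : ∃ K : ℝ, 1 ≤ K ∧ ∀ p : ℕ, p.Prime → localSum k p ≤ K := by
  have h : ∀ p : ℕ, p.Prime →
      localSum k p ≤ ∑' m : ℕ, ((m : ℝ) + (0 : ℕ) + 1) ^ (2 * k) * (1 / 2) ^ m := fun p hp => by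
    rw [localSum_eq_tsum]
    refine (summable_divisorTerm_prime_pow k hp).tsum_le_tsum (fun m => ?_)
      (summable_add_pow_mul_half_pow 0 (2 * k))
    simpa using divisorTerm_prime_pow_add_le k hp 0 m
  exact ⟨_, (one_le_localSum k Nat.prime_two).trans (h 2 Nat.prime_two), h⟩

theorem hasSum_divisorTerm_factoredNumbers (k : ℕ) {S : Finset ℕ} (hS : ∀ p ∈ S, p.Prime) :
    HasSum (fun n : Nat.factoredNumbers S => divisorTerm k n) (∏ p ∈ S, localSum k p) := by
  have h := (EulerProduct.summable_and_hasSum_factoredNumbers_prod_filter_prime_tsum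
    (f := divisorTerm k) (by simp [divisorTerm, divisorFun_one]) (fun {m n} hmn => by
      rw [divisorTerm, divisorTerm, divisorTerm, divisorFun_mul_of_coprime k hmn]
      push_cast
      rw [mul_pow, mul_div_mul_comm]) (fun {p} hp => by
        simpa only [Real.norm_of_nonneg (divisorTerm_nonneg _ _)] using
          summable_divisorTerm_prime_pow k hp) S).2
  rw [Finset.filter_true_of_mem hS] at h
  simpa only [localSum_eq_tsum] using h

end DivisorFunction

/-! ### Convergence and positivity of the Euler product `a(k)`. -/

section EulerFactor

/-- The factor of `arithFactor` at `p`. -/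
noncomputable def eulerFactor (k p : ℕ) : ℝ := (1 - 1 / (p : ℝ)) ^ (k ^ 2) * localSum k p

theorem eulerFactor_pos (k : ℕ) {p : ℕ} (hp : p.Prime) : 0 < eulerFactor k p := by
  have h2 : (1 : ℝ) < p := by exact_mod_cast hp.one_lt
  have : 1 / (p : ℝ) < 1 := by rw [div_lt_one (by linarith)]; exact h2
  exact mul_pos (pow_pos (by linarith) _) (zero_lt_one.trans_le (one_le_localSum k hp))

/-- Since `d_k(p)² = k²`, the local sum is `1 + k²/p + O(p^{-2})`, and the first order term cancels
against `(1 - 1/p)^{k²}`. Bernoulli's inequality makes both sides of this explicit. -/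
theorem exists_abs_eulerFactor_sub_one_le (k : ℕ) :
    ∃ K : ℝ, ∀ p : ℕ, p.Prime → |eulerFactor k p - 1| ≤ K * (1 / (p : ℝ) ^ 2) := by
  set K : ℝ := ∑' m : ℕ, ((m : ℝ) + (2 : ℕ) + 1) ^ (2 * k) * (1 / 2) ^ m with hK
  have hK0 : 0 ≤ K := tsum_nonneg fun m => by positivity
  refine ⟨K + ((k ^ 2 : ℕ) : ℝ) ^ 2, fun p hp => ?_⟩
  have hp2 : (2 : ℝ) ≤ p := by exact_mod_cast hp.two_le
  set y : ℝ := 1 / p with hy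
  have hy0 : 0 ≤ y := by positivity
  have hy1 : y ≤ 1 := by rw [hy, div_le_one (by linarith)]; linarith
  have hsum := summable_divisorTerm_prime_pow k hp
  set ε : ℝ := ∑' m : ℕ, divisorTerm k (p ^ (m + 2)) with hε
  have hε0 : 0 ≤ ε := tsum_nonneg fun m => divisorTerm_nonneg _ _
  have hεle : ε ≤ y ^ 2 * K := by
    rw [hK, ← tsum_mul_left]
    refine ((summable_nat_add_iff 2).mpr hsum).tsum_le_tsum (fun m => ?_)
      ((summable_add_pow_mul_half_pow 2 (2 * k)).mul_left _)
    exact_mod_cast divisorTerm_prime_pow_add_le k hp 2 m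
  have hloc : localSum k p = 1 + ((k ^ 2 : ℕ) : ℝ) * y + ε := by
    rw [localSum_eq_tsum, ← hsum.sum_add_tsum_nat_add 2, Finset.sum_range_succ,
      Finset.sum_range_one, pow_zero, pow_one, divisorTerm, divisorTerm, divisorFun_one,
      divisorFun_prime k hp]
    rw [hy]; push_cast; ring
  set N : ℕ := k ^ 2
  have hpow0 : 0 ≤ (1 - y) ^ N := pow_nonneg (by linarith) _
  have hpow1 : (1 - y) ^ N ≤ 1 := pow_le_one₀ (by linarith) (by linarith)
  have hlow : 1 - (N : ℝ) * y ≤ (1 - y) ^ N := by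
    have := one_add_mul_le_pow (a := -y) (by linarith) N
    simpa [sub_eq_add_neg] using this
  have hbern : 1 + (N : ℝ) * y ≤ (1 + y) ^ N := one_add_mul_le_pow (by linarith) N
  have hup : (1 - y) ^ N * (1 + N * y) ≤ 1 := by
    calc (1 - y) ^ N * (1 + N * y) ≤ (1 - y) ^ N * (1 + y) ^ N := by gcongr
      _ = (1 - y ^ 2) ^ N := by rw [← mul_pow]; ring_nf
      _ ≤ 1 := pow_le_one₀ (by nlinarith) (by nlinarith)
  have hN : (0 : ℝ) ≤ N := Nat.cast_nonneg _
  have hlow' : 1 - (N : ℝ) ^ 2 * y ^ 2 ≤ (1 - y) ^ N * (1 + N * y) := by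
    have : (1 - (N : ℝ) * y) * (1 + N * y) ≤ (1 - y) ^ N * (1 + N * y) :=
      mul_le_mul_of_nonneg_right hlow (by positivity)
    nlinarith
  have hye : 1 / (p : ℝ) ^ 2 = y ^ 2 := by rw [hy]; ring
  have h1 : (1 - y) ^ N * ε ≤ y ^ 2 * K :=
    (mul_le_of_le_one_left hε0 hpow1).trans hεle
  have h2 : 0 ≤ (1 - y) ^ N * ε := mul_nonneg hpow0 hε0
  have h3 : 0 ≤ y ^ 2 * K := by positivity
  have h4 : 0 ≤ (N : ℝ) ^ 2 * y ^ 2 := by positivity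
  rw [eulerFactor, hloc, hye, abs_le]
  constructor <;> nlinarith

theorem summable_one_div_prime_sq : Summable fun p : Nat.Primes => 1 / ((p : ℕ) : ℝ) ^ 2 :=
  (Real.summable_one_div_nat_pow.mpr one_lt_two).comp_injective Subtype.val_injective

theorem summable_eulerFactor_sub_one (k : ℕ) :
    Summable fun p : Nat.Primes => eulerFactor k p - 1 := by
  obtain ⟨K, hK⟩ := exists_abs_eulerFactor_sub_one_le k
  exact Summable.of_norm_bounded (summable_one_div_prime_sq.mul_left K) fun p => hK p p.2

theorem summable_log_eulerFactor (k : ℕ) :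
    Summable fun p : Nat.Primes => Real.log (eulerFactor k p) := by
  simpa using Real.summable_log_one_add_of_summable (summable_eulerFactor_sub_one k)

theorem arithFactor_pos (k : ℕ) : 0 < arithFactor k := by
  have h := Real.rexp_tsum_eq_tprod (f := fun p : Nat.Primes => eulerFactor k p)
    (fun p => eulerFactor_pos k p.2) (summable_log_eulerFactor k)
  have : arithFactor k = ∏' p : Nat.Primes, eulerFactor k p := rfl
  rw [this, ← h]
  exact Real.exp_pos _

theorem hasProd_eulerFactor (k : ℕ) :
    HasProd (fun p : Nat.Primes => eulerFactor k p) (arithFactor k) :=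
  (Real.multipliable_of_summable_log (fun p => eulerFactor_pos k p.2)
    (summable_log_eulerFactor k)).hasProd

/-- One set `P` serves two purposes: the Euler product over any larger finite set is already
accurate, and the primes outside `P`, from which coincidences of matrices come, have a small sum of
`p^{-2}`. -/
theorem exists_primes_eulerFactor_close (k : ℕ) {ε : ℝ} (hε : 0 < ε) :
    ∃ P : Finset ℕ, (∀ p ∈ P, p.Prime) ∧
      (∀ Q : Finset ℕ, (∀ p ∈ Q, p.Prime) → P ⊆ Q →
        |∏ p ∈ Q, eulerFactor k p - arithFactor k| ≤ ε) ∧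
      ∀ R : Finset ℕ, (∀ p ∈ R, p.Prime) → Disjoint R P → ∑ p ∈ R, 1 / (p : ℝ) ^ 2 ≤ ε := by
  obtain ⟨P₁, hP₁⟩ := eventually_atTop.mp
    ((hasProd_eulerFactor k).eventually (Metric.closedBall_mem_nhds _ hε))
  obtain ⟨P₂, hP₂⟩ := summable_iff_vanishing.mp summable_one_div_prime_sq _
    (Metric.closedBall_mem_nhds (0 : ℝ) hε)
  let e : Nat.Primes ↪ ℕ := ⟨fun p => p, Nat.Primes.coe_nat_injective⟩
  have hlift : ∀ Q : Finset ℕ, (∀ p ∈ Q, p.Prime) →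
      ∃ Q' : Finset Nat.Primes, Q = Q'.map e := fun Q hQ => by
    refine ⟨Q.preimage e e.injective.injOn, Finset.ext fun p => ?_⟩
    simp only [Finset.mem_map, Finset.mem_preimage]
    exact ⟨fun hp => ⟨⟨p, hQ p hp⟩, hp, rfl⟩, by rintro ⟨_, h, rfl⟩; exact h⟩
  refine ⟨(P₁ ∪ P₂).map e, ?_, ?_, ?_⟩
  · intro p hp
    obtain ⟨p', -, rfl⟩ := Finset.mem_map.mp hp
    exact p'.2
  · intro Q hQ hPQ
    obtain ⟨Q', rfl⟩ := hlift Q hQ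
    have := hP₁ Q' (Finset.union_subset_left (Finset.map_subset_map.mp hPQ))
    rw [Finset.prod_map]
    exact Metric.mem_closedBall.mp this
  · intro R hR hRP
    obtain ⟨R', rfl⟩ := hlift R hR
    have := hP₂ R' (Finset.disjoint_of_subset_right Finset.subset_union_right
      ((Finset.disjoint_map _).mp hRP))
    rw [Finset.sum_map]
    exact (le_abs_self _).trans (mem_closedBall_zero_iff.mp this)

end EulerFactor

/-! ### Divisibility conditions on the entries, absorbed into row and column weights. -/

section Scaling

variable {k X : ℕ} {n m : Fin k → ℕ} {a D : Fin k → Fin k → ℕ}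

/-- The row products of a matrix. -/
def rowProd (a : Fin k → Fin k → ℕ) (i : Fin k) : ℕ := ∏ j, a i j

/-- The column products of a matrix. -/
def colProd (a : Fin k → Fin k → ℕ) (j : Fin k) : ℕ := ∏ i, a i j

theorem rowProd_mul (a D : Fin k → Fin k → ℕ) : rowProd (a * D) = rowProd a * rowProd D := by
  funext i; simp [rowProd, Finset.prod_mul_distrib]

theorem colProd_mul (a D : Fin k → Fin k → ℕ) : colProd (a * D) = colProd a * colProd D := by
  funext i; simp [colProd, Finset.prod_mul_distrib]

theorem prod_rowProd (a : Fin k → Fin k → ℕ) : ∏ i, rowProd a i = ∏ j, colProd a j :=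
  Finset.prod_comm

theorem one_le_rowProd (hD : ∀ i j, 1 ≤ D i j) (i : Fin k) : 1 ≤ rowProd D i :=
  Nat.succ_le_of_lt (Finset.prod_pos fun j _ => hD i j)

theorem one_le_colProd (hD : ∀ i j, 1 ≤ D i j) (j : Fin k) : 1 ≤ colProd D j :=
  Nat.succ_le_of_lt (Finset.prod_pos fun i _ => hD i j)

theorem mem_matSet_iff (hn : ∀ i, 1 ≤ n i) :
    a ∈ matSet k X n m ↔ (∀ i j, 1 ≤ a i j) ∧ (∀ i, n i * rowProd a i ≤ X) ∧
      ∀ j, m j * colProd a j ≤ X := by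
  rw [mem_matSet]
  refine ⟨fun h => ⟨fun i j => (Finset.mem_Icc.mp (h.1 i j)).1, h.2⟩, fun h => ⟨fun i j => ?_, h.2⟩⟩
  refine Finset.mem_Icc.mpr ⟨h.1 i j, le_trans ?_ (h.2.1 i)⟩
  refine (Nat.le_of_dvd (one_le_rowProd h.1 i) (Finset.dvd_prod_of_mem _ (Finset.mem_univ j))).trans
    (Nat.le_mul_of_pos_left _ (hn i))

/-- An entrywise factor `D` is traded for weights. This is why `matSet` carries weights, and why
those that arise have equal products. -/
theorem mul_mem_matSet_iff (hn : ∀ i, 1 ≤ n i) (hD : ∀ i j, 1 ≤ D i j) :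
    D * a ∈ matSet k X n m ↔ a ∈ matSet k X (n * rowProd D) (m * colProd D) := by
  rw [mem_matSet_iff hn, mem_matSet_iff (n := n * rowProd D) fun i => Nat.mul_pos (hn i) (one_le_rowProd hD i),
    rowProd_mul, colProd_mul]
  simp only [Pi.mul_apply, mul_assoc]
  refine and_congr_left' (forall_congr' fun i => forall_congr' fun j => ?_)
  exact ⟨fun h => Nat.pos_of_mul_pos_left h, fun h => Nat.mul_pos (hD i j) h⟩

/-- The matrix with entry `p` at `e` and `1` elsewhere. -/
def bump (p : ℕ) (e : Fin k × Fin k) (i j : Fin k) : ℕ := if (i, j) = e then p else 1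

theorem one_le_bump {p : ℕ} (hp : 1 ≤ p) (e : Fin k × Fin k) (i j : Fin k) : 1 ≤ bump p e i j := by
  unfold bump; split_ifs <;> omega

theorem prod_rowProd_bump (p : ℕ) (e : Fin k × Fin k) : ∏ i, rowProd (bump p e) i = p := by
  simp only [rowProd, bump]
  rw [← Fintype.prod_prod_type' (f := fun i j => if (i, j) = e then p else 1)]
  simp

/-- The matrices in `matSet` whose entry at `e.2` is not divisible by `e.1`, for all `e ∈ E`. -/
def sievedSet (E : Finset (ℕ × Fin k × Fin k)) (X : ℕ) (n m : Fin k → ℕ) :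
    Finset (Fin k → Fin k → ℕ) :=
  (matSet k X n m).filter fun a => ∀ e ∈ E, ¬ e.1 ∣ a e.2.1 e.2.2

/-- One step of inclusion-exclusion. A matrix with `p` dividing the entry at `e` is `bump p e * a`,
and the other conditions pass to `a`: at `e` they concern primes different from `p`, elsewhere the
factor is `1`. -/
theorem card_sievedSet_insert {E : Finset (ℕ × Fin k × Fin k)} (hE : ∀ e ∈ E, e.1.Prime) {p : ℕ}
    (hp : p.Prime) {e : Fin k × Fin k} (he : (p, e) ∉ E) (hn : ∀ i, 1 ≤ n i) :
    (sievedSet (insert (p, e) E) X n m).card +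
      (sievedSet E X (n * rowProd (bump p e)) (m * colProd (bump p e))).card =
      (sievedSet E X n m).card := by
  have hb := one_le_bump (k := k) hp.one_le e
  rw [← Finset.card_filter_add_card_filter_not (s := sievedSet E X n m)
    (fun a => ¬ p ∣ a e.1 e.2)]
  congr 1
  · congr 1
    ext a
    simp only [sievedSet, Finset.mem_filter, Finset.forall_mem_insert, and_assoc]
    tauto
  · refine Finset.card_nbij' (fun a => bump p e * a) (fun b i j => b i j / bump p e i j) ?_ ?_ ?_ ?_
    · intro a ha
      simp only [sievedSet, Finset.coe_filter, Finset.mem_filter, Set.mem_ofPred_eq] at ha ⊢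
      refine ⟨⟨(mul_mem_matSet_iff hn hb).mpr ha.1, fun f hf => ?_⟩, ?_⟩
      · simp only [Pi.mul_apply]
        intro hdvd
        rcases (hE f hf).dvd_mul.mp hdvd with h | h
        · unfold bump at h
          split_ifs at h with hfe
          · have h1 : f.1 = p := (Nat.prime_dvd_prime_iff_eq (hE f hf) hp).mp h
            have h2 : f = (p, e) := Prod.ext h1 hfe
            exact he (h2 ▸ hf)
          · exact (hE f hf).one_lt.ne' (Nat.dvd_one.mp h)
        · exact ha.2 f hf h
      · simp [bump]
    · intro b hbm
      simp only [sievedSet, Finset.coe_filter, Finset.mem_filter, Set.mem_ofPred_eq, not_not]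
        at hbm ⊢
      have hdvd : ∀ i j, bump p e i j ∣ b i j := fun i j => by
        unfold bump
        split_ifs with h
        · rw [← h] at hbm; exact hbm.2
        · exact one_dvd _
      have heq : bump p e * (fun i j => b i j / bump p e i j) = b := by
        funext i j; exact Nat.mul_div_cancel' (hdvd i j)
      refine ⟨(mul_mem_matSet_iff hn hb).mp (by rw [heq]; exact hbm.1.1), fun f hf h => hbm.1.2 f hf ?_⟩
      exact h.trans (Nat.div_dvd_of_dvd (hdvd _ _))
    · intro a _
      funext i j
      exact Nat.mul_div_cancel_left _ (hb i j)
    · intro b hbm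
      simp only [Finset.coe_filter, Set.mem_ofPred_eq, not_not] at hbm
      funext i j
      refine Nat.mul_div_cancel' ?_
      unfold bump
      split_ifs with h
      · rw [← h] at hbm; exact hbm.2
      · exact one_dvd _

end Scaling

/-! ### Matrix counts uniform in the weights, and their sieved versions. -/

section Uniform

variable {d : ℕ}

/-- The order of magnitude `X^{d+1} (log X)^{d²}` of the counting functions. -/
noncomputable def matScale (d X : ℕ) : ℝ := (X : ℝ) ^ (d + 1) * Real.log X ^ (d ^ 2)

theorem matScale_pos {X : ℕ} (hX : 2 ≤ X) : 0 < matScale d X := by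
  have h : (1 : ℝ) < X := by exact_mod_cast hX
  exact mul_pos (by positivity) (pow_pos (Real.log_pos h) _)

/-- The limiting density of `matSet`. -/
noncomputable def matConst (d : ℕ) : ℝ := d.centralBinom * birkhoffVol d

theorem matConst_pos (d : ℕ) : 0 < matConst d :=
  mul_pos (by exact_mod_cast d.centralBinom_pos) (birkhoffVol_pos d)

theorem card_matSet_div {X : ℕ} {n m : Fin (d + 1) → ℕ} (hn : ∀ i, 1 ≤ n i) :
    ((matSet (d + 1) X n m).card : ℝ) / matScale d X = matDensity d X n m / ∏ i, (n i : ℝ) := by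
  have : (∏ i, (n i : ℝ)) ≠ 0 := Finset.prod_ne_zero_iff.mpr fun i _ => by
    have := hn i; positivity
  rw [matDensity, matScale]
  field_simp

theorem exists_card_matSet_le (d : ℕ) : ∃ C : ℝ, 0 ≤ C ∧ ∀ X : ℕ, 2 ≤ X →
    ∀ n m : Fin (d + 1) → ℕ, (∀ i, 1 ≤ n i) → (∀ j, 1 ≤ m j) → ∏ i, n i = ∏ j, m j →
      ((matSet (d + 1) X n m).card : ℝ) / matScale d X ≤ C / ∏ i, (n i : ℝ) := by
  refine ⟨max 0 (∫ t, outerBound d t ∂(orthant (Fin d × Fin d))), le_max_left _ _, ?_⟩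
  intro X hX n m hn hm hnm
  rw [card_matSet_div hn]
  gcongr
  exact (matDensity_le hX hn hm hnm).trans (le_max_right _ _)

theorem exists_card_matSet_close (d : ℕ) {ε : ℝ} (hε : 0 < ε) : ∃ X₀ : ℕ, ∀ X ≥ X₀,
    ∀ n m : Fin (d + 1) → ℕ, (∀ i, 1 ≤ n i) → (∀ j, 1 ≤ m j) → ∏ i, n i = ∏ j, m j →
      |((matSet (d + 1) X n m).card : ℝ) / matScale d X - matConst d / ∏ i, (n i : ℝ)| ≤ ε := by
  obtain ⟨C, hC0, hC⟩ := exists_card_matSet_le d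
  have hc := matConst_pos d
  obtain ⟨M, hM⟩ := exists_nat_gt ((C + matConst d) / ε)
  let box : Finset (Fin (d + 1) → ℕ) := Fintype.piFinset fun _ => Finset.Icc 1 M
  have hfin : ∀ᶠ X : ℕ in atTop, ∀ nm ∈ box ×ˢ box, ∏ i, nm.1 i = ∏ j, nm.2 j →
      |matDensity d X nm.1 nm.2 - matConst d| ≤ ε := by
    rw [Filter.eventually_all_finset]
    intro nm hnm
    by_cases heq : ∏ i, nm.1 i = ∏ j, nm.2 j
    · simp only [box, Finset.mem_product, Fintype.mem_piFinset, Finset.mem_Icc] at hnm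
      have h := tendsto_matDensity (fun i => (hnm.1 i).1) (fun j => (hnm.2 j).1) heq
      filter_upwards [h.eventually (Metric.closedBall_mem_nhds _ hε)] with X hX _
      exact Metric.mem_closedBall.mp hX
    · exact Eventually.of_forall fun X h => absurd h heq
  obtain ⟨X₀, hX₀⟩ := eventually_atTop.mp hfin
  refine ⟨max X₀ 2, fun X hX n m hn hm hnm => ?_⟩
  have hprod : (1 : ℝ) ≤ ∏ i, (n i : ℝ) := by
    exact_mod_cast (Finset.prod_pos fun i _ => hn i : 0 < ∏ i, n i)
  have hX2 : 2 ≤ X := (le_max_right _ _).trans hX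
  -- For a large product, the uniform upper bound makes both terms at most `ε`; below `M` only
  -- finitely many weights occur, and the limit for each of them suffices.
  by_cases hbig : M < ∏ i, n i
  · have hbig' : (C + matConst d) / ε < ∏ i, (n i : ℝ) :=
      hM.trans (by exact_mod_cast hbig)
    rw [div_lt_iff₀ hε] at hbig'
    have h1 := hC X hX2 n m hn hm hnm
    have h0 : 0 ≤ ((matSet (d + 1) X n m).card : ℝ) / matScale d X :=
      div_nonneg (Nat.cast_nonneg _) (matScale_pos hX2).le
    have h2 : C / ∏ i, (n i : ℝ) ≤ ε := by
      rw [div_le_iff₀ (by linarith)]; nlinarith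
    have h3 : matConst d / ∏ i, (n i : ℝ) ≤ ε := by
      rw [div_le_iff₀ (by linarith)]; nlinarith
    have h4 : 0 ≤ matConst d / ∏ i, (n i : ℝ) := by positivity
    rw [abs_le]
    constructor <;> linarith
  · have hle : ∀ f : Fin (d + 1) → ℕ, (∀ i, 1 ≤ f i) → ∏ i, f i ≤ M → f ∈ box := by
      intro f hf hfM
      refine Fintype.mem_piFinset.mpr fun i => Finset.mem_Icc.mpr ⟨hf i, le_trans ?_ hfM⟩
      exact Nat.le_of_dvd (Finset.prod_pos fun i _ => hf i)
        (Finset.dvd_prod_of_mem _ (Finset.mem_univ i))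
    push Not at hbig
    have h := hX₀ X ((le_max_left _ _).trans hX) (n, m)
      (Finset.mem_product.mpr ⟨hle n hn hbig, hle m hm (hnm ▸ hbig)⟩) hnm
    rw [card_matSet_div hn, ← sub_div, abs_div, abs_of_pos (by linarith : 0 < ∏ i, (n i : ℝ))]
    exact (div_le_self (abs_nonneg _) hprod).trans h

/-- A new condition subtracts the same count with `∏ n` multiplied by `p`: the density gains the
factor `1 - 1/p`, and the error at most doubles. -/
theorem abs_card_sievedSet_sub_le {X : ℕ} {ε : ℝ} (hX : ∀ n m : Fin (d + 1) → ℕ, (∀ i, 1 ≤ n i) →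
      (∀ j, 1 ≤ m j) → ∏ i, n i = ∏ j, m j →
      |((matSet (d + 1) X n m).card : ℝ) / matScale d X - matConst d / ∏ i, (n i : ℝ)| ≤ ε)
    (E : Finset (ℕ × Fin (d + 1) × Fin (d + 1))) (hE : ∀ e ∈ E, e.1.Prime)
    {n m : Fin (d + 1) → ℕ} (hn : ∀ i, 1 ≤ n i) (hm : ∀ j, 1 ≤ m j)
    (hnm : ∏ i, n i = ∏ j, m j) :
    |((sievedSet E X n m).card : ℝ) / matScale d X -
      matConst d * (∏ e ∈ E, (1 - 1 / (e.1 : ℝ))) / ∏ i, (n i : ℝ)| ≤ 2 ^ E.card * ε := by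
  induction E using Finset.induction_on generalizing n m with
  | empty => simpa [sievedSet] using hX n m hn hm hnm
  | insert e E he ih =>
    obtain ⟨p, e⟩ := e
    have hE' : ∀ e ∈ E, e.1.Prime := fun f hf => hE f (Finset.mem_insert_of_mem hf)
    have hp : p.Prime := hE _ (Finset.mem_insert_self _ _)
    have hb := one_le_bump (k := d + 1) hp.one_le e
    have h1 := ih hE' hn hm hnm
    have h2 := ih hE' (n := n * rowProd (bump p e)) (m := m * colProd (bump p e))
      (fun i => Nat.mul_pos (hn i) (one_le_rowProd hb i))
      (fun i => Nat.mul_pos (hm i) (one_le_colProd hb i)) (by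
        simp only [Pi.mul_apply, Finset.prod_mul_distrib]
        rw [hnm, prod_rowProd])
    have hcard := card_sievedSet_insert (X := X) (m := m) hE' hp he hn
    have hprod : ∏ i, (((n * rowProd (bump p e)) i : ℕ) : ℝ) = (∏ i, (n i : ℝ)) * p := by
      rw [← Nat.cast_prod]
      simp only [Pi.mul_apply, Finset.prod_mul_distrib, prod_rowProd_bump]
      push_cast; rfl
    rw [hprod] at h2
    have hcard' : ((sievedSet (insert (p, e) E) X n m).card : ℝ) = (sievedSet E X n m).card -
        (sievedSet E X (n * rowProd (bump p e)) (m * colProd (bump p e))).card := by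
      rw [← hcard]; push_cast; ring
    have hp0 : (p : ℝ) ≠ 0 := by exact_mod_cast hp.ne_zero
    have hn0 : (∏ i, (n i : ℝ)) ≠ 0 := Finset.prod_ne_zero_iff.mpr fun i _ => by
      have := hn i; positivity
    rw [hcard', Finset.prod_insert he, Finset.card_insert_of_notMem he]
    refine le_trans (le_of_eq ?_) ((abs_sub _ _).trans ((add_le_add h1 h2).trans
      (le_of_eq (by ring))))
    congr 1
    field_simp
    ring

end Uniform

/-! ### Common refinements of two factorizations. -/

section Refinement

theorem exists_prod_eq_of_dvd_prod {l : ℕ} (m : Fin l → ℕ) {N : ℕ} (h : N ∣ ∏ j, m j) :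
    ∃ u : Fin l → ℕ, (∀ j, u j ∣ m j) ∧ ∏ j, u j = N := by
  induction l generalizing N with
  | zero => exact ⟨m, fun j => j.elim0, by simpa using (Nat.dvd_one.mp (by simpa using h)).symm⟩
  | succ l ih =>
    rw [Fin.prod_univ_succ] at h
    obtain ⟨a₁, a₂, h₁, h₂, rfl⟩ := exists_dvd_and_dvd_of_dvd_mul h
    obtain ⟨u, hu, rfl⟩ := ih (fun j => m j.succ) h₂
    refine ⟨Fin.cons a₁ u, fun j => ?_, by simp [Fin.prod_univ_succ]⟩
    refine Fin.cases ?_ (fun j => ?_) j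
    · simpa using h₁
    · simpa using hu j

/-- Induction on the rows: `n 0` divides `∏ m`, so it is a product of divisors `u j` of the `m j`;
these form a row, and the quotients `m j / u j` remain. -/
theorem exists_refinement {k l : ℕ} (n : Fin k → ℕ) (m : Fin l → ℕ) (hn : ∀ i, 1 ≤ n i)
    (h : ∏ i, n i = ∏ j, m j) :
    ∃ a : Fin k → Fin l → ℕ, (∀ i, ∏ j, a i j = n i) ∧ ∀ j, ∏ i, a i j = m j := by
  induction k generalizing m with
  | zero =>
    refine ⟨fun i => i.elim0, fun i => i.elim0, fun j => ?_⟩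
    have : m j ∣ 1 := by
      have h' := Finset.dvd_prod_of_mem m (Finset.mem_univ j)
      rw [← h] at h'
      simpa using h'
    simpa using (Nat.dvd_one.mp this).symm
  | succ k ih =>
    rw [Fin.prod_univ_succ] at h
    obtain ⟨u, hu, hu0⟩ := exists_prod_eq_of_dvd_prod m (h ▸ Dvd.intro _ rfl : n 0 ∣ ∏ j, m j)
    choose v hv using hu
    obtain ⟨a, ha, ha'⟩ := ih (fun i => n i.succ) v (fun i => hn _) (by
      have : n 0 * ∏ i : Fin k, n i.succ = n 0 * ∏ j, v j := by
        rw [h, Finset.prod_congr rfl fun j _ => hv j, Finset.prod_mul_distrib, hu0]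
      exact Nat.eq_of_mul_eq_mul_left (hn 0) this)
    refine ⟨Fin.cons u a, fun i => ?_, fun j => ?_⟩
    · refine Fin.cases ?_ (fun i => ?_) i
      · simpa using hu0
      · simpa using ha i
    · rw [Fin.prod_univ_succ, hv j]
      simp [ha' j]

end Refinement

/-! ### Smooth and rough parts; recovering a matrix from its margins. -/

section Smooth

variable {S Q : Finset ℕ}

theorem coprime_of_mem_factoredNumbers {s r : ℕ} (hs : s ∈ Nat.factoredNumbers S)
    (hr : ∀ p ∈ S, ¬ p ∣ r) : s.Coprime r :=
  Nat.coprime_of_dvd fun p hp hps hpr => hr p (Nat.mem_factoredNumbers'.mp hs p hp hps) hpr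

theorem exists_smooth_mul_rough (hS : ∀ p ∈ S, p.Prime) (n : ℕ) (hn : n ≠ 0) :
    ∃ s r, s * r = n ∧ s ∈ Nat.factoredNumbers S ∧ ∀ p ∈ S, ¬ p ∣ r := by
  have hone : ∀ p ∈ S, ¬ p ∣ 1 := fun p hp h => (hS p hp).one_lt.ne' (Nat.dvd_one.mp h)
  have hone' : 1 ∈ Nat.factoredNumbers S := Nat.mem_factoredNumbers'.mpr fun p hp h =>
    absurd (Nat.dvd_one.mp h) hp.one_lt.ne'
  induction n using Nat.recOnMul with
  | zero => exact absurd rfl hn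
  | one => exact ⟨1, 1, rfl, hone', hone⟩
  | prime p hp =>
    by_cases h : p ∈ S
    · refine ⟨p, 1, mul_one _, Nat.mem_factoredNumbers'.mpr fun l hl hlp => ?_, hone⟩
      exact (Nat.prime_dvd_prime_iff_eq hl hp).mp hlp ▸ h
    · refine ⟨1, p, one_mul _, hone', fun l hl hlp => h ?_⟩
      exact (Nat.prime_dvd_prime_iff_eq (hS l hl) hp).mp hlp ▸ hl
  | mul a b iha ihb =>
    obtain ⟨s, r, h1, h2, h3⟩ := iha (left_ne_zero_of_mul hn)
    obtain ⟨s', r', h1', h2', h3'⟩ := ihb (right_ne_zero_of_mul hn)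
    refine ⟨s * s', r * r', by rw [← h1, ← h1']; ring, Nat.mul_mem_factoredNumbers h2 h2', ?_⟩
    intro p hp h
    rcases (hS p hp).dvd_mul.mp h with h | h
    · exact h3 p hp h
    · exact h3' p hp h

theorem prod_mem_factoredNumbers_of_forall {k : ℕ} {s : Fin k → ℕ}
    (hs : ∀ i, s i ∈ Nat.factoredNumbers S) : ∏ i, s i ∈ Nat.factoredNumbers S := by
  rw [Nat.mem_factoredNumbers']
  intro p hp h
  obtain ⟨i, -, hi⟩ := (hp.prime.dvd_finsetProd_iff _).mp h
  exact Nat.mem_factoredNumbers'.mp (hs i) p hp hi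

theorem prod_rough {k : ℕ} {r : Fin k → ℕ} (hS : ∀ p ∈ S, p.Prime)
    (hr : ∀ i, ∀ p ∈ S, ¬ p ∣ r i) : ∀ p ∈ S, ¬ p ∣ ∏ i, r i := fun p hp h => by
  obtain ⟨i, -, hi⟩ := ((hS p hp).prime.dvd_finsetProd_iff _).mp h
  exact hr i p hp hi

/-- The row and the column through `(i, j)` share the factor `a i j`, and the remaining entries of
one are coprime to those of the other. -/
theorem entry_eq_gcd {k : ℕ} {a : Fin k → Fin k → ℕ}
    (ha : ∀ e f : Fin k × Fin k, e ≠ f → (a e.1 e.2).Coprime (a f.1 f.2)) (i j : Fin k) :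
    a i j = (rowProd a i).gcd (colProd a j) := by
  rw [rowProd, colProd, ← Finset.mul_prod_erase _ _ (Finset.mem_univ j),
    ← Finset.mul_prod_erase (a := i) _ (fun i => a i j) (Finset.mem_univ i), Nat.gcd_mul_left]
  refine (mul_right_eq_self₀.mpr (Or.inl ?_)).symm
  refine Nat.Coprime.prod_left fun j' hj' => Nat.Coprime.prod_right fun i' hi' => ?_
  exact ha (i, j') (i', j) fun h => Finset.ne_of_mem_erase hj' (Prod.ext_iff.mp h).2

end Smooth

/-! ### Comparison of solutions with pairs of smooth tuples and rough matrices. -/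

section Counting

variable {k X : ℕ} {R S : Finset ℕ}

/-- The pairs of `k`-tuples in `[1, X]` with equal products, whose entries are not divisible by
any `p ∈ R`. -/
def solSet (k X : ℕ) (R : Finset ℕ) : Finset ((Fin k → ℕ) × (Fin k → ℕ)) :=
  ((Fintype.piFinset fun _ => Finset.Icc 1 X) ×ˢ Fintype.piFinset fun _ => Finset.Icc 1 X).filter
    fun nm => ∏ i, nm.1 i = ∏ j, nm.2 j ∧ (∀ i, ∀ p ∈ R, ¬ p ∣ nm.1 i) ∧
      ∀ j, ∀ p ∈ R, ¬ p ∣ nm.2 j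

open scoped Classical in
/-- The pairs of `k`-tuples of `S`-factored numbers in `[1, X]` with equal products. -/
noncomputable def smoothPairs (k X : ℕ) (S : Finset ℕ) : Finset ((Fin k → ℕ) × (Fin k → ℕ)) :=
  ((Fintype.piFinset fun _ => Finset.Icc 1 X) ×ˢ Fintype.piFinset fun _ => Finset.Icc 1 X).filter
    fun nm => ∏ i, nm.1 i = ∏ j, nm.2 j ∧ (∀ i, nm.1 i ∈ Nat.factoredNumbers S) ∧
      ∀ j, nm.2 j ∈ Nat.factoredNumbers S

theorem mem_solSet {nm : (Fin k → ℕ) × (Fin k → ℕ)} :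
    nm ∈ solSet k X R ↔ ((∀ i, 1 ≤ nm.1 i ∧ nm.1 i ≤ X) ∧ ∀ j, 1 ≤ nm.2 j ∧ nm.2 j ≤ X) ∧
      ∏ i, nm.1 i = ∏ j, nm.2 j ∧ (∀ i, ∀ p ∈ R, ¬ p ∣ nm.1 i) ∧ ∀ j, ∀ p ∈ R, ¬ p ∣ nm.2 j := by
  simp [solSet]

theorem mem_smoothPairs {nm : (Fin k → ℕ) × (Fin k → ℕ)} :
    nm ∈ smoothPairs k X S ↔ ((∀ i, 1 ≤ nm.1 i ∧ nm.1 i ≤ X) ∧ ∀ j, 1 ≤ nm.2 j ∧ nm.2 j ≤ X) ∧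
      ∏ i, nm.1 i = ∏ j, nm.2 j ∧ (∀ i, nm.1 i ∈ Nat.factoredNumbers S) ∧
        ∀ j, nm.2 j ∈ Nat.factoredNumbers S := by
  simp [smoothPairs]

/-- The matrices in `matSet` with no entry divisible by a `p ∈ Q`. -/
def roughSet (Q : Finset ℕ) (X : ℕ) (n m : Fin k → ℕ) : Finset (Fin k → Fin k → ℕ) :=
  sievedSet (Q ×ˢ Finset.univ) X n m

theorem mem_roughSet {Q : Finset ℕ} {n m : Fin k → ℕ} (hn : ∀ i, 1 ≤ n i)
    {a : Fin k → Fin k → ℕ} :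
    a ∈ roughSet Q X n m ↔ ((∀ i j, 1 ≤ a i j) ∧ (∀ i, n i * rowProd a i ≤ X) ∧
      ∀ j, m j * colProd a j ≤ X) ∧ ∀ i j, ∀ p ∈ Q, ¬ p ∣ a i j := by
  simp only [roughSet, sievedSet, Finset.mem_filter, mem_matSet_iff hn, Finset.mem_product,
    Finset.mem_univ, and_true, Prod.forall]
  exact and_congr_right fun _ => ⟨fun h i j p hp => h p i j hp, fun h p i j hp => h i j p hp⟩

/-- The pairs of smooth tuples with the rough matrices that complement them. -/
noncomputable def tripleSet (k X : ℕ) (R S : Finset ℕ) :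
    Finset (Σ _ : (Fin k → ℕ) × (Fin k → ℕ), Fin k → Fin k → ℕ) :=
  (smoothPairs k X S).sigma fun nm => roughSet (R ∪ S) X nm.1 nm.2

theorem mem_tripleSet {t : Σ _ : (Fin k → ℕ) × (Fin k → ℕ), Fin k → Fin k → ℕ} :
    t ∈ tripleSet k X R S ↔ t.1 ∈ smoothPairs k X S ∧ t.2 ∈ roughSet (R ∪ S) X t.1.1 t.1.2 :=
  Finset.mem_sigma

theorem card_tripleSet : (tripleSet k X R S).card =
    ∑ nm ∈ smoothPairs k X S, (roughSet (R ∪ S) X nm.1 nm.2).card :=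
  Finset.card_sigma _ _

/-- Recombination of a smooth pair and a rough matrix. -/
def recombine (t : Σ _ : (Fin k → ℕ) × (Fin k → ℕ), Fin k → Fin k → ℕ) :
    (Fin k → ℕ) × (Fin k → ℕ) :=
  (t.1.1 * rowProd t.2, t.1.2 * colProd t.2)

/-- `recombine` reaches every solution: after splitting off smooth parts, equality of the products
holds separately for the smooth and the rough parts, and the rough ones have a common refinement. -/
theorem card_solSet_le (hS : ∀ p ∈ S, p.Prime) :
    (solSet k X R).card ≤ (tripleSet k X R S).card := by
  refine Finset.card_le_card_of_surjOn recombine ?_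
  rintro ⟨n, m⟩ hnm
  rw [Finset.mem_coe, mem_solSet] at hnm
  obtain ⟨⟨hn, hm⟩, heq, hnR, hmR⟩ := hnm
  choose s r hsr hs hr using fun i =>
    exists_smooth_mul_rough hS (n i) (Nat.one_le_iff_ne_zero.mp (hn i).1)
  choose s' r' hsr' hs' hr' using fun i =>
    exists_smooth_mul_rough hS (m i) (Nat.one_le_iff_ne_zero.mp (hm i).1)
  have hprod : (∏ i, s i) * ∏ i, r i = (∏ i, s' i) * ∏ i, r' i := by
    rw [← Finset.prod_mul_distrib, ← Finset.prod_mul_distrib,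
      Finset.prod_congr rfl fun i _ => hsr i, Finset.prod_congr rfl fun i _ => hsr' i]
    exact heq
  have hss' : ∏ i, s i = ∏ i, s' i := eq_of_mul_eq_mul_of_coprime hprod
    (coprime_of_mem_factoredNumbers (prod_mem_factoredNumbers_of_forall hs) (prod_rough hS hr'))
    (coprime_of_mem_factoredNumbers (prod_mem_factoredNumbers_of_forall hs') (prod_rough hS hr))
  have hs1 : ∀ i, 1 ≤ s i := fun i => Nat.pos_of_ne_zero (Nat.ne_zero_of_mem_factoredNumbers (hs i))
  have hs1' : ∀ i, 1 ≤ s' i :=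
    fun i => Nat.pos_of_ne_zero (Nat.ne_zero_of_mem_factoredNumbers (hs' i))
  have hr1 : ∀ i, 1 ≤ r i := fun i => Nat.pos_of_ne_zero fun h0 => by
    have h1 := hsr i; rw [h0, mul_zero] at h1; exact absurd (hn i).1 (by simp [← h1])
  have hr1' : ∀ i, 1 ≤ r' i := fun i => Nat.pos_of_ne_zero fun h0 => by
    have h1 := hsr' i; rw [h0, mul_zero] at h1; exact absurd (hm i).1 (by simp [← h1])
  have hrr' : ∏ i, r i = ∏ i, r' i := by
    rw [hss'] at hprod
    exact Nat.eq_of_mul_eq_mul_left (Finset.prod_pos fun i _ => hs1' i) hprod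
  obtain ⟨a, ha, ha'⟩ := exists_refinement r r' hr1 hrr'
  have hdvd : ∀ i j, a i j ∣ r i := fun i j =>
    ha i ▸ Finset.dvd_prod_of_mem _ (Finset.mem_univ j)
  refine ⟨⟨(s, s'), a⟩, ?_, ?_⟩
  · rw [Finset.mem_coe, mem_tripleSet, mem_smoothPairs, mem_roughSet hs1]
    refine ⟨⟨⟨fun i => ⟨hs1 i, ?_⟩, fun i => ⟨hs1' i, ?_⟩⟩, hss', hs, hs'⟩,
      ⟨fun i j => Nat.pos_of_dvd_of_pos (hdvd i j) (hr1 i), fun i => ?_, fun i => ?_⟩, ?_⟩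
    · exact (Nat.le_mul_of_pos_right _ (hr1 i)).trans ((hsr i).le.trans (hn i).2)
    · exact (Nat.le_mul_of_pos_right _ (hr1' i)).trans ((hsr' i).le.trans (hm i).2)
    · exact (congrArg _ (ha i)).trans (hsr i) ▸ (hn i).2
    · exact (congrArg _ (ha' i)).trans (hsr' i) ▸ (hm i).2
    · intro i j p hp h
      rcases Finset.mem_union.mp hp with hp | hp
      · exact hnR i p hp ((h.trans (hdvd i j)).trans (Dvd.intro_left _ (hsr i)))
      · exact hr i p hp (h.trans (hdvd i j))
  · refine Prod.ext (funext fun i => ?_) (funext fun i => ?_)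
    · exact (congrArg _ (ha i)).trans (hsr i)
    · exact (congrArg _ (ha' i)).trans (hsr' i)

theorem recombine_mem_solSet (hR : ∀ p ∈ R, p.Prime) (hRS : Disjoint R S)
    {t : Σ _ : (Fin k → ℕ) × (Fin k → ℕ), Fin k → Fin k → ℕ} (ht : t ∈ tripleSet k X R S) :
    recombine t ∈ solSet k X R := by
  obtain ⟨⟨n, m⟩, a⟩ := t
  obtain ⟨h1, h2⟩ := mem_tripleSet.mp ht
  rw [mem_smoothPairs] at h1
  obtain ⟨⟨hn, hm⟩, heq, hns, hms⟩ := h1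
  rw [mem_roughSet fun i => (hn i).1] at h2
  obtain ⟨⟨ha, hrow, hcol⟩, hrough⟩ := h2
  have hdisj : ∀ p ∈ R, p ∉ S := fun p hp hp' => Finset.disjoint_left.mp hRS hp hp'
  rw [mem_solSet]
  refine ⟨⟨fun i => ⟨Nat.mul_pos (hn i).1 (one_le_rowProd ha i), hrow i⟩,
    fun i => ⟨Nat.mul_pos (hm i).1 (one_le_colProd ha i), hcol i⟩⟩, ?_, ?_, ?_⟩
  · simp only [recombine, Pi.mul_apply, Finset.prod_mul_distrib, prod_rowProd]
    exact congrArg (· * _) heq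
  · intro i p hp h
    rcases (hR p hp).dvd_mul.mp h with h | h
    · exact hdisj p hp (Nat.mem_factoredNumbers'.mp (hns i) p (hR p hp) h)
    · obtain ⟨j, -, hj⟩ := ((hR p hp).prime.dvd_finsetProd_iff _).mp h
      exact hrough i j p (Finset.mem_union_left _ hp) hj
  · intro i p hp h
    rcases (hR p hp).dvd_mul.mp h with h | h
    · exact hdisj p hp (Nat.mem_factoredNumbers'.mp (hms i) p (hR p hp) h)
    · obtain ⟨j, -, hj⟩ := ((hR p hp).prime.dvd_finsetProd_iff _).mp h
      exact hrough j i p (Finset.mem_union_left _ hp) hj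

/-- The entries of a matrix are pairwise coprime. -/
def PairwiseCoprimeEntries (a : Fin k → Fin k → ℕ) : Prop :=
  ∀ e f : Fin k × Fin k, e ≠ f → (a e.1 e.2).Coprime (a f.1 f.2)

-- `recombine` is injective here: coprimality separates the smooth factor from the rough one in each
-- entry, and `entry_eq_gcd` recovers the matrix from its margins.
open scoped Classical in
theorem card_filter_coprime_le (hR : ∀ p ∈ R, p.Prime) (hS : ∀ p ∈ S, p.Prime)
    (hRS : Disjoint R S) :
    ((tripleSet k X R S).filter fun t => PairwiseCoprimeEntries t.2).card ≤
      (solSet k X R).card := by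
  refine Finset.card_le_card_of_injOn recombine
    (fun t ht => recombine_mem_solSet hR hRS (Finset.mem_filter.mp ht).1) ?_
  rintro ⟨⟨n, m⟩, a⟩ ht ⟨⟨n', m'⟩, a'⟩ ht' h
  rw [Finset.mem_coe, Finset.mem_filter, mem_tripleSet, mem_smoothPairs] at ht ht'
  obtain ⟨⟨⟨⟨hn, hm⟩, -, hns, hms⟩, ha⟩, hc⟩ := ht
  obtain ⟨⟨⟨⟨hn', hm'⟩, -, hns', hms'⟩, ha'⟩, hc'⟩ := ht'
  rw [mem_roughSet fun i => (hn i).1] at ha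
  rw [mem_roughSet fun i => (hn' i).1] at ha'
  dsimp only at *
  have hrow : ∀ i, n i * rowProd a i = n' i * rowProd a' i := fun i =>
    congrFun (congrArg Prod.fst h) i
  have hcol : ∀ i, m i * colProd a i = m' i * colProd a' i := fun i =>
    congrFun (congrArg Prod.snd h) i
  have hrr : ∀ i, ∀ p ∈ S, ¬ p ∣ rowProd a i := fun i => prod_rough hS fun j p hp =>
    ha.2 i j p (Finset.mem_union_right _ hp)
  have hrr' : ∀ i, ∀ p ∈ S, ¬ p ∣ rowProd a' i := fun i => prod_rough hS fun j p hp =>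
    ha'.2 i j p (Finset.mem_union_right _ hp)
  have hcr : ∀ i, ∀ p ∈ S, ¬ p ∣ colProd a i := fun i => prod_rough hS fun j p hp =>
    ha.2 j i p (Finset.mem_union_right _ hp)
  have hcr' : ∀ i, ∀ p ∈ S, ¬ p ∣ colProd a' i := fun i => prod_rough hS fun j p hp =>
    ha'.2 j i p (Finset.mem_union_right _ hp)
  have e1 : n = n' := funext fun i => eq_of_mul_eq_mul_of_coprime (hrow i)
    (coprime_of_mem_factoredNumbers (hns i) (hrr' i))
    (coprime_of_mem_factoredNumbers (hns' i) (hrr i))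
  have e2 : m = m' := funext fun i => eq_of_mul_eq_mul_of_coprime (hcol i)
    (coprime_of_mem_factoredNumbers (hms i) (hcr' i))
    (coprime_of_mem_factoredNumbers (hms' i) (hcr i))
  subst e1 e2
  have e3 : a = a' := by
    funext i j
    rw [entry_eq_gcd hc i j, entry_eq_gcd hc' i j, Nat.eq_of_mul_eq_mul_left (hn i).1 (hrow i),
      Nat.eq_of_mul_eq_mul_left (hm j).1 (hcol j)]
  rw [e3]

/-- The index set for the matrices with two entries divisible by a prime outside `Q`. -/
def collisionIndex (k X : ℕ) (Q : Finset ℕ) : Finset (((Fin k × Fin k) × (Fin k × Fin k)) × ℕ) :=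
  (Finset.univ.filter fun ef => ef.1 ≠ ef.2) ×ˢ
    (Finset.Icc 1 X).filter fun p => p.Prime ∧ p ∉ Q

-- If two entries share a prime `p`, then `p` lies outside `R ∪ S` and is at most `X`. Dividing it
-- out of both places leaves a matrix whose row weights have product `p²`.
open scoped Classical in
theorem card_filter_not_coprime_le :
    ((tripleSet k X R S).filter fun t => ¬ PairwiseCoprimeEntries t.2).card ≤
      ∑ c ∈ collisionIndex k X (R ∪ S),
        (matSet k X (rowProd (bump c.2 c.1.1 * bump c.2 c.1.2))
          (colProd (bump c.2 c.1.1 * bump c.2 c.1.2))).card := by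
  have hex : ∀ nm : (Fin k → ℕ) × (Fin k → ℕ), ∃ a : Fin k → Fin k → ℕ,
      (∀ i, 1 ≤ nm.1 i) → ∏ i, nm.1 i = ∏ j, nm.2 j → rowProd a = nm.1 ∧ colProd a = nm.2 := by
    intro nm
    by_cases h : (∀ i, 1 ≤ nm.1 i) ∧ ∏ i, nm.1 i = ∏ j, nm.2 j
    · obtain ⟨a, h1, h2⟩ := exists_refinement nm.1 nm.2 h.1 h.2
      exact ⟨a, fun _ _ => ⟨funext h1, funext h2⟩⟩
    · exact ⟨fun _ _ => 1, fun h1 h2 => absurd ⟨h1, h2⟩ h⟩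
  choose ref href using hex
  have hmain : ((tripleSet k X R S).filter fun t => ¬ PairwiseCoprimeEntries t.2).card ≤
      ((collisionIndex k X (R ∪ S)).biUnion fun c =>
        (matSet k X (rowProd (bump c.2 c.1.1 * bump c.2 c.1.2))
          (colProd (bump c.2 c.1.1 * bump c.2 c.1.2))).image
            fun b => (bump c.2 c.1.1 * bump c.2 c.1.2) * b).card := by
    -- Multiplying the rough matrix by a fixed refinement of the smooth pair encodes the triple in a
    -- single matrix. Nothing is lost, since each entry of the product splits uniquely into smooth
    -- and rough parts.
    refine Finset.card_le_card_of_injOn (fun t => ref t.1 * t.2) ?_ ?_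
    · rintro ⟨⟨n, m⟩, a⟩ ht
      rw [Finset.mem_coe, Finset.mem_filter, mem_tripleSet, mem_smoothPairs] at ht
      obtain ⟨⟨⟨⟨hn, hm⟩, heq, hns, hms⟩, ha⟩, hc⟩ := ht
      rw [mem_roughSet fun i => (hn i).1] at ha
      obtain ⟨hr1, hr2⟩ := href (n, m) (fun i => (hn i).1) heq
      dsimp only at *
      simp only [PairwiseCoprimeEntries, not_forall] at hc
      obtain ⟨e, f, hef, hnc⟩ := hc
      obtain ⟨p, hp, hpe, hpf⟩ := Nat.Prime.not_coprime_iff_dvd.mp hnc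
      have hpQ : p ∉ R ∪ S := fun h => ha.2 e.1 e.2 p h hpe
      have hrefpos : ∀ i j, 1 ≤ ref (n, m) i j := fun i j => by
        have h : rowProd (ref (n, m)) i ≠ 0 := by
          rw [hr1]; exact Nat.one_le_iff_ne_zero.mp (hn i).1
        exact Nat.one_le_iff_ne_zero.mpr fun h0 => h (Finset.prod_eq_zero (Finset.mem_univ j) h0)
      have hmem : ref (n, m) * a ∈ matSet k X 1 1 := by
        rw [mul_mem_matSet_iff (n := 1) (fun _ => le_rfl) hrefpos, hr1, hr2, one_mul, one_mul,
          mem_matSet_iff fun i => (hn i).1]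
        exact ha.1
      have hpX : p ≤ X := by
        have h1 := (mem_matSet.mp hmem).1 e.1 e.2
        rw [Finset.mem_Icc] at h1
        exact (Nat.le_of_dvd h1.1 (hpe.trans (Dvd.intro_left _ rfl))).trans h1.2
      have hb := one_le_bump (k := k) hp.one_le
      have hD1 : ∀ i j, 1 ≤ (bump p e * bump p f) i j := fun i j => Nat.mul_pos (hb e i j) (hb f i j)
      have hdvd : ∀ i j, (bump p e * bump p f) i j ∣ (ref (n, m) * a) i j := by
        intro i j
        simp only [Pi.mul_apply]
        refine Dvd.dvd.mul_left ?_ _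
        unfold bump
        split_ifs with h1 h2 h2
        · exact absurd (h1.symm.trans h2) hef
        · rw [mul_one]; rw [← h1] at hpe; exact hpe
        · rw [one_mul]; rw [← h2] at hpf; exact hpf
        · exact one_dvd _
      have hfac : (bump p e * bump p f) * (fun i j => (ref (n, m) * a) i j /
          (bump p e * bump p f) i j) = ref (n, m) * a := by
        funext i j; exact Nat.mul_div_cancel' (hdvd i j)
      refine Finset.mem_biUnion.mpr ⟨((e, f), p), ?_, Finset.mem_image.mpr ⟨_, ?_, hfac⟩⟩
      · simp only [collisionIndex, Finset.mem_product, Finset.mem_filter, Finset.mem_univ,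
          true_and, Finset.mem_Icc]
        exact ⟨hef, ⟨hp.one_le, hpX⟩, hp, hpQ⟩
      · have := (mul_mem_matSet_iff (X := X) (n := 1) (m := 1) (a := fun i j =>
          (ref (n, m) * a) i j / (bump p e * bump p f) i j) (fun _ => le_rfl) hD1).mp
          (by rw [hfac]; exact hmem)
        simpa using this
    · rintro ⟨⟨n, m⟩, a⟩ ht ⟨⟨n', m'⟩, a'⟩ ht' h
      rw [Finset.mem_coe, Finset.mem_filter, mem_tripleSet, mem_smoothPairs] at ht ht'
      obtain ⟨⟨⟨⟨hn, hm⟩, heq, hns, hms⟩, ha⟩, hc⟩ := ht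
      obtain ⟨⟨⟨⟨hn', hm'⟩, heq', hns', hms'⟩, ha'⟩, hc'⟩ := ht'
      rw [mem_roughSet fun i => (hn i).1] at ha
      rw [mem_roughSet fun i => (hn' i).1] at ha'
      obtain ⟨hr1, hr2⟩ := href (n, m) (fun i => (hn i).1) heq
      obtain ⟨hr1', hr2'⟩ := href (n', m') (fun i => (hn' i).1) heq'
      dsimp only at *
      have hsm : ∀ i j, ref (n, m) i j ∈ Nat.factoredNumbers S := fun i j =>
        Nat.mem_factoredNumbers_of_dvd (hns i)
          ((Finset.dvd_prod_of_mem _ (Finset.mem_univ j)).trans (congrFun hr1 i).dvd)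
      have hsm' : ∀ i j, ref (n', m') i j ∈ Nat.factoredNumbers S := fun i j =>
        Nat.mem_factoredNumbers_of_dvd (hns' i)
          ((Finset.dvd_prod_of_mem _ (Finset.mem_univ j)).trans (congrFun hr1' i).dvd)
      have hmul : ∀ i j, ref (n, m) i j * a i j = ref (n', m') i j * a' i j := fun i j =>
        congrFun (congrFun h i) j
      have e1 : ref (n, m) = ref (n', m') := by
        funext i j
        exact eq_of_mul_eq_mul_of_coprime (hmul i j)
          (coprime_of_mem_factoredNumbers (hsm i j)
            fun p hp => ha'.2 i j p (Finset.mem_union_right _ hp))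
          (coprime_of_mem_factoredNumbers (hsm' i j)
            fun p hp => ha.2 i j p (Finset.mem_union_right _ hp))
      have e2 : n = n' := by rw [← hr1, ← hr1', e1]
      have e3 : m = m' := by rw [← hr2, ← hr2', e1]
      subst e2 e3
      have e4 : a = a' := by
        funext i j
        exact Nat.eq_of_mul_eq_mul_left
          (Nat.pos_of_ne_zero (Nat.ne_zero_of_mem_factoredNumbers (hsm i j))) (hmul i j)
      rw [e4]
  exact hmain.trans (Finset.card_biUnion_le.trans
    (Finset.sum_le_sum fun c _ => Finset.card_image_le))

theorem card_tripleSet_le (hR : ∀ p ∈ R, p.Prime) (hS : ∀ p ∈ S, p.Prime)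
    (hRS : Disjoint R S) :
    (tripleSet k X R S).card ≤ (solSet k X R).card + ∑ c ∈ collisionIndex k X (R ∪ S),
        (matSet k X (rowProd (bump c.2 c.1.1 * bump c.2 c.1.2))
          (colProd (bump c.2 c.1.1 * bump c.2 c.1.2))).card := by
  classical
  rw [← Finset.card_filter_add_card_filter_not (s := tripleSet k X R S)
    (fun t => PairwiseCoprimeEntries t.2)]
  exact add_le_add (card_filter_coprime_le hR hS hRS) card_filter_not_coprime_le

end Counting

/-! ### Asymptotics of the number of solutions, uniform in the excluded primes. -/

section Asymptotics

variable {d : ℕ}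

theorem sum_collision_le {C : ℝ} (hC0 : 0 ≤ C) {X : ℕ}
    (hC : ∀ n m : Fin (d + 1) → ℕ, (∀ i, 1 ≤ n i) → (∀ j, 1 ≤ m j) → ∏ i, n i = ∏ j, m j →
      ((matSet (d + 1) X n m).card : ℝ) / matScale d X ≤ C / ∏ i, (n i : ℝ)) (Q : Finset ℕ) :
    (∑ c ∈ collisionIndex (d + 1) X Q,
      ((matSet (d + 1) X (rowProd (bump c.2 c.1.1 * bump c.2 c.1.2))
        (colProd (bump c.2 c.1.1 * bump c.2 c.1.2))).card : ℝ)) / matScale d X ≤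
      ((d + 1 : ℝ) ^ 4 * C) *
        ∑ p ∈ (Finset.Icc 1 X).filter fun p => p.Prime ∧ p ∉ Q, 1 / (p : ℝ) ^ 2 := by
  have hterm : ∀ c ∈ collisionIndex (d + 1) X Q,
      ((matSet (d + 1) X (rowProd (bump c.2 c.1.1 * bump c.2 c.1.2))
        (colProd (bump c.2 c.1.1 * bump c.2 c.1.2))).card : ℝ) / matScale d X ≤
        C * (1 / (c.2 : ℝ) ^ 2) := by
    rintro ⟨⟨e, f⟩, p⟩ hc
    simp only [collisionIndex, Finset.mem_product, Finset.mem_filter] at hc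
    have hp : p.Prime := hc.2.2.1
    have hb := one_le_bump (k := d + 1) hp.one_le
    have hD1 : ∀ i j, 1 ≤ (bump p e * bump p f) i j := fun i j =>
      Nat.mul_pos (hb e i j) (hb f i j)
    refine (hC _ _ (one_le_rowProd hD1) (one_le_colProd hD1) (prod_rowProd _)).trans (le_of_eq ?_)
    rw [← Nat.cast_prod, rowProd_mul]
    simp only [Pi.mul_apply, Finset.prod_mul_distrib, prod_rowProd_bump]
    push_cast
    ring
  rw [Finset.sum_div]
  refine (Finset.sum_le_sum hterm).trans ?_
  rw [collisionIndex, Finset.sum_product]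
  dsimp only
  rw [Finset.sum_const, nsmul_eq_mul, ← Finset.mul_sum,
    ← mul_assoc]
  refine mul_le_mul_of_nonneg_right (mul_le_mul_of_nonneg_right ?_ hC0)
    (Finset.sum_nonneg fun _ _ => by positivity)
  refine (Nat.cast_le.mpr (Finset.card_filter_le _ _)).trans (le_of_eq ?_)
  simp only [Finset.card_univ, Fintype.card_prod, Fintype.card_fin]
  push_cast
  ring

/-- Dominated convergence for sums: the convergent series of `C d_k(N)² / N` over factored numbers
is the majorant. -/
theorem tendsto_tsum_min (k : ℕ) {S : Finset ℕ} (hS : ∀ p ∈ S, p.Prime) {C : ℝ} (hC : 0 ≤ C) :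
    Tendsto (fun δ : ℝ => ∑' N : Nat.factoredNumbers S,
      (divisorFun k N : ℝ) ^ 2 * min δ (C / (N : ℕ))) (𝓝[>] 0) (𝓝 0) := by
  have hsum : Summable fun N : Nat.factoredNumbers S => C * divisorTerm k N :=
    (hasSum_divisorTerm_factoredNumbers k hS).summable.mul_left C
  have h := tendsto_tsum_of_dominated_convergence (𝓕 := 𝓝[>] (0 : ℝ))
    (f := fun δ (N : Nat.factoredNumbers S) => (divisorFun k N : ℝ) ^ 2 * min δ (C / (N : ℕ)))
    (g := fun _ => 0) hsum ?_ ?_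
  · simpa using h
  · intro N
    have hc : Continuous fun δ : ℝ => (divisorFun k N : ℝ) ^ 2 * min δ (C / (N : ℕ)) := by
      fun_prop
    have h0 := (hc.tendsto 0).mono_left (nhdsWithin_le_nhds (s := Set.Ioi 0))
    have : min 0 (C / ((N : ℕ) : ℝ)) = 0 := min_eq_left (by positivity)
    simpa [this] using h0
  · filter_upwards [self_mem_nhdsWithin] with δ hδ N
    have hδ' : (0 : ℝ) < δ := hδ
    have hmin : 0 ≤ min δ (C / ((N : ℕ) : ℝ)) := le_min hδ'.le (by positivity)
    rw [Real.norm_of_nonneg (by positivity), divisorTerm, mul_div_left_comm]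
    exact mul_le_mul_of_nonneg_left (min_le_right _ _) (by positivity)

theorem card_tripleSet_hasSum {k X : ℕ} {R S : Finset ℕ} :
    HasSum (fun N : Nat.factoredNumbers S =>
      ∑ nm ∈ Nat.finMulAntidiag k N ×ˢ Nat.finMulAntidiag k N,
        ((roughSet (R ∪ S) X nm.1 nm.2).card : ℝ)) ((tripleSet k X R S).card : ℝ) := by
  classical
  have hempty : ∀ N : Nat.factoredNumbers S,
      ∀ nm ∈ Nat.finMulAntidiag k N ×ˢ Nat.finMulAntidiag k N, nm ∉ smoothPairs k X S →
        ((roughSet (R ∪ S) X nm.1 nm.2).card : ℝ) = 0 := by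
    intro N nm hnm hnot
    rw [Nat.cast_eq_zero, Finset.card_eq_zero, Finset.eq_empty_iff_forall_notMem]
    intro a ha
    refine hnot ?_
    obtain ⟨h1, h2⟩ := Finset.mem_product.mp hnm
    have hn : ∀ i, 1 ≤ nm.1 i := fun i =>
      Nat.pos_of_ne_zero (Nat.ne_zero_of_mem_finMulAntidiag h1 i)
    have hm : ∀ i, 1 ≤ nm.2 i := fun i =>
      Nat.pos_of_ne_zero (Nat.ne_zero_of_mem_finMulAntidiag h2 i)
    rw [mem_roughSet hn] at ha
    rw [mem_smoothPairs]
    refine ⟨⟨fun i => ⟨hn i, ?_⟩, fun i => ⟨hm i, ?_⟩⟩, ?_, fun i => ?_, fun i => ?_⟩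
    · exact (Nat.le_mul_of_pos_right _ (one_le_rowProd ha.1.1 i)).trans (ha.1.2.1 i)
    · exact (Nat.le_mul_of_pos_right _ (one_le_colProd ha.1.1 i)).trans (ha.1.2.2 i)
    · exact (Nat.prod_eq_of_mem_finMulAntidiag h1).trans
        (Nat.prod_eq_of_mem_finMulAntidiag h2).symm
    · exact Nat.mem_factoredNumbers_of_dvd N.2 (Nat.dvd_of_mem_finMulAntidiag h1 i)
    · exact Nat.mem_factoredNumbers_of_dvd N.2 (Nat.dvd_of_mem_finMulAntidiag h2 i)
  let prodOf : (Fin k → ℕ) × (Fin k → ℕ) → Nat.factoredNumbers S := fun nm =>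
    if h : ∏ i, nm.1 i ∈ Nat.factoredNumbers S then ⟨_, h⟩ else
      ⟨1, Nat.mem_factoredNumbers'.mpr fun p hp h => absurd (Nat.dvd_one.mp h) hp.one_lt.ne'⟩
  have hprodOf : ∀ nm ∈ smoothPairs k X S, ((prodOf nm : ℕ)) = ∏ i, nm.1 i := by
    intro nm hnm
    have := prod_mem_factoredNumbers_of_forall (mem_smoothPairs.mp hnm).2.2.1
    simp only [prodOf, dif_pos this]
  have hfiber : ∀ N : Nat.factoredNumbers S,
      ∑ nm ∈ (smoothPairs k X S).filter (fun nm => prodOf nm = N),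
        ((roughSet (R ∪ S) X nm.1 nm.2).card : ℝ) =
      ∑ nm ∈ Nat.finMulAntidiag k N ×ˢ Nat.finMulAntidiag k N,
        ((roughSet (R ∪ S) X nm.1 nm.2).card : ℝ) := by
    intro N
    refine Finset.sum_subset ?_ ?_
    · intro nm hnm
      obtain ⟨h1, h2⟩ := Finset.mem_filter.mp hnm
      have h3 := hprodOf nm h1
      rw [h2] at h3
      have hN := Nat.ne_zero_of_mem_factoredNumbers N.2
      rw [Finset.mem_product, Nat.mem_finMulAntidiag, Nat.mem_finMulAntidiag]
      exact ⟨⟨h3.symm, hN⟩, (mem_smoothPairs.mp h1).2.1 ▸ h3.symm, hN⟩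
    · intro nm hnm hnot
      refine hempty N nm hnm fun h => hnot (Finset.mem_filter.mpr ⟨h, Subtype.ext ?_⟩)
      rw [hprodOf nm h]
      exact Nat.prod_eq_of_mem_finMulAntidiag (Finset.mem_product.mp hnm).1
  rw [card_tripleSet, Nat.cast_sum,
    ← Finset.sum_fiberwise_of_maps_to (t := (smoothPairs k X S).image prodOf) (g := prodOf)
      fun nm h => Finset.mem_image_of_mem _ h]
  simp only [hfiber]
  refine hasSum_sum_of_ne_finset_zero fun N hN => ?_
  rw [← hfiber N]
  refine Finset.sum_eq_zero fun nm hnm => absurd ?_ hN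
  obtain ⟨h1, h2⟩ := Finset.mem_filter.mp hnm
  exact h2 ▸ Finset.mem_image_of_mem _ h1

/-- For each smooth pair the error is at most `δ` by the sieve and `O(1/N)` trivially. Summing the
minimum over all pairs costs `∑ d_k(N)² min(δ, O(1/N))`, which is small with `δ`. -/
theorem eventually_card_tripleSet_close (d B : ℕ) {S : Finset ℕ} (hS : ∀ p ∈ S, p.Prime) {ε : ℝ}
    (hε : 0 < ε) : ∀ᶠ X : ℕ in atTop, ∀ R : Finset ℕ, (∀ p ∈ R, p.Prime) → R.card ≤ B →
      |((tripleSet (d + 1) X R S).card : ℝ) / matScale d X - matConst d *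
        (∏ p ∈ R ∪ S, (1 - 1 / (p : ℝ)) ^ ((d + 1) ^ 2)) * ∏ p ∈ S, localSum (d + 1) p| ≤ ε := by
  obtain ⟨C, hC0, hC⟩ := exists_card_matSet_le d
  have hc := matConst_pos d
  obtain ⟨δ, hδε, hδ0⟩ := (((tendsto_tsum_min (d + 1) hS (add_nonneg hC0 hc.le)).eventually
    (ge_mem_nhds hε)).and self_mem_nhdsWithin).exists
  have hδ0' : (0 : ℝ) < δ := hδ0
  -- An upper bound for the number of sieve conditions, one for each prime and matrix entry; as
  -- every condition doubles the error, the starting precision is `δ / 2^M`, whatever `R`.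
  set M : ℕ := (B + S.card) * ((d + 1) * (d + 1))
  obtain ⟨X₀, hX₀⟩ := exists_card_matSet_close d (ε := δ / 2 ^ M) (by positivity)
  filter_upwards [eventually_ge_atTop X₀, eventually_ge_atTop 2] with X hX hX2 R hR hRB
  have hQ : ∀ p ∈ R ∪ S, p.Prime := fun p hp => (Finset.mem_union.mp hp).elim (hR p) (hS p)
  set w : ℝ := ∏ p ∈ R ∪ S, (1 - 1 / (p : ℝ)) ^ ((d + 1) ^ 2) with hw
  have hfac : ∀ p ∈ R ∪ S, 0 ≤ 1 - 1 / (p : ℝ) ∧ 1 - 1 / (p : ℝ) ≤ 1 := fun p hp => by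
    have h1 : (1 : ℝ) ≤ p := by exact_mod_cast (hQ p hp).one_le
    have h2 : 1 / (p : ℝ) ≤ 1 := by rw [div_le_one (by linarith)]; exact h1
    have h3 : 0 ≤ 1 / (p : ℝ) := by positivity
    constructor <;> linarith
  have hw0 : 0 ≤ w := Finset.prod_nonneg fun p hp => pow_nonneg (hfac p hp).1 _
  have hw1 : w ≤ 1 := Finset.prod_le_one (fun p hp => pow_nonneg (hfac p hp).1 _)
    fun p hp => pow_le_one₀ (hfac p hp).1 (hfac p hp).2
  have hA := matScale_pos (d := d) hX2
  have hterm : ∀ n m : Fin (d + 1) → ℕ, (∀ i, 1 ≤ n i) → (∀ j, 1 ≤ m j) →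
      ∏ i, n i = ∏ j, m j → |((roughSet (R ∪ S) X n m).card : ℝ) / matScale d X -
        matConst d * w / ∏ i, (n i : ℝ)| ≤ min δ ((C + matConst d) / ∏ i, (n i : ℝ)) := by
    intro n m hn hm hnm
    have hn0 : 0 < ∏ i, (n i : ℝ) := Finset.prod_pos fun i _ => by exact_mod_cast hn i
    refine le_min ?_ ?_
    · have h := abs_card_sievedSet_sub_le (hX₀ X hX) ((R ∪ S) ×ˢ Finset.univ)
        (fun e he => hQ _ (Finset.mem_product.mp he).1) hn hm hnm
      have hprod : ∏ e ∈ (R ∪ S) ×ˢ (Finset.univ : Finset (Fin (d + 1) × Fin (d + 1))),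
          (1 - 1 / (e.1 : ℝ)) = w := by
        rw [Finset.prod_product, hw]
        refine Finset.prod_congr rfl fun p _ => ?_
        simp [Finset.prod_const, sq]
      rw [hprod] at h
      refine h.trans ?_
      have hcard : ((R ∪ S) ×ˢ (Finset.univ : Finset (Fin (d + 1) × Fin (d + 1)))).card ≤ M := by
        rw [Finset.card_product, Finset.card_univ, Fintype.card_prod, Fintype.card_fin]
        exact Nat.mul_le_mul_right _ ((Finset.card_union_le _ _).trans
          (Nat.add_le_add_right hRB _))
      rw [mul_div_assoc', div_le_iff₀ (by positivity), mul_comm]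
      exact mul_le_mul_of_nonneg_left (pow_le_pow_right₀ one_le_two hcard) hδ0'.le
    · have h1 : ((roughSet (R ∪ S) X n m).card : ℝ) / matScale d X ≤ C / ∏ i, (n i : ℝ) := by
        refine le_trans ?_ (hC X hX2 n m hn hm hnm)
        gcongr
        exact Finset.filter_subset _ _
      have h2 : 0 ≤ ((roughSet (R ∪ S) X n m).card : ℝ) / matScale d X := by positivity
      have h3 : matConst d * w / ∏ i, (n i : ℝ) ≤ matConst d / ∏ i, (n i : ℝ) := by
        gcongr
        exact mul_le_of_le_one_right hc.le hw1
      have h4 : 0 ≤ matConst d * w / ∏ i, (n i : ℝ) := by positivity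
      have h5 : 0 ≤ C / ∏ i, (n i : ℝ) := by positivity
      rw [add_div, abs_le]
      constructor <;> linarith
  have hsum1 := (card_tripleSet_hasSum (k := d + 1) (X := X) (R := R) (S := S)).div_const
    (matScale d X)
  have hsum2 := (hasSum_divisorTerm_factoredNumbers (d + 1) hS).mul_left (matConst d * w)
  have hsum := hsum1.sub hsum2
  have hbsum : Summable fun N : Nat.factoredNumbers S =>
      (divisorFun (d + 1) N : ℝ) ^ 2 * min δ ((C + matConst d) / (N : ℕ)) := by
    refine Summable.of_nonneg_of_le (fun N => mul_nonneg (by positivity)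
      (le_min hδ0'.le (by positivity))) (fun N => ?_)
      ((hasSum_divisorTerm_factoredNumbers (d + 1) hS).summable.mul_left (C + matConst d))
    rw [divisorTerm, mul_div_left_comm]
    exact mul_le_mul_of_nonneg_left (min_le_right _ _) (by positivity)
  rw [← hsum.tsum_eq, ← Real.norm_eq_abs]
  refine (tsum_of_norm_bounded hbsum.hasSum ?_).trans hδε
  intro N
  have hdiv : matConst d * w * divisorTerm (d + 1) N =
      ∑ nm ∈ Nat.finMulAntidiag (d + 1) N ×ˢ Nat.finMulAntidiag (d + 1) N,
        matConst d * w / (N : ℕ) := by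
    rw [Finset.sum_const, Finset.card_product, nsmul_eq_mul, divisorTerm, divisorFun]
    push_cast
    ring
  rw [hdiv, Finset.sum_div, ← Finset.sum_sub_distrib]
  refine (norm_sum_le _ _).trans ?_
  have hcard : (divisorFun (d + 1) N : ℝ) ^ 2 * min δ ((C + matConst d) / (N : ℕ)) =
      ∑ nm ∈ Nat.finMulAntidiag (d + 1) N ×ˢ Nat.finMulAntidiag (d + 1) N,
        min δ ((C + matConst d) / (N : ℕ)) := by
    rw [Finset.sum_const, Finset.card_product, nsmul_eq_mul, divisorFun]
    push_cast
    ring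
  rw [hcard]
  refine Finset.sum_le_sum fun nm hnm => ?_
  obtain ⟨h1, h2⟩ := Finset.mem_product.mp hnm
  have hN : ((N : ℕ) : ℝ) = ∏ i, (nm.1 i : ℝ) := by
    rw [← Nat.cast_prod, Nat.prod_eq_of_mem_finMulAntidiag h1]
  rw [hN]
  exact hterm nm.1 nm.2
    (fun i => Nat.pos_of_ne_zero (Nat.ne_zero_of_mem_finMulAntidiag h1 i))
    (fun i => Nat.pos_of_ne_zero (Nat.ne_zero_of_mem_finMulAntidiag h2 i))
    ((Nat.prod_eq_of_mem_finMulAntidiag h1).trans (Nat.prod_eq_of_mem_finMulAntidiag h2).symm)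

theorem prod_inv_localSum_le_one (k : ℕ) {R : Finset ℕ} (hR : ∀ p ∈ R, p.Prime) :
    ∏ p ∈ R, (localSum k p)⁻¹ ≤ 1 :=
  Finset.prod_le_one (fun p hp => inv_nonneg.mpr (zero_le_one.trans (one_le_localSum k (hR p hp))))
    fun p hp => inv_le_one_of_one_le₀ (one_le_localSum k (hR p hp))

theorem prod_inv_localSum_pos (k : ℕ) {R : Finset ℕ} (hR : ∀ p ∈ R, p.Prime) :
    0 < ∏ p ∈ R, (localSum k p)⁻¹ :=
  Finset.prod_pos fun p hp => inv_pos.mpr (zero_lt_one.trans_le (one_le_localSum k (hR p hp)))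

theorem exists_le_prod_inv_localSum (k B : ℕ) : ∃ κ : ℝ, 0 < κ ∧ ∀ R : Finset ℕ,
    (∀ p ∈ R, p.Prime) → R.card ≤ B → κ ≤ ∏ p ∈ R, (localSum k p)⁻¹ := by
  obtain ⟨K, hK1, hK⟩ := exists_localSum_le k
  have hK0 : 0 < K := zero_lt_one.trans_le hK1
  refine ⟨(K⁻¹) ^ B, by positivity, fun R hR hRB => ?_⟩
  calc (K⁻¹) ^ B ≤ (K⁻¹) ^ R.card :=
        pow_le_pow_of_le_one (by positivity) (inv_le_one_of_one_le₀ hK1) hRB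
    _ = ∏ p ∈ R, K⁻¹ := by rw [Finset.prod_const]
    _ ≤ _ := Finset.prod_le_prod (fun _ _ => by positivity) fun p hp =>
        inv_anti₀ (zero_lt_one.trans_le (one_le_localSum k (hR p hp))) (hK p (hR p hp))

/-- Solutions and triples differ by the collisions, which are controlled by `∑ p^{-2}` outside `P`.
A third of `ε` pays for the triple count, another third, through `η`, for collisions and truncation
of the Euler product. -/
theorem eventually_card_solSet_close (d B : ℕ) {ε : ℝ} (hε : 0 < ε) :
    ∀ᶠ X : ℕ in atTop, ∀ R : Finset ℕ, (∀ p ∈ R, p.Prime) → R.card ≤ B →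
      |((solSet (d + 1) X R).card : ℝ) / matScale d X - matConst d * arithFactor (d + 1) *
        ∏ p ∈ R, (localSum (d + 1) p)⁻¹| ≤ ε := by
  obtain ⟨C, hC0, hC⟩ := exists_card_matSet_le d
  have hc := matConst_pos d
  set η : ℝ := ε / 3 / ((d + 1 : ℝ) ^ 4 * C + matConst d) with hη
  have hden : 0 < (d + 1 : ℝ) ^ 4 * C + matConst d := by positivity
  have hη0 : 0 < η := by positivity
  have hηmul : ((d + 1 : ℝ) ^ 4 * C + matConst d) * η = ε / 3 := by rw [hη]; field_simp
  obtain ⟨P, hP, hPprod, hPsum⟩ := exists_primes_eulerFactor_close (d + 1) hη0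
  -- The set `S = P \ R` used below varies with `R`, but only among the finitely many subsets of
  -- `P`, so one threshold for `X` suffices.
  have hev : ∀ᶠ X : ℕ in atTop, ∀ S ∈ P.powerset, ∀ R : Finset ℕ, (∀ p ∈ R, p.Prime) →
      R.card ≤ B → |((tripleSet (d + 1) X R S).card : ℝ) / matScale d X - matConst d *
        (∏ p ∈ R ∪ S, (1 - 1 / (p : ℝ)) ^ ((d + 1) ^ 2)) *
          ∏ p ∈ S, localSum (d + 1) p| ≤ ε / 3 := by
    rw [Filter.eventually_all_finset]
    exact fun S hS => eventually_card_tripleSet_close d B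
      (fun p hp => hP p (Finset.mem_powerset.mp hS hp)) (by positivity)
  filter_upwards [hev, eventually_ge_atTop 2] with X hX hX2 R hR hRB
  set S := P \ R with hS
  have hSP : S ⊆ P := Finset.sdiff_subset
  have hSprime : ∀ p ∈ S, p.Prime := fun p hp => hP p (hSP hp)
  have hRS : Disjoint R S := Finset.disjoint_sdiff
  have hQprime : ∀ p ∈ R ∪ S, p.Prime := fun p hp =>
    (Finset.mem_union.mp hp).elim (hR p) (hSprime p)
  have hPQ : P ⊆ R ∪ S := by
    rw [hS, Finset.union_sdiff_self_eq_union]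
    exact Finset.subset_union_right
  have htri := hX S (Finset.mem_powerset.mpr hSP) R hR hRB
  have hA := matScale_pos (d := d) hX2
  -- The primes of `R` have the factor `(1 - 1/p)^{k²}` but no local sum; completing their Euler
  -- factors creates the inverse local sums.
  have hmain : matConst d * (∏ p ∈ R ∪ S, (1 - 1 / (p : ℝ)) ^ ((d + 1) ^ 2)) *
      ∏ p ∈ S, localSum (d + 1) p =
      matConst d * (∏ p ∈ R ∪ S, eulerFactor (d + 1) p) * ∏ p ∈ R, (localSum (d + 1) p)⁻¹ := by
    simp only [eulerFactor]
    rw [Finset.prod_mul_distrib, Finset.prod_union hRS (f := fun p => localSum (d + 1) p),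
      Finset.prod_inv_distrib]
    have : ∏ p ∈ R, localSum (d + 1) p ≠ 0 := Finset.prod_ne_zero_iff.mpr fun p hp =>
      (zero_lt_one.trans_le (one_le_localSum (d + 1) (hR p hp))).ne'
    field_simp
  rw [hmain] at htri
  have hEuler : |matConst d * (∏ p ∈ R ∪ S, eulerFactor (d + 1) p) *
      (∏ p ∈ R, (localSum (d + 1) p)⁻¹) - matConst d * arithFactor (d + 1) *
        ∏ p ∈ R, (localSum (d + 1) p)⁻¹| ≤ matConst d * η := by
    rw [← sub_mul, ← mul_sub, abs_mul, abs_mul, abs_of_pos hc,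
      abs_of_pos (prod_inv_localSum_pos (d + 1) hR)]
    refine (mul_le_of_le_one_right (by positivity) (prod_inv_localSum_le_one (d + 1) hR)).trans ?_
    exact mul_le_mul_of_nonneg_left (hPprod _ hQprime hPQ) hc.le
  have hup : ((solSet (d + 1) X R).card : ℝ) / matScale d X ≤
      ((tripleSet (d + 1) X R S).card : ℝ) / matScale d X := by
    gcongr
    exact card_solSet_le hSprime
  have hlow : ((tripleSet (d + 1) X R S).card : ℝ) / matScale d X ≤
      ((solSet (d + 1) X R).card : ℝ) / matScale d X + (d + 1 : ℝ) ^ 4 * C * η := by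
    have h1 := card_tripleSet_le (k := d + 1) (X := X) hR hSprime hRS
    have h2 := sum_collision_le hC0 (hC X hX2) (R ∪ S)
    have h3 : ∑ p ∈ (Finset.Icc 1 X).filter (fun p => p.Prime ∧ p ∉ R ∪ S),
        1 / (p : ℝ) ^ 2 ≤ η := by
      refine hPsum _ (fun p hp => (Finset.mem_filter.mp hp).2.1) ?_
      rw [Finset.disjoint_left]
      exact fun p hp hpP => (Finset.mem_filter.mp hp).2.2 (hPQ hpP)
    have h4 := h2.trans (mul_le_mul_of_nonneg_left h3 (by positivity))
    refine le_trans ?_ (add_le_add_right h4 _)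
    rw [← add_div]
    gcongr
    exact_mod_cast h1
  rw [abs_le] at htri hEuler ⊢
  have h5 : (d + 1 : ℝ) ^ 4 * C * η + matConst d * η = ε / 3 := by rw [← add_mul]; exact hηmul
  have h6 : 0 ≤ (d + 1 : ℝ) ^ 4 * C * η := by positivity
  have h7 : 0 ≤ matConst d * η := by positivity
  constructor <;> linarith

end Asymptotics

/-! ### Orthogonality of characters and the principal character. -/

section Orthogonality

theorem norm_sum_char_pow {q : ℕ} (χ : DirichletCharacter ℂ q) (k X : ℕ) :
    ((‖∑ n ∈ Finset.Icc 1 X, χ (n : ZMod q)‖ ^ (2 * k) : ℝ) : ℂ) =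
      ∑ n ∈ Fintype.piFinset fun _ : Fin k => Finset.Icc 1 X,
        ∑ m ∈ Fintype.piFinset fun _ : Fin k => Finset.Icc 1 X,
          χ ((∏ i, n i : ℕ) : ZMod q) * star (χ ((∏ j, m j : ℕ) : ZMod q)) := by
  have hpow : (∑ n ∈ Finset.Icc 1 X, χ (n : ZMod q)) ^ k =
      ∑ n ∈ Fintype.piFinset fun _ : Fin k => Finset.Icc 1 X, χ ((∏ i, n i : ℕ) : ZMod q) := by
    rw [Finset.sum_pow']
    refine Finset.sum_congr rfl fun n _ => ?_
    rw [Nat.cast_prod, map_prod]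
  rw [pow_mul, ← Finset.sum_mul_sum, ← star_sum, ← hpow, star_pow, ← mul_pow, Complex.star_def,
    Complex.mul_conj, Complex.normSq_eq_norm_sq]
  push_cast
  rfl

variable {q : ℕ} [NeZero q]

open scoped Classical in
theorem sum_char_mul_star_char (a b : ZMod q) :
    ∑ χ : DirichletCharacter ℂ q, χ b * star (χ a) =
      if IsUnit a ∧ a = b then (q.totient : ℂ) else 0 := by
  by_cases ha : IsUnit a
  · have h := DirichletCharacter.sum_char_inv_mul_char_eq ℂ ha b
    simp only [ha, true_and]
    rw [← h]
    refine Finset.sum_congr rfl fun χ _ => ?_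
    rw [MulChar.star_apply', mul_comm]
    obtain ⟨u, rfl⟩ := ha
    rw [MulChar.inv_apply, Ring.inverse_unit, ZMod.inv_coe_unit]
  · simp only [ha, false_and, if_false]
    refine Finset.sum_eq_zero fun χ _ => ?_
    rw [χ.map_nonunit ha, star_zero, mul_zero]

/-- Expanding the powers, orthogonality keeps the pairs whose products are congruent units modulo
`q`. Both products are at most `X^k ≤ q`, so congruence is equality. -/
theorem card_solSet_eq_sum_char {k X : ℕ} (hX : X ^ k ≤ q) :
    ∑ χ : DirichletCharacter ℂ q, ‖∑ n ∈ Finset.Icc 1 X, χ (n : ZMod q)‖ ^ (2 * k) =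
      q.totient * ((solSet k X q.primeFactors).card : ℝ) := by
  classical
  rw [← Complex.ofReal_inj, Complex.ofReal_sum]
  simp only [norm_sum_char_pow]
  rw [Finset.sum_comm, Finset.sum_congr rfl fun n _ => Finset.sum_comm]
  simp only [sum_char_mul_star_char]
  rw [← Finset.sum_product', ← Finset.sum_filter, Finset.sum_const, nsmul_eq_mul]
  have hset : ((Fintype.piFinset fun _ : Fin k => Finset.Icc 1 X) ×ˢ
      Fintype.piFinset fun _ : Fin k => Finset.Icc 1 X).filter (fun nm =>
        IsUnit ((∏ j, nm.2 j : ℕ) : ZMod q) ∧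
          ((∏ j, nm.2 j : ℕ) : ZMod q) = ((∏ i, nm.1 i : ℕ) : ZMod q)) =
      solSet k X q.primeFactors := by
    refine Finset.filter_congr fun nm hnm => ?_
    obtain ⟨h1, h2⟩ := Finset.mem_product.mp hnm
    rw [Fintype.mem_piFinset] at h1 h2
    have hpos : ∀ f : Fin k → ℕ, (∀ i, f i ∈ Finset.Icc 1 X) → 1 ≤ ∏ i, f i ∧ ∏ i, f i ≤ q := by
      intro f hf
      refine ⟨Nat.succ_le_of_lt (Finset.prod_pos fun i _ => (Finset.mem_Icc.mp (hf i)).1), ?_⟩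
      refine le_trans (Finset.prod_le_pow_card _ _ X fun i _ => (Finset.mem_Icc.mp (hf i)).2) ?_
      simpa using hX
    have hcop : ∀ f : Fin k → ℕ, (∏ i, f i).Coprime q ↔
        ∀ i, ∀ p ∈ q.primeFactors, ¬ p ∣ f i := by
      intro f
      rw [Nat.coprime_fintype_prod_left_iff]
      refine forall_congr' fun i => ⟨fun h p hp hpf => ?_, fun h => ?_⟩
      · have hp' := Nat.mem_primeFactors.mp hp
        exact Nat.not_coprime_of_dvd_of_dvd hp'.1.one_lt hpf hp'.2.1 h
      · exact Nat.coprime_of_dvd fun p hp hpf hpq =>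
          h p (Nat.mem_primeFactors.mpr ⟨hp, hpq, NeZero.ne q⟩) hpf
    have heq : ((∏ j, nm.2 j : ℕ) : ZMod q) = ((∏ i, nm.1 i : ℕ) : ZMod q) ↔
        ∏ i, nm.1 i = ∏ j, nm.2 j := by
      refine ⟨fun h => ?_, fun h => by rw [h]⟩
      rw [ZMod.natCast_eq_natCast_iff] at h
      obtain ⟨a1, a2⟩ := hpos _ h1
      obtain ⟨b1, b2⟩ := hpos _ h2
      generalize ∏ i, nm.1 i = a at *
      generalize ∏ i, nm.2 i = b at *
      -- The products lie in `[1, q]` with `q` allowed, so both are shifted by one to become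
      -- residues below `q`.
      have h' : b - 1 ≡ a - 1 [MOD q] :=
        Nat.ModEq.add_right_cancel' 1 (by rwa [Nat.sub_add_cancel b1, Nat.sub_add_cancel a1])
      have := Nat.ModEq.eq_of_lt_of_lt h' (by omega) (by omega)
      omega
    rw [ZMod.isUnit_iff_coprime, heq, hcop, ← hcop, ← hcop]
    constructor
    · rintro ⟨h, h'⟩
      exact ⟨h', by rw [h']; exact h, h⟩
    · rintro ⟨h, -, h'⟩
      exact ⟨h', h⟩
  rw [hset]
  push_cast
  ring

theorem abs_charMoment_sub_le {k : ℕ} {x : ℝ} (hx : 0 ≤ x) (hxq : x ^ k ≤ q) :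
    |charMoment k q x - (solSet k ⌊x⌋₊ q.primeFactors).card| ≤
      (⌊x⌋₊ : ℝ) ^ (2 * k) / q.totient := by
  classical
  have hX : ⌊x⌋₊ ^ k ≤ q := by
    have : ((⌊x⌋₊ : ℝ)) ^ k ≤ q := (pow_le_pow_left₀ (Nat.cast_nonneg _) (Nat.floor_le hx) k).trans hxq
    exact_mod_cast this
  have hφ : (0 : ℝ) < q.totient := by
    exact_mod_cast Nat.totient_pos.mpr (Nat.pos_of_ne_zero (NeZero.ne q))
  have hall := card_solSet_eq_sum_char hX
  have hsplit := Finset.sum_filter_add_sum_filter_not Finset.univ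
    (fun χ : DirichletCharacter ℂ q => χ ≠ 1)
    fun χ => ‖∑ n ∈ Finset.Icc 1 ⌊x⌋₊, χ (n : ZMod q)‖ ^ (2 * k)
  have hone : (Finset.univ.filter fun χ : DirichletCharacter ℂ q => ¬ χ ≠ 1) = {1} := by
    ext χ; simp
  rw [hall, hone, Finset.sum_singleton] at hsplit
  set T : ℝ := ‖∑ n ∈ Finset.Icc 1 ⌊x⌋₊, (1 : DirichletCharacter ℂ q) (n : ZMod q)‖ with hT
  have hTle : T ≤ ⌊x⌋₊ := by
    refine (norm_sum_le _ _).trans ((Finset.sum_le_card_nsmul _ _ 1 fun n _ =>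
      DirichletCharacter.norm_le_one _ _).trans ?_)
    simp
  have hmom : charMoment k q x = (solSet k ⌊x⌋₊ q.primeFactors).card - T ^ (2 * k) / q.totient := by
    have h1 := eq_sub_of_add_eq hsplit
    rw [charMoment]
    convert congrArg (fun y => 1 / (q.totient : ℝ) * y) h1 using 1
    field_simp
  rw [hmom, sub_sub_cancel_left, abs_neg, abs_of_nonneg (by positivity)]
  gcongr

/-- Each factor `1 - 1/p` of `φ(q)/q` is at least `1/2`. This is where the bound on the number of
prime factors makes the principal character harmless. -/
theorem le_two_pow_mul_totient (q : ℕ) : (q : ℝ) ≤ 2 ^ q.primeFactors.card * q.totient := by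
  have h : (q.totient : ℝ) = q * ∏ p ∈ q.primeFactors, (1 - (p : ℝ)⁻¹) := by
    have := Nat.totient_eq_mul_prod_factors q
    have h' := congrArg (Rat.cast : ℚ → ℝ) this
    push_cast at h'
    exact h'
  rw [h, mul_left_comm, ← Finset.prod_const, ← Finset.prod_mul_distrib]
  refine le_mul_of_one_le_right (Nat.cast_nonneg _) ?_
  refine Finset.one_le_prod fun p hp => ?_
  have h2 : (2 : ℝ) ≤ p := by exact_mod_cast (Nat.prime_of_mem_primeFactors hp).two_le
  have h3 : (p : ℝ)⁻¹ ≤ 2⁻¹ := inv_anti₀ (by norm_num) h2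
  linarith

end Orthogonality

/-! ### Assembling the asymptotic formula. -/

section Limit

/-- A single point in dimension zero; it agrees with the convention `β(1) = 1`. -/
theorem birkhoffVol_zero : birkhoffVol 0 = 1 := by
  have h : marginPolytope 0 1 1 = Set.univ := by
    ext x
    simp [marginPolytope]
  rw [birkhoffVol, h, measureReal_def, volume_pi, Measure.pi_univ]
  simp

theorem Gamma_div_Gamma_sq_eq_centralBinom (d : ℕ) :
    Real.Gamma (2 * ((d + 1 : ℕ) : ℝ) - 1) / Real.Gamma ((d + 1 : ℕ) : ℝ) ^ 2 =
      d.centralBinom := by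
  have h1 : 2 * ((d + 1 : ℕ) : ℝ) - 1 = ((d + d : ℕ) : ℝ) + 1 := by push_cast; ring
  rw [h1, Real.Gamma_nat_eq_factorial, Nat.cast_succ, Real.Gamma_nat_eq_factorial,
    Nat.centralBinom_eq_two_mul_choose, two_mul, Nat.cast_add_choose, sq]

theorem beta_eq_birkhoffVol' (d : ℕ) {b : Fin (d + 1 - 1) → ℝ} (hb : ∀ i, 0 < b i)
    {c : Fin (d + 1) → ℝ} (hc : ∀ j, 0 < c j) : beta (d + 1) b c = (birkhoffVol d : ℂ) := by
  rcases Nat.eq_zero_or_pos d with rfl | hd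
  · rw [birkhoffVol_zero]
    simp [beta]
  · exact beta_eq_birkhoffVol hd hb hc

theorem tendsto_matScale_floor_div (d : ℕ) :
    Tendsto (fun x : ℝ => matScale d ⌊x⌋₊ / (x ^ (d + 1) * Real.log x ^ (d ^ 2))) atTop (𝓝 1) := by
  have h1 : Tendsto (fun x : ℝ => (⌊x⌋₊ : ℝ) / x) atTop (𝓝 1) := tendsto_nat_floor_div_atTop
  have h2 : Tendsto (fun x : ℝ => Real.log ⌊x⌋₊ / Real.log x) atTop (𝓝 1) := by
    have h3 : Tendsto (fun x : ℝ => 1 + Real.log ((⌊x⌋₊ : ℝ) / x) / Real.log x) atTop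
        (𝓝 (1 + 0)) := by
      refine tendsto_const_nhds.add ?_
      have h4 := h1.log one_ne_zero
      exact h4.div_atTop Real.tendsto_log_atTop
    rw [add_zero] at h3
    refine h3.congr' ?_
    filter_upwards [eventually_ge_atTop 2] with x hx
    have hx0 : x ≠ 0 := by linarith
    have hl : Real.log x ≠ 0 := (Real.log_pos (by linarith)).ne'
    have hf : ((⌊x⌋₊ : ℕ) : ℝ) ≠ 0 := by
      have : 1 ≤ ⌊x⌋₊ := Nat.le_floor (by push_cast; linarith)
      positivity
    rw [Real.log_div hf hx0]
    field_simp
    ring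
  have h := (h1.pow (d + 1)).mul (h2.pow (d ^ 2))
  rw [one_pow, one_pow, one_mul] at h
  refine h.congr fun x => ?_
  rw [matScale, div_pow, div_pow, div_mul_div_comm]

variable {ι : Type*} {l : Filter ι} {x : ι → ℝ} {q : ι → ℕ} {d B : ℕ}

/-- Relative to the main term the contribution is at most `2^B (x^{d+1}/q) / (log X)^{d²}`. For `d ≥
1` the bracket is at most `1` and the logarithm wins; for `d = 0` there is no logarithm, and `x/q →
0` is needed. -/
theorem tendsto_principal_term (hx : Tendsto x l atTop)
    (hω : ∀ᶠ i in l, (q i).primeFactors.card ≤ B) (hq : ∀ᶠ i in l, q i ≠ 0)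
    (hxq : ∀ᶠ i in l, x i ^ (d + 1) ≤ (q i : ℝ))
    (hd : d = 0 → Tendsto (fun i => x i / (q i : ℝ)) l (𝓝 0)) :
    Tendsto (fun i => (⌊x i⌋₊ : ℝ) ^ (2 * (d + 1)) / (q i).totient / matScale d ⌊x i⌋₊) l
      (𝓝 0) := by
  have hfl : Tendsto (fun i => ⌊x i⌋₊) l atTop := tendsto_nat_floor_atTop.comp hx
  have hlog : Tendsto (fun i => Real.log (⌊x i⌋₊ : ℝ)) l atTop :=
    Real.tendsto_log_atTop.comp (tendsto_natCast_atTop_atTop.comp hfl)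
  have hmain : Tendsto (fun i => 2 ^ B * (x i ^ (d + 1) / q i / Real.log ⌊x i⌋₊ ^ (d ^ 2))) l
      (𝓝 0) := by
    rw [← mul_zero ((2 : ℝ) ^ B)]
    refine Tendsto.const_mul _ ?_
    rcases Nat.eq_zero_or_pos d with rfl | hd0
    · simpa using hd rfl
    · have hinv : Tendsto (fun i => 1 / Real.log (⌊x i⌋₊ : ℝ) ^ (d ^ 2)) l (𝓝 0) :=
        tendsto_const_nhds.div_atTop ((tendsto_pow_atTop (by positivity)).comp hlog)
      refine squeeze_zero' ?_ ?_ hinv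
      · filter_upwards [hlog.eventually_ge_atTop 0, hx.eventually_ge_atTop 0] with i hi hi'
        positivity
      · filter_upwards [hlog.eventually_ge_atTop 0, hxq, hq] with i hi hi' hqi
        gcongr
        rw [div_le_one (by positivity)]
        exact hi'
  refine squeeze_zero' ?_ ?_ hmain
  · filter_upwards [hfl.eventually_ge_atTop 2] with i hi
    have := matScale_pos (d := d) hi
    positivity
  · filter_upwards [hfl.eventually_ge_atTop 2, hx.eventually_ge_atTop 0, hω, hq] with i hi hi' hωi hqi
    have hlogpos : 0 < Real.log (⌊x i⌋₊ : ℝ) := Real.log_pos (by exact_mod_cast hi)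
    have hX0 : (0 : ℝ) < ⌊x i⌋₊ := by exact_mod_cast (by omega : 0 < ⌊x i⌋₊)
    have hq0 : (0 : ℝ) < q i := by positivity
    have hφ : (0 : ℝ) < (q i).totient := by
      exact_mod_cast Nat.totient_pos.mpr (Nat.pos_of_ne_zero hqi)
    have hqφ : (q i : ℝ) ≤ 2 ^ B * (q i).totient :=
      (le_two_pow_mul_totient (q i)).trans (mul_le_mul_of_nonneg_right
        (pow_le_pow_right₀ one_le_two hωi) hφ.le)
    have hXx : (⌊x i⌋₊ : ℝ) ^ (d + 1) ≤ x i ^ (d + 1) :=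
      pow_le_pow_left₀ hX0.le (Nat.floor_le hi') _
    calc (⌊x i⌋₊ : ℝ) ^ (2 * (d + 1)) / (q i).totient / matScale d ⌊x i⌋₊
        = (⌊x i⌋₊ : ℝ) ^ (d + 1) / (q i).totient / Real.log ⌊x i⌋₊ ^ (d ^ 2) := by
          rw [matScale, two_mul, pow_add]; field_simp
      _ ≤ (2 ^ B * (x i ^ (d + 1) / q i)) / Real.log ⌊x i⌋₊ ^ (d ^ 2) := by
          gcongr
          rw [mul_div_assoc', div_le_div_iff₀ hφ hq0]
          calc (⌊x i⌋₊ : ℝ) ^ (d + 1) * q i ≤ x i ^ (d + 1) * (2 ^ B * (q i).totient) := by gcongr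
            _ = _ := by ring
      _ = _ := by rw [mul_div_assoc]

/-- The estimates so far are additive after division by `matScale`. They become a statement on
ratios because `V` is bounded below by a positive constant, as at most `B` local sums, each bounded,
enter its denominator. -/
theorem tendsto_charMoment_div [∀ i, NeZero (q i)] (hx : Tendsto x l atTop)
    (hω : ∀ᶠ i in l, (q i).primeFactors.card ≤ B)
    (hxq : ∀ᶠ i in l, x i ^ (d + 1) ≤ (q i : ℝ))
    (hd : d = 0 → Tendsto (fun i => x i / (q i : ℝ)) l (𝓝 0)) :
    Tendsto (fun i => charMoment (d + 1) (q i) (x i) /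
      ((matConst d * arithFactor (d + 1) * ∏ p ∈ (q i).primeFactors, (localSum (d + 1) p)⁻¹) *
        (x i ^ (d + 1) * Real.log (x i) ^ (d ^ 2)))) l (𝓝 1) := by
  have hfl : Tendsto (fun i => ⌊x i⌋₊) l atTop := tendsto_nat_floor_atTop.comp hx
  have hprime : ∀ i, ∀ p ∈ (q i).primeFactors, p.Prime := fun i p hp =>
    Nat.prime_of_mem_primeFactors hp
  set V : ι → ℝ := fun i => matConst d * arithFactor (d + 1) *
    ∏ p ∈ (q i).primeFactors, (localSum (d + 1) p)⁻¹ with hV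
  have hVpos : ∀ i, 0 < V i := fun i => mul_pos (mul_pos (matConst_pos d) (arithFactor_pos _))
    (prod_inv_localSum_pos _ (hprime i))
  obtain ⟨κ, hκ, hκle⟩ := exists_le_prod_inv_localSum (d + 1) B
  set κ' : ℝ := matConst d * arithFactor (d + 1) * κ with hκ'
  have hκ'0 : 0 < κ' := mul_pos (mul_pos (matConst_pos d) (arithFactor_pos _)) hκ
  have hVκ : ∀ᶠ i in l, κ' ≤ V i := by
    filter_upwards [hω] with i hi
    exact mul_le_mul_of_nonneg_left (hκle _ (hprime i) hi)
      (mul_pos (matConst_pos d) (arithFactor_pos _)).le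
  have hcard : Tendsto (fun i => ((solSet (d + 1) ⌊x i⌋₊ (q i).primeFactors).card : ℝ) /
      matScale d ⌊x i⌋₊ - V i) l (𝓝 0) := by
    rw [Metric.tendsto_nhds]
    intro ε hε
    -- Uniformity over all `R` is used here: the primes dividing `q i` change with `i`.
    filter_upwards [hfl.eventually (eventually_card_solSet_close d B (half_pos hε)), hω]
      with i hi hωi
    rw [Real.dist_eq, sub_zero]
    exact (hi _ (hprime i) hωi).trans_lt (half_lt_self hε)
  have herr : Tendsto (fun i => (charMoment (d + 1) (q i) (x i) -
      (solSet (d + 1) ⌊x i⌋₊ (q i).primeFactors).card) / matScale d ⌊x i⌋₊) l (𝓝 0) := by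
    refine squeeze_zero_norm' ?_ (tendsto_principal_term hx hω
      (Eventually.of_forall fun i => NeZero.ne (q i)) hxq hd)
    filter_upwards [hfl.eventually_ge_atTop 2, hx.eventually_ge_atTop 0, hxq] with i hi hi' hi''
    have hA := matScale_pos (d := d) hi
    rw [norm_div, Real.norm_of_nonneg hA.le, Real.norm_eq_abs]
    gcongr
    exact abs_charMoment_sub_le hi' hi''
  have hdiff : Tendsto (fun i => charMoment (d + 1) (q i) (x i) / matScale d ⌊x i⌋₊ - V i) l
      (𝓝 0) := by
    have h := herr.add hcard
    rw [add_zero] at h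
    refine h.congr fun i => ?_
    rw [sub_div]; ring
  have hrel : Tendsto (fun i => charMoment (d + 1) (q i) (x i) / matScale d ⌊x i⌋₊ / V i) l
      (𝓝 1) := by
    have h0 : Tendsto (fun i => (charMoment (d + 1) (q i) (x i) / matScale d ⌊x i⌋₊ - V i) / V i) l
        (𝓝 0) := by
      have hb := (hdiff.norm).div_const κ'
      rw [norm_zero, zero_div] at hb
      refine squeeze_zero_norm' ?_ hb
      filter_upwards [hVκ] with i hi
      rw [norm_div, Real.norm_of_nonneg (hVpos i).le]
      gcongr
    have h1 := h0.add_const 1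
    rw [zero_add] at h1
    refine h1.congr fun i => ?_
    have := (hVpos i).ne'
    field_simp
    ring
  have h := hrel.mul ((tendsto_matScale_floor_div d).comp hx)
  rw [one_mul] at h
  refine h.congr' ?_
  filter_upwards [hfl.eventually_ge_atTop 2] with i hi
  have hA := (matScale_pos (d := d) hi).ne'
  have hVi := (hVpos i).ne'
  simp only [Function.comp_apply]
  change _ = _ / (V i * _)
  rw [div_div, div_mul_div_comm, mul_comm (matScale d _) (V i), mul_right_comm,
    mul_div_mul_right _ _ hA]

end Limit

end CharSumMoments

theorem theorem2 (k : ℕ) (hk : 1 ≤ k)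
    (b : Fin (k - 1) → ℝ) (hb : ∀ i, 0 < b i) (c : Fin k → ℝ) (hc : ∀ j, 0 < c j)
    (B : ℕ) {ι : Type*} (l : Filter ι) (x : ι → ℝ) (q : ι → ℕ) [∀ i, NeZero (q i)]
    (hx : Filter.Tendsto x l Filter.atTop) (hq : Filter.Tendsto q l Filter.atTop)
    (hω : ∀ᶠ i in l, (q i).primeFactors.card ≤ B)
    (hxq : ∀ᶠ i in l, x i ^ k ≤ (q i : ℝ))
    (hk1 : k = 1 → Filter.Tendsto (fun i => x i / (q i : ℝ)) l (nhds 0)) :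
    Asymptotics.IsEquivalent l
      (fun i => (CharSumMoments.charMoment k (q i) (x i) : ℂ))
      (fun i =>
        (CharSumMoments.arithFactor k : ℂ) * CharSumMoments.beta k b c *
          ((∏ p ∈ (q i).primeFactors, (CharSumMoments.localSum k p)⁻¹ : ℝ) : ℂ) *
          ((Real.Gamma (2 * (k : ℝ) - 1) / Real.Gamma (k : ℝ) ^ 2 : ℝ) : ℂ) *
          ((x i ^ k * Real.log (x i) ^ ((k - 1) ^ 2) : ℝ) : ℂ)) := by
  obtain ⟨d, rfl⟩ : ∃ d, k = d + 1 := ⟨k - 1, by omega⟩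
  have hlim := CharSumMoments.tendsto_charMoment_div hx hω hxq fun hd => hk1 (by rw [hd])
  have hlimC := (Complex.continuous_ofReal.tendsto 1).comp hlim
  rw [Complex.ofReal_one] at hlimC
  -- The right hand side is real: `β` is a volume, and its product with the Gamma quotient is
  -- `matConst d`.
  have hrhs : ∀ i, (CharSumMoments.arithFactor (d + 1) : ℂ) * CharSumMoments.beta (d + 1) b c *
      ((∏ p ∈ (q i).primeFactors, (CharSumMoments.localSum (d + 1) p)⁻¹ : ℝ) : ℂ) *
      ((Real.Gamma (2 * ((d + 1 : ℕ) : ℝ) - 1) / Real.Gamma ((d + 1 : ℕ) : ℝ) ^ 2 : ℝ) : ℂ) *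
      ((x i ^ (d + 1) * Real.log (x i) ^ ((d + 1 - 1) ^ 2) : ℝ) : ℂ) =
      (((CharSumMoments.matConst d * CharSumMoments.arithFactor (d + 1) *
        ∏ p ∈ (q i).primeFactors, (CharSumMoments.localSum (d + 1) p)⁻¹) *
          (x i ^ (d + 1) * Real.log (x i) ^ (d ^ 2)) : ℝ) : ℂ) := by
    intro i
    rw [CharSumMoments.beta_eq_birkhoffVol' d hb hc,
      CharSumMoments.Gamma_div_Gamma_sq_eq_centralBinom, CharSumMoments.matConst,
      Nat.add_sub_cancel]
    push_cast
    ring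
  simp only [hrhs]
  refine (Asymptotics.isEquivalent_iff_tendsto_one ?_).mpr ?_
  · filter_upwards [hx.eventually_gt_atTop 1] with i hi
    rw [Complex.ofReal_ne_zero]
    refine (mul_pos (mul_pos (mul_pos (CharSumMoments.matConst_pos d)
      (CharSumMoments.arithFactor_pos _)) (CharSumMoments.prod_inv_localSum_pos _
        fun p hp => Nat.prime_of_mem_primeFactors hp)) (mul_pos (pow_pos (by linarith) _)
          (pow_pos (Real.log_pos hi) _))).ne'
  · refine hlimC.congr fun i => ?_
    simp only [Function.comp_apply, Pi.div_apply, Complex.ofReal_div]
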